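/- **Setting.** Let $n,d\ge 1$, let $\mathcal G$ be a connected undirected graph on $\{1,\dots,n\}$, and let $f_1,\dots,f_n:\mathbb R^d\to\mathbb R$ be differentiable, $\mu$-strongly convex and $L$-smooth with $\mu>0$, i.e. for all $x,y$ $$f_i(y)+\langle\nabla f_i(y),x-y\rangle+\tfrac{\mu}{2}\|x-y\|^2\le f_i(x)\le f_i(y)+\langle\nabla f_i(y),x-y\rangle+\tfrac{L}{2}\|x-y\|^2 .$$ Put $f=\frac1n\sum_i f_i$, let $x^*$ be its minimizer, and $\kappa=L/\mu$. Let $W\in\mathbb R^{n\times n}$ be symmetric, entrywise nonnegative, doubly stochastic, regular (some power $W^\ell$, $\ell\ge1$, is entrywise positive), positive semidefinite, and supported on $\mathcal G$ ($W_{ij}>0$ and $i\neq j$ imply that $ij$ is an edge). Put $\theta=1-\|W-\frac1n\mathbf 1\mathbf 1^\top\|$ (spectral norm), $\Pi=I-\frac1n\mathbf 1\mathbf 1^\top$, and $$\eta_0=\frac{1-\sqrt{1-(1-\theta)^2}}{1+\sqrt{1-(1-\theta)^2}},\quad \eta_w=\frac{1+\eta_0}{2},\quad \hat\theta=1-\sqrt{\eta_w},\quad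 \widetilde W=\begin{pmatrix}(1+\eta_w)W&-\eta_w I\\ I&0\end{pmatrix}.$$ For an $n\times d$ matrix $A$ write $A_\#=\binom{A}{A}$, $\|A\|$ for its Frobenius norm and $\bar a=\frac1n\mathbf 1^\top A$ for the average of its rows; $\nabla F(A)$ has rows $\nabla f_i(a_i)$. For a $2n\times d$ matrix $\widetilde A$, $A$ denotes its first $n$ rows. **Method (Optimal Gradient Tracking).** Let $\alpha,\beta,\gamma,\tau,p,q\in(0,1)$, $\eta>0$, and let $X^0\in\mathbb R^{n\times d}$ be arbitrary. Let $\xi^k\in\{0,1\}$, $\zeta^k\in\{0,1/q\}$ be random with $\Pr[\xi^k=1]=p$ and $\Pr[\zeta^k=1/q]=q$, the pairs $(\xi^k,\zeta^k)$, $k\ge0$, being independent (the dependence of $\xi^k$ and $\zeta^k$ for the same $k$ is arbitrary). Start with $Y^0=Q^0=X^0$, $\widetilde Z^0=\widetilde U^0=X^0_\#$, $\widetilde G^0=\nabla F(X^0)_\#$ and iterate $$\begin{aligned} X^k&=(1-\alpha-\tau)Y^k+\alpha Z^k+\tau U^k,\\ \widetilde Z^{k+1}&=(1+\beta)^{-1}\widetilde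 W\big(\widetilde Z^k+\beta X^k_\#-\eta G^k_\#+\eta\zeta^k(\nabla F(Q^k)_\#-\nabla F(X^k)_\#)\big),\\ Y^{k+1}&=X^k+\gamma(Z^{k+1}-Z^k),\qquad Q^{k+1}=(1-\xi^k)Q^k+\xi^kX^k,\\ \widetilde U^{k+1}&=\widetilde W\big((1-\xi^k)\widetilde U^k+\xi^kX^k_\#\big),\qquad \widetilde G^{k+1}=\widetilde W\widetilde G^k+\xi^k(\nabla F(X^k)_\#-\nabla F(Q^k)_\#). \end{aligned}$$ **Lyapunov function.** Put $c=14$, $\Delta_i=\mathbb E\|\nabla F(X^i)-\nabla F(Q^i)\|^2$, $e_i=\mathbb E\|\Pi X^i\|^2$ and $$\begin{aligned} \mathcal G^k&=\sum_{i<k}4cp(1-\hat\theta)^{k-1-i}\Delta_i+2c(1-\hat\theta)^k\|\Pi G^0\|^2,\\ \mathcal U^k&=\sum_{i<k}2cp(1-\hat\theta)^{2(k-i)}e_i+2c(1-\hat\theta)^{2k}\|\Pi U^0\|^2,\\ \mathcal Z^k&=\sum_{i<k}(1-\hat\theta)^{k-i}\Big(\tfrac{8c\beta^2}{\hat\theta}e_i+\tfrac{8c\eta^2}{\hat\theta}\mathcal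 G^i+2c\big(\tfrac{\eta^2}{q}+\tfrac{2\eta^2}{\hat\theta}\big)\Delta_i\Big)+2c(1-\hat\theta)^k\|\Pi Z^0\|^2,\\ \Psi^k&=\tfrac8\tau\Big(\mathbb E\big[\tfrac{\tau}{4p}\|\Pi Q^k\|^2+\tfrac{4(1-\tau)}{4-\tau}\|\Pi Y^k\|^2\big]+\tfrac{16}{\hat\theta}\mathcal U^k+\big(1-\tfrac{\hat\theta}{6}\big)\tfrac{48(1-\tau)\gamma^2}{\tau\hat\theta}\mathcal Z^k+\tfrac{1}{\hat\theta L^2}\mathcal G^k\Big), \end{aligned}$$ $$B=\tfrac{384(1-\tau)\gamma^2}{\tau^2\hat\theta}\big(\tfrac{\eta^2}{q}+\tfrac{2\eta^2}{\hat\theta}\big)+\tfrac{16p}{\tau\hat\theta L^2},\quad C_0=\Big(\tfrac{1-\alpha-\tau}{\alpha n}+\tfrac1{n\gamma}+\tfrac1n\Big)L,\quad D=\tfrac{C_0\tau q}{16\alpha\eta L},\quad \rho=\tfrac{\alpha p}{2\tau+\alpha},$$ $$\Phi^k=\mathbb E\Big[\tfrac1\gamma(f(\bar y^k)-f(x^*))+\tfrac{2\tau+\alpha}{2\alpha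 p}(f(\bar u^k)-f(x^*))+\tfrac{1+\beta}{2\eta}\|\bar z^k-x^*\|^2+D\,\Psi^k\Big].$$ **Theorem.** There is a universal constant $C>0$, independent of all the data, such that the following holds. 1. $\sqrt\theta\le C\,\hat\theta$ and $\hat\theta\le C\sqrt\theta$. 2. If $$\begin{gathered} \tfrac{2(1-\tau)}{2-\tau}+\tfrac{384c(1-\tau)\gamma^2\beta^2}{\tau\hat\theta^2}+\tfrac\tau4+\tfrac{32cp}{\hat\theta}\le1-\tfrac\tau8,\quad \tfrac{\alpha^2}{(1-\tau)\gamma^2}\le1,\quad \tfrac{384c(1-\tau)\gamma^2\eta^2L^2}{\tau\hat\theta}\le\tfrac{\hat\theta}2,\\ \tfrac{8\eta L^2}{qn}\le\tfrac{C_0}2,\quad cC_0B\le\tfrac{\eta}{qn},\quad \tfrac{32\eta L}{q}\le\tfrac\tau\alpha,\quad L\gamma\le\tfrac1{4\eta},\quad \tfrac{\beta}{2\eta}\le\tfrac\mu4,\\ \tfrac1\gamma-\tfrac{1-\alpha-\tau}{\alpha}-\tfrac12\le0,\quad \tfrac{1-\alpha-\tau}{\alpha}\le\tfrac1\gamma-\tfrac14,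 \end{gathered}$$ then for all $k\ge0$ $$\Phi^{k+1}\le\Big(1-\min\big\{\tfrac\gamma4,\rho,\tfrac{\beta}{1+\beta},\tfrac p2,\tau,\tfrac{\hat\theta}2\big\}\Big)\Phi^k .$$ 3. The choice $$\tau=\tfrac12,\quad p=q=\tfrac{\hat\theta}{60750},\quad \alpha=\tfrac{1}{45\sqrt\kappa},\quad \gamma=\tfrac{4\alpha}{4-4\tau-3\alpha},\quad \eta=\tfrac{\hat\theta\sqrt\kappa}{91125L},\quad \beta=\tfrac{\mu\eta}2$$ is in the admissible range and satisfies all inequalities of 2. 4. With this choice the method is executed by the agents with a single loop: agent $i$ stores the $i$-th rows of $Y^k$ and of both halves of $\widetilde Z^k,\widetilde U^k,\widetilde G^k$, and $\nabla f_i(q_i^k)$; it computes one gradient at initialization and, in iteration $k$, one gradient of $f_i$ if $\xi^k\ne0$ or $\zeta^k\ne0$ and none otherwise; each iteration uses one communication round, in which every agent sends three vectors of $\mathbb R^d$ to its neighbours in $\mathcal G$. This execution reproduces the iterates above, and for every $\varepsilon\in(0,\frac12]$ there is a $K$ such that $\Phi^k\le\varepsilon\Phi^0$ for all $k\ge K$,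 and the first $K$ iterations use at most $C\sqrt{\kappa/\theta}\,\log\frac1\varepsilon$ communication rounds and, for each agent, in expectation at most $C\sqrt\kappa\,\log\frac1\varepsilon$ gradient computations. -/

import Mathlib

open MeasureTheory ProbabilityTheory

noncomputable section

namespace OGT

/-! ## Row matrices -/

/-- Vectors of `ℝ^d` with the Euclidean norm. -/
abbrev Vec (d : ℕ) := EuclideanSpace ℝ (Fin d)

/-- Real matrices with `d` columns and rows indexed by `ι`, stored by rows.
`n`-by-`d` matrices have `ι = Fin n`; `2n`-by-`d` matrices have `ι = Fin n ⊕ Fin n`, the first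
summand being the first `n` rows. -/
abbrev Rows (ι : Type) (d : ℕ) := ι → Vec d

/-- The matrix product `M X`. -/
def mulRows {ι : Type} [Fintype ι] {d : ℕ} (M : Matrix ι ι ℝ) (X : Rows ι d) : Rows ι d :=
  fun i => ∑ j, M i j • X j

/-- The squared Frobenius norm. -/
def frobSq {ι : Type} [Fintype ι] {d : ℕ} (X : Rows ι d) : ℝ := ∑ i, ‖X i‖ ^ 2

/-- The average of the rows of an `n`-by-`d` matrix. -/
def rowAvg {n d : ℕ} (X : Rows (Fin n) d) : Vec d := (n : ℝ)⁻¹ • ∑ i, X i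

/-- The `2n`-by-`d` matrix made of two stacked copies of `A`. -/
def stack {n d : ℕ} (A : Rows (Fin n) d) : Rows (Fin n ⊕ Fin n) d := Sum.elim A A

/-- The first `n` rows of a `2n`-by-`d` matrix. -/
def top {n d : ℕ} (A : Rows (Fin n ⊕ Fin n) d) : Rows (Fin n) d := fun i => A (Sum.inl i)

/-- The matrix `𝟏𝟏ᵀ / n`. -/
def avgMatrix (n : ℕ) : Matrix (Fin n) (Fin n) ℝ := fun _ _ => (n : ℝ)⁻¹

/-- The projection `Π = I - 𝟏𝟏ᵀ / n`; `frobSq (mulRows (proj n) X)` is the consensus error of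
`X`. -/
def proj (n : ℕ) : Matrix (Fin n) (Fin n) ℝ := 1 - avgMatrix n

/-- The squared consensus error `‖Π X‖²`. -/
def consErr {n d : ℕ} (X : Rows (Fin n) d) : ℝ := frobSq (mulRows (proj n) X)

/-- The spectral norm of a real square matrix. -/
def specNorm {n : ℕ} (A : Matrix (Fin n) (Fin n) ℝ) : ℝ :=
  ‖Matrix.toEuclideanCLM (𝕜 := ℝ) A‖

/-! ## The problem -/

/-- The data of a decentralized problem with `n` agents in dimension `d`: communication graph,
gossip matrix, local objectives, the two constants, starting matrix, and a point `xs` (the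
minimizer of the average objective under `Problem.Assumptions`). -/
structure Problem (n d : ℕ) where
  G : SimpleGraph (Fin n)
  W : Matrix (Fin n) (Fin n) ℝ
  f : Fin n → Vec d → ℝ
  μ : ℝ
  L : ℝ
  X₀ : Rows (Fin n) d
  xs : Vec d

/-- `φ` is `μ`-strongly convex and `L`-smooth. -/
def IsStronglyConvexSmooth {d : ℕ} (μ L : ℝ) (φ : Vec d → ℝ) : Prop :=
  Differentiable ℝ φ ∧ ∀ x y : Vec d,
    φ y + inner ℝ (gradient φ y) (x - y) + μ / 2 * ‖x - y‖ ^ 2 ≤ φ x ∧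
    φ x ≤ φ y + inner ℝ (gradient φ y) (x - y) + L / 2 * ‖x - y‖ ^ 2

/-- `W` is a symmetric, doubly stochastic, regular, positive semidefinite matrix supported on the
graph `G`. -/
structure IsGossip {n : ℕ} (G : SimpleGraph (Fin n)) (W : Matrix (Fin n) (Fin n) ℝ) : Prop where
  symm : ∀ i j, W i j = W j i
  nonneg : ∀ i j, 0 ≤ W i j
  row_sum : ∀ i, ∑ j, W i j = 1
  col_sum : ∀ j, ∑ i, W i j = 1
  regular : ∃ l : ℕ, 0 < l ∧ ∀ i j, 0 < (W ^ l) i j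
  support : ∀ i j, i ≠ j → 0 < W i j → G.Adj i j
  psd : W.PosSemidef

/-- The spectral gap `θ = 1 - ‖W - 𝟏𝟏ᵀ / n‖`. -/
def gap {n : ℕ} (W : Matrix (Fin n) (Fin n) ℝ) : ℝ := 1 - specNorm (W - avgMatrix n)

/-- The momentum weight `(1 + η₀) / 2`, with
`η₀ = (1 - √(1 - (1 - θ)²)) / (1 + √(1 - (1 - θ)²))`. -/
def etaW (θ : ℝ) : ℝ :=
  (1 + (1 - √(1 - (1 - θ) ^ 2)) / (1 + √(1 - (1 - θ) ^ 2))) / 2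

/-- The accelerated gap `θ̂ = 1 - √(etaW θ)`. -/
def accGap (θ : ℝ) : ℝ := 1 - √(etaW θ)

namespace Problem

variable {n d : ℕ}

/-- The global objective, the average of the local ones. -/
def favg (I : Problem n d) (x : Vec d) : ℝ := (n : ℝ)⁻¹ * ∑ i, I.f i x

/-- Standing assumptions. -/
structure Assumptions (I : Problem n d) : Prop where
  connected : I.G.Connected
  gossip : IsGossip I.G I.W
  mu_pos : 0 < I.μ
  objective : ∀ i, IsStronglyConvexSmooth I.μ I.L (I.f i)
  minimizer : ∀ x, I.favg I.xs ≤ I.favg x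

/-- The condition number of the objective. -/
def κ (I : Problem n d) : ℝ := I.L / I.μ

/-- The spectral gap. -/
def θ (I : Problem n d) : ℝ := gap I.W

/-- The accelerated gap. -/
def θhat (I : Problem n d) : ℝ := accGap I.θ

/-- The matrix of local gradients, whose `i`-th row is `∇ f_i (x_i)`. -/
def gradF (I : Problem n d) (X : Rows (Fin n) d) : Rows (Fin n) d :=
  fun i => gradient (I.f i) (X i)

/-- The augmented `2n`-by-`2n` gossip matrix. -/
def augW (I : Problem n d) : Matrix (Fin n ⊕ Fin n) (Fin n ⊕ Fin n) ℝ :=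
  Matrix.fromBlocks ((1 + etaW I.θ) • I.W) (-(etaW I.θ) • (1 : Matrix (Fin n) (Fin n) ℝ))
    (1 : Matrix (Fin n) (Fin n) ℝ) 0

end Problem

/-! ## Optimal Gradient Tracking -/

/-- Parameters and stepsize of the method. -/
structure Params where
  α : ℝ
  β : ℝ
  γ : ℝ
  τ : ℝ
  p : ℝ
  q : ℝ
  η : ℝ

/-- The admissible range of the inputs of the method. -/
structure Params.Valid (r : Params) : Prop where
  α_mem : r.α ∈ Set.Ioo (0 : ℝ) 1
  β_mem : r.β ∈ Set.Ioo (0 : ℝ) 1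
  γ_mem : r.γ ∈ Set.Ioo (0 : ℝ) 1
  τ_mem : r.τ ∈ Set.Ioo (0 : ℝ) 1
  p_mem : r.p ∈ Set.Ioo (0 : ℝ) 1
  q_mem : r.q ∈ Set.Ioo (0 : ℝ) 1
  η_pos : 0 < r.η

/-- The variables carried from one iteration to the next. -/
structure State (n d : ℕ) where
  Y : Rows (Fin n) d
  Zt : Rows (Fin n ⊕ Fin n) d
  Ut : Rows (Fin n ⊕ Fin n) d
  Gt : Rows (Fin n ⊕ Fin n) d
  Q : Rows (Fin n) d

namespace State

variable {n d : ℕ}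

def Z (s : State n d) : Rows (Fin n) d := top s.Zt

def U (s : State n d) : Rows (Fin n) d := top s.Ut

def Gr (s : State n d) : Rows (Fin n) d := top s.Gt

/-- `X^k = (1 - α - τ) Y^k + α Z^k + τ U^k`. -/
def X (r : Params) (s : State n d) : Rows (Fin n) d :=
  (1 - r.α - r.τ) • s.Y + r.α • s.Z + r.τ • s.U

end State

variable {n d : ℕ}

/-- Initial values. -/
def initState (I : Problem n d) : State n d where
  Y := I.X₀
  Zt := stack I.X₀
  Ut := stack I.X₀
  Gt := stack (I.gradF I.X₀)
  Q := I.X₀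

/-- The updated `Z̃^{k+1}`, for the value `ζ` of `ζ^k`. -/
def nextZt (I : Problem n d) (r : Params) (ζ : ℝ) (s : State n d) : Rows (Fin n ⊕ Fin n) d :=
  (1 + r.β)⁻¹ • mulRows I.augW
    (s.Zt + r.β • stack (s.X r) - r.η • stack s.Gr
      + (r.η * ζ) • (stack (I.gradF s.Q) - stack (I.gradF (s.X r))))

/-- One iteration, for the values `ξ`, `ζ` of `ξ^k`, `ζ^k`. -/
def step (I : Problem n d) (r : Params) (ξ ζ : ℝ) (s : State n d) : State n d where
  Y := s.X r + r.γ • (top (nextZt I r ζ s) - s.Z)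
  Zt := nextZt I r ζ s
  Ut := mulRows I.augW ((1 - ξ) • s.Ut + ξ • stack (s.X r))
  Gt := mulRows I.augW s.Gt + ξ • (stack (I.gradF (s.X r)) - stack (I.gradF s.Q))
  Q := (1 - ξ) • s.Q + ξ • s.X r

/-- The iterates along sequences `ξ^0, ξ^1, …` and `ζ^0, ζ^1, …`. -/
def iter (I : Problem n d) (r : Params) (ξ ζ : ℕ → ℝ) : ℕ → State n d
  | 0 => initState I
  | k + 1 => step I r (ξ k) (ζ k) (iter I r ξ ζ k)

/-- The random inputs: `ξ^k ∼ Bernoulli(p)` and `ζ^k ∼ Bernoulli(q) / q` are two-point random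
variables, and the pairs `(ξ^k, ζ^k)`, `k ≥ 0`, are independent. The dependence between `ξ^k` and
`ζ^k` with the same `k` is left free. -/
structure Sampling {Ω : Type*} [MeasurableSpace Ω] (P : Measure Ω) (p q : ℝ)
    (ξ ζ : ℕ → Ω → ℝ) : Prop where
  measurable_ξ : ∀ k, Measurable (ξ k)
  measurable_ζ : ∀ k, Measurable (ζ k)
  values_ξ : ∀ k ω, ξ k ω = 0 ∨ ξ k ω = 1
  values_ζ : ∀ k ω, ζ k ω = 0 ∨ ζ k ω = 1 / q
  prob_ξ : ∀ k, P.real {ω | ξ k ω = 1} = p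
  prob_ζ : ∀ k, P.real {ω | ζ k ω = 1 / q} = q
  indep : iIndepFun (fun k ω => (ξ k ω, ζ k ω)) P

/-! ## Lyapunov function -/

section Lyapunov

variable {Ω : Type*} [MeasurableSpace Ω] (P : Measure Ω)
  (I : Problem n d) (r : Params) (ξ ζ : ℕ → Ω → ℝ)

/-- The state after `k` iterations, as a random variable. -/
def rv (k : ℕ) (ω : Ω) : State n d := iter I r (fun j => ξ j ω) (fun j => ζ j ω) k

/-- `E ‖∇F(X^k) - ∇F(Q^k)‖²`. -/
def gradDiff (k : ℕ) : ℝ :=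
  ∫ ω, frobSq (I.gradF ((rv I r ξ ζ k ω).X r) - I.gradF (rv I r ξ ζ k ω).Q) ∂P

/-- `E ‖Π X^k‖²`. -/
def errX (k : ℕ) : ℝ := ∫ ω, consErr ((rv I r ξ ζ k ω).X r) ∂P

/-- The constant of the loopless Chebyshev acceleration bound. -/
def cheb : ℝ := 14

/-- Majorant of the consensus error of `G̃^k`. -/
def majG (k : ℕ) : ℝ :=
  (∑ i ∈ Finset.range k,
      4 * cheb * r.p * (1 - I.θhat) ^ (k - 1 - i) * gradDiff P I r ξ ζ i)
    + 2 * cheb * (1 - I.θhat) ^ k * consErr (initState I).Gr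

/-- Majorant of the consensus error of `Ũ^k`. -/
def majU (k : ℕ) : ℝ :=
  (∑ i ∈ Finset.range k,
      2 * cheb * r.p * (1 - I.θhat) ^ (2 * (k - i)) * errX P I r ξ ζ i)
    + 2 * cheb * (1 - I.θhat) ^ (2 * k) * consErr (initState I).U

/-- Majorant of the consensus error of `Z̃^k`. -/
def majZ (k : ℕ) : ℝ :=
  (∑ i ∈ Finset.range k, (1 - I.θhat) ^ (k - i) *
      (8 * cheb * r.β ^ 2 / I.θhat * errX P I r ξ ζ i
        + 8 * cheb * r.η ^ 2 / I.θhat * majG P I r ξ ζ i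
        + 2 * cheb * (r.η ^ 2 / r.q + 2 * r.η ^ 2 / I.θhat) * gradDiff P I r ξ ζ i))
    + 2 * cheb * (1 - I.θhat) ^ k * consErr (initState I).Z

/-- The Lyapunov function of the consensus errors. -/
def consLyap (k : ℕ) : ℝ :=
  8 / r.τ *
    ((∫ ω, (r.τ / (4 * r.p) * consErr (rv I r ξ ζ k ω).Q
          + 4 * (1 - r.τ) / (4 - r.τ) * consErr (rv I r ξ ζ k ω).Y) ∂P)
      + 16 / I.θhat * majU P I r ξ ζ k
      + (1 - I.θhat / 6) * (48 * (1 - r.τ) * r.γ ^ 2 / (r.τ * I.θhat)) * majZ P I r ξ ζ k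
      + 1 / (I.θhat * I.L ^ 2) * majG P I r ξ ζ k)

/-- `((1 - α - τ) / (α n) + 1 / (n γ) + 1 / n) L`. -/
def constC : ℝ :=
  ((1 - r.α - r.τ) / (r.α * n) + 1 / (n * r.γ) + 1 / n) * I.L

/-- The weight of the consensus part in the full Lyapunov function. -/
def constD : ℝ := constC I r * r.τ * r.q / (16 * r.α * r.η * I.L)

/-- The weight of the gradient differences in the decrease of the consensus part. -/
def constB : ℝ :=
  384 * (1 - r.τ) * r.γ ^ 2 / (r.τ ^ 2 * I.θhat) * (r.η ^ 2 / r.q + 2 * r.η ^ 2 / I.θhat)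
    + 16 * r.p / (r.τ * I.θhat * I.L ^ 2)

/-- The Lyapunov function of the method. -/
def lyap (k : ℕ) : ℝ :=
  ∫ ω, (1 / r.γ * (I.favg (rowAvg (rv I r ξ ζ k ω).Y) - I.favg I.xs)
      + (2 * r.τ + r.α) / (2 * r.α * r.p)
          * (I.favg (rowAvg (rv I r ξ ζ k ω).U) - I.favg I.xs)
      + (1 + r.β) / (2 * r.η) * ‖rowAvg (rv I r ξ ζ k ω).Z - I.xs‖ ^ 2
      + constD I r * consLyap P I r ξ ζ k) ∂P

/-- The constant `ρ = α p / (2 τ + α)`. -/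
def rho : ℝ := r.α * r.p / (2 * r.τ + r.α)

/-- `min {γ/4, ρ, β/(1+β), p/2, τ, θ̂/2}`. -/
def rate : ℝ :=
  min (r.γ / 4) (min (rho r) (min (r.β / (1 + r.β)) (min (r.p / 2) (min r.τ (I.θhat / 2)))))

/-- The inequalities required of the parameters and the stepsize. -/
structure Conditions : Prop where
  cons₁ : 2 * (1 - r.τ) / (2 - r.τ)
      + 384 * cheb * (1 - r.τ) * r.γ ^ 2 * r.β ^ 2 / (r.τ * I.θhat ^ 2)
      + r.τ / 4 + 32 * cheb * r.p / I.θhat ≤ 1 - r.τ / 8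
  cons₂ : r.α ^ 2 / ((1 - r.τ) * r.γ ^ 2) ≤ 1
  cons₃ : 384 * cheb * (1 - r.τ) * r.γ ^ 2 * r.η ^ 2 * I.L ^ 2 / (r.τ * I.θhat) ≤ I.θhat / 2
  diff₁ : 8 * r.η * I.L ^ 2 / (r.q * n) ≤ constC I r / 2
  diff₂ : cheb * constC I r * constB I r ≤ r.η / (r.q * n)
  diff₃ : 32 * r.η * I.L / r.q ≤ r.τ / r.α
  main₁ : I.L * r.γ ≤ 1 / (4 * r.η)
  main₂ : r.β / (2 * r.η) ≤ I.μ / 4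
  main₃ : 1 / r.γ - (1 - r.α - r.τ) / r.α - 1 / 2 ≤ 0
  main₄ : (1 - r.α - r.τ) / r.α ≤ 1 / r.γ - 1 / 4

/-- The explicit choice of the parameters and the stepsize. -/
def explicitParams : Params where
  τ := 1 / 2
  p := I.θhat / 60750
  q := I.θhat / 60750
  α := 1 / (45 * √I.κ)
  γ := 4 * (1 / (45 * √I.κ)) / (4 - 4 * (1 / 2) - 3 * (1 / (45 * √I.κ)))
  η := I.θhat * √I.κ / (91125 * I.L)
  β := I.μ * (I.θhat * √I.κ / (91125 * I.L)) / 2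

end Lyapunov

/-! ## Decentralized execution

The agents run synchronously. In every pass through the (only) loop an agent first computes
locally, with access to its objective only through gradient queries, then broadcasts three vectors
of `ℝ^d` to its neighbours, and finally updates its memory from what it has received. Gradient
queries and communication rounds are counted. -/

/-- A local computation with result in `B` that may query the gradient of the agent's own
objective. -/
inductive Prog (E B : Type) : Type
  | done (b : B) : Prog E B
  | query (x : E) (next : E → Prog E B) : Prog E B

/-- The result, when queries are answered by `g`. -/
def Prog.eval {E B : Type} (g : E → E) : Prog E B → B
  | .done b => b
  | .query x next => (next (g x)).eval g

/-- The number of gradients computed, when queries are answered by `g`. -/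
def Prog.cost {E B : Type} (g : E → E) : Prog E B → ℕ
  | .done _ => 0
  | .query x next => (next (g x)).cost g + 1

/-- The memory of one agent: its row of `Y`, its two rows of each of `Z̃`, `Ũ`, `G̃`, and the
stored gradient `m`. -/
structure Agent (d : ℕ) where
  y : Vec d
  z₁ : Vec d
  z₂ : Vec d
  u₁ : Vec d
  u₂ : Vec d
  g₁ : Vec d
  g₂ : Vec d
  m : Vec d

/-- What an agent broadcasts in one communication round. -/
structure Message (d : ℕ) where
  z : Vec d
  u : Vec d
  g : Vec d

/-- The outcome of the local phase: the outgoing message, and what the agent keeps for the update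
(the new point `x`, the second rows of the arguments of the two products for `Z̃` and `Ũ`, and the
new stored gradient). -/
structure Local (d : ℕ) where
  msg : Message d
  x : Vec d
  z₂ : Vec d
  u₂ : Vec d
  m : Vec d

/-- The agent's row of `X`. -/
def Agent.x (r : Params) (a : Agent d) : Vec d :=
  (1 - r.α - r.τ) • a.y + r.α • a.z₁ + r.τ • a.u₁

/-- The outcome of the local phase when `v` is the gradient at the new point; `v` is used only if
`ξ ≠ 0` or `ζ ≠ 0`. -/
def Agent.localWith (r : Params) (ξ ζ : ℝ) (a : Agent d) (v : Vec d) : Local d where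
  msg :=
    { z := a.z₁ + r.β • a.x r - r.η • a.g₁ + (if ζ = 0 then 0 else (r.η / r.q) • (a.m - v))
      u := if ξ = 0 then a.u₁ else a.x r
      g := a.g₁ }
  x := a.x r
  z₂ := a.z₂ + r.β • a.x r - r.η • a.g₁ + (if ζ = 0 then 0 else (r.η / r.q) • (a.m - v))
  u₂ := if ξ = 0 then a.u₂ else a.x r
  m := if ξ = 0 then a.m else v

/-- The local phase: the gradient is computed only if `ξ ≠ 0` or `ζ ≠ 0`. -/
def Agent.localPhase (r : Params) (ξ ζ : ℝ) (a : Agent d) : Prog (Vec d) (Local d) :=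
  if ξ = 0 ∧ ζ = 0 then .done (a.localWith r ξ ζ 0)
  else .query (a.x r) fun v => .done (a.localWith r ξ ζ v)

/-- The initialization of an agent. -/
def Agent.start (x₀ : Vec d) : Prog (Vec d) (Agent d) :=
  .query x₀ fun v => .done ⟨x₀, x₀, x₀, x₀, x₀, v, v, v⟩

open scoped Classical in
/-- The weighted sum, at agent `i`, of vectors sent by its neighbours and its own one. -/
def mix (I : Problem n d) (i : Fin n) (v : Fin n → Vec d) : Vec d :=
  ∑ j with j = i ∨ I.G.Adj i j, I.W i j • v j

/-- The update of agent `i` with memory `a`, own local outcome `l`, and received messages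
`inbox`. -/
def Agent.update (I : Problem n d) (r : Params) (i : Fin n) (a : Agent d) (l : Local d)
    (inbox : Fin n → Message d) : Agent d :=
  let z₁ := (1 + r.β)⁻¹ •
    ((1 + etaW I.θ) • mix I i (fun j => (inbox j).z) - etaW I.θ • l.z₂)
  { y := l.x + r.γ • (z₁ - a.z₁)
    z₁ := z₁
    z₂ := (1 + r.β)⁻¹ • l.msg.z
    u₁ := (1 + etaW I.θ) • mix I i (fun j => (inbox j).u) - etaW I.θ • l.u₂
    u₂ := l.msg.u
    g₁ := (1 + etaW I.θ) • mix I i (fun j => (inbox j).g) - etaW I.θ • a.g₂ + (l.m - a.m)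
    g₂ := l.msg.g + (l.m - a.m)
    m := l.m }

/-- The network: memories, number of gradients computed so far by each agent, and number of
communication rounds so far. -/
structure Network (n d : ℕ) where
  agent : Fin n → Agent d
  grads : Fin n → ℕ
  rounds : ℕ

/-- The network after the initialization. -/
def Network.start (I : Problem n d) : Network n d where
  agent i := (Agent.start (I.X₀ i)).eval (gradient (I.f i))
  grads i := (Agent.start (I.X₀ i)).cost (gradient (I.f i))
  rounds := 0

/-- One pass through the loop: local phase, one communication round, update. -/
def Network.step (I : Problem n d) (r : Params) (ξ ζ : ℝ) (N : Network n d) : Network n d :=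
  let out : Fin n → Local d := fun i =>
    ((N.agent i).localPhase r ξ ζ).eval (gradient (I.f i))
  { agent := fun i => (N.agent i).update I r i (out i) (fun j => (out j).msg)
    grads := fun i => N.grads i + ((N.agent i).localPhase r ξ ζ).cost (gradient (I.f i))
    rounds := N.rounds + 1 }

/-- The execution of `k` passes through the loop. -/
def run (I : Problem n d) (r : Params) (ξ ζ : ℕ → ℝ) : ℕ → Network n d
  | 0 => Network.start I
  | k + 1 => (run I r ξ ζ k).step I r (ξ k) (ζ k)

/-- The part of a state of the matrix iteration that belongs to agent `i`. -/
def State.agent (I : Problem n d) (s : State n d) (i : Fin n) : Agent d where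
  y := s.Y i
  z₁ := s.Zt (Sum.inl i)
  z₂ := s.Zt (Sum.inr i)
  u₁ := s.Ut (Sum.inl i)
  u₂ := s.Ut (Sum.inr i)
  g₁ := s.Gt (Sum.inl i)
  g₂ := s.Gt (Sum.inr i)
  m := gradient (I.f i) (s.Q i)

end OGT

end

/-!
The proof has two layers, coupled by the weight `D`.

*Consensus.* On the complement of the constants, `W` is diagonalized by an orthonormal eigenbasis of
`W - 𝟏𝟏ᵀ/n` with eigenvalues in `[0, 1 - θ]` (`IsGossip.exists_eigenbasis`). In each eigencomponent
the augmented matrix acts by a two-term recursion whose characteristic roots are complex of modulus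
`√η_w = 1 - θ̂`. A quadratic form that the recursion multiplies by `η_w` then yields
`‖Π (W̃^k B_#)‖² ≤ 14 (1 - θ̂)^(2k) ‖Π B‖²` for the upper half (`consErr_augW_pow_le`). Since a single
step need not contract, errors are followed through the property `Decay`, which is stable under the operations of
the method; this dominates `Π G^k`, `Π U^k`, `Π Z^k` by scalar processes whose second moments obey the
recursions defining the majorants (`consErr_G_le`, `consErr_U_le`, `consErr_Z_le`). For `G` the
summands are correlated through the past, and it is essential that the second moment is taken step
by step, using that `p` is small compared with `θ̂`. Young's and Jensen's inequalities for `X^k` and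
`Y^k` then give `Ψ^{k+1} ≤ (1 - t) Ψ^k - E‖Π X^k‖² - E‖Π Q^k‖² + 2 c B Δ_k` (`consLyap_succ_le`).

*Optimization.* The row averages follow an accelerated variance-reduced gradient method: `ū = q̄`, the
tracked gradient averages to that at `Q` (`Balanced`), and the linear models of the `f_i` at the rows
of `X` are an inexact oracle for `f` at `x̄` whose error is the consensus error of `X`
(`model_lower`, `model_upper`, `model_lower_of_gradDiff`). The three-point identity for `z̄` and the
coupling of `x̄` with `ȳ`, `z̄`, `ū` give the descent (`descent`, `mainLyap_succ_le`) up to multiples of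
`E‖Π X^k‖²` and `E‖Π Q^k‖²`, and with a negative multiple of `Δ_k`. The conditions on the
parameters make `D` large enough to absorb the former and small enough not to exhaust the latter
(`Conditions.constD_bounds`), whence `lyap_succ_le`.

All random inputs take finitely many values, so functions of the past (`Past`) are bounded and
measurable, and conditional expectations reduce to `integral_le_of_affine`.

For the explicit parameters the rate is at least a constant times `θ̂ / √κ`, and `θ̂` is of the order
of `√θ`; an agent computes a gradient with probability at most `p + q`, of the order of `θ̂`, in each
iteration. This gives the two complexities.
-/

namespace OGT

/-! ### Row matrices and the consensus seminorm -/

section RowMatrices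

variable {ι : Type} [Fintype ι] {n d : ℕ}

theorem mulRows_add (M : Matrix ι ι ℝ) (X Y : Rows ι d) :
    mulRows M (X + Y) = mulRows M X + mulRows M Y := by
  funext i
  simp [mulRows, Finset.sum_add_distrib]

theorem mulRows_smul (M : Matrix ι ι ℝ) (a : ℝ) (X : Rows ι d) :
    mulRows M (a • X) = a • mulRows M X := by
  funext i
  simp only [mulRows, Pi.smul_apply, Finset.smul_sum]
  exact Finset.sum_congr rfl fun j _ => smul_comm _ _ _

theorem mulRows_mul [DecidableEq ι] (M N : Matrix ι ι ℝ) (X : Rows ι d) :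
    mulRows (M * N) X = mulRows M (mulRows N X) := by
  funext i
  simp only [mulRows, Matrix.mul_apply, Finset.sum_smul, Finset.smul_sum, smul_smul]
  rw [Finset.sum_comm]

theorem mulRows_one [DecidableEq ι] (X : Rows ι d) : mulRows (1 : Matrix ι ι ℝ) X = X := by
  funext i
  simp [mulRows, Matrix.one_apply, ite_smul]

theorem mulRows_sub_left (M N : Matrix ι ι ℝ) (X : Rows ι d) :
    mulRows (M - N) X = mulRows M X - mulRows N X := by
  funext i
  simp [mulRows, sub_smul, Finset.sum_sub_distrib]

theorem mulRows_avgMatrix (X : Rows (Fin n) d) (i : Fin n) :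
    mulRows (avgMatrix n) X i = rowAvg X := by
  simp [mulRows, avgMatrix, rowAvg, Finset.smul_sum]

theorem mulRows_proj (X : Rows (Fin n) d) (i : Fin n) :
    mulRows (proj n) X i = X i - rowAvg X := by
  rw [proj, mulRows_sub_left, mulRows_one, Pi.sub_apply, mulRows_avgMatrix]

theorem rowAvg_add (X Y : Rows (Fin n) d) : rowAvg (X + Y) = rowAvg X + rowAvg Y := by
  simp [rowAvg, Finset.sum_add_distrib]

theorem rowAvg_sub (X Y : Rows (Fin n) d) : rowAvg (X - Y) = rowAvg X - rowAvg Y := by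
  simp [rowAvg, Finset.sum_sub_distrib, smul_sub]

theorem rowAvg_smul (a : ℝ) (X : Rows (Fin n) d) : rowAvg (a • X) = a • rowAvg X := by
  simp only [rowAvg, Pi.smul_apply, ← Finset.smul_sum]
  exact smul_comm _ _ _

theorem frobSq_nonneg (X : Rows ι d) : 0 ≤ frobSq X :=
  Finset.sum_nonneg fun _ _ => sq_nonneg _

/-- The Frobenius norm, as the norm of the `ℓ²` product of the rows. -/
noncomputable def fnorm (X : Rows ι d) : ℝ := ‖(WithLp.toLp 2 X : PiLp 2 fun _ : ι => Vec d)‖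

theorem fnorm_nonneg (X : Rows ι d) : 0 ≤ fnorm X := norm_nonneg _

theorem fnorm_sq (X : Rows ι d) : fnorm X ^ 2 = frobSq X := by
  rw [fnorm, PiLp.norm_sq_eq_of_L2, frobSq]

theorem fnorm_add_le (X Y : Rows ι d) : fnorm (X + Y) ≤ fnorm X + fnorm Y := by
  simp only [fnorm, WithLp.toLp_add]
  exact norm_add_le _ _

theorem fnorm_smul (a : ℝ) (X : Rows ι d) : fnorm (a • X) = |a| * fnorm X := by
  simp only [fnorm, WithLp.toLp_smul, norm_smul, Real.norm_eq_abs]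

/-- The consensus seminorm `‖Π X‖`. -/
noncomputable def cnorm (X : Rows (Fin n) d) : ℝ := fnorm (mulRows (proj n) X)

theorem cnorm_nonneg (X : Rows (Fin n) d) : 0 ≤ cnorm X := fnorm_nonneg _

theorem cnorm_sq (X : Rows (Fin n) d) : cnorm X ^ 2 = consErr X := fnorm_sq _

theorem consErr_nonneg (X : Rows (Fin n) d) : 0 ≤ consErr X := frobSq_nonneg _

theorem cnorm_add_le (X Y : Rows (Fin n) d) : cnorm (X + Y) ≤ cnorm X + cnorm Y := by
  simp only [cnorm, mulRows_add]
  exact fnorm_add_le _ _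

theorem cnorm_smul (a : ℝ) (X : Rows (Fin n) d) : cnorm (a • X) = |a| * cnorm X := by
  simp only [cnorm, mulRows_smul, fnorm_smul]

theorem consErr_eq (X : Rows (Fin n) d) : consErr X = ∑ i, ‖X i - rowAvg X‖ ^ 2 := by
  simp only [consErr, frobSq, mulRows_proj]

theorem sum_sub_rowAvg (hn : 0 < n) (X : Rows (Fin n) d) : ∑ i, (X i - rowAvg X) = 0 := by
  have : (n : ℝ) ≠ 0 := by positivity
  simp [Finset.sum_sub_distrib, rowAvg, ← Nat.cast_smul_eq_nsmul ℝ, smul_smul, this]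

/-- The mean square distance to a point splits into the distance of the average and the consensus
error. -/
theorem sum_norm_sub_sq (hn : 0 < n) (X : Rows (Fin n) d) (x : Vec d) :
    ∑ i, ‖x - X i‖ ^ 2 = n * ‖x - rowAvg X‖ ^ 2 + consErr X := by
  have h1 : ∀ i, ‖x - X i‖ ^ 2 = ‖x - rowAvg X‖ ^ 2
      - 2 * inner ℝ (x - rowAvg X) (X i - rowAvg X) + ‖X i - rowAvg X‖ ^ 2 := by
    intro i
    rw [← norm_sub_sq_real]
    congr 2
    abel
  simp only [h1, Finset.sum_add_distrib, Finset.sum_sub_distrib, ← Finset.mul_sum, ← inner_sum,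
    sum_sub_rowAvg hn, inner_zero_right, consErr_eq]
  simp

/-- Jensen's inequality for the average of the rows. -/
theorem rowAvg_norm_sq_le (hn : 0 < n) (X : Rows (Fin n) d) :
    ‖rowAvg X‖ ^ 2 ≤ (n : ℝ)⁻¹ * frobSq X := by
  have h := sum_norm_sub_sq hn X 0
  have hn' : (0 : ℝ) < n := by exact_mod_cast hn
  have h0 := consErr_nonneg X
  simp only [zero_sub, norm_neg] at h
  rw [le_inv_mul_iff₀ hn', frobSq]
  linarith

end RowMatrices

/-! ### Spectral gap of the gossip matrix -/

section SpectralGap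

variable {n : ℕ} {G : SimpleGraph (Fin n)} {W : Matrix (Fin n) (Fin n) ℝ}

theorem avgMatrix_mul_self (hn : 0 < n) : avgMatrix n * avgMatrix n = avgMatrix n := by
  have : (n : ℝ) ≠ 0 := by positivity
  ext i j
  simp [Matrix.mul_apply, avgMatrix, this]

theorem IsGossip.mul_avg (h : IsGossip G W) : W * avgMatrix n = avgMatrix n := by
  ext i j
  simp [Matrix.mul_apply, avgMatrix, ← Finset.sum_mul, h.row_sum]

theorem IsGossip.avg_mul (h : IsGossip G W) : avgMatrix n * W = avgMatrix n := by
  ext i j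
  simp [Matrix.mul_apply, avgMatrix, ← Finset.mul_sum, h.col_sum]

theorem proj_transpose : (proj n).transpose = proj n := by
  ext i j
  simp [proj, avgMatrix, Matrix.one_apply, eq_comm]

theorem IsGossip.proj_mul_mul_proj (hn : 0 < n) (h : IsGossip G W) :
    proj n * W * proj n = W - avgMatrix n := by
  simp only [proj, sub_mul, mul_sub, one_mul, mul_one, h.avg_mul, h.mul_avg, avgMatrix_mul_self hn]
  abel

theorem IsGossip.posSemidef_sub_avg (hn : 0 < n) (h : IsGossip G W) :
    (W - avgMatrix n).PosSemidef := by
  have := h.psd.mul_mul_conjTranspose_same (proj n)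
  rwa [Matrix.conjTranspose_eq_transpose_of_trivial, proj_transpose,
    h.proj_mul_mul_proj hn] at this

theorem IsGossip.row_sum_pow (h : IsGossip G W) (l : ℕ) (i : Fin n) : ∑ j, (W ^ l) i j = 1 := by
  induction l generalizing i with
  | zero => simp [Matrix.one_apply]
  | succ l ih =>
    simp only [pow_succ, Matrix.mul_apply]
    rw [Finset.sum_comm]
    simp [← Finset.mul_sum, h.row_sum, ih]

/-- A Perron–Frobenius argument: an eigenvector of `W - 𝟏𝟏ᵀ/n` for an eigenvalue at least
one would have mean zero, and a positive power of `W` would force it to be constant. -/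
theorem IsGossip.eigenvalue_lt_one (hn : 0 < n) (h : IsGossip G W) {lam : ℝ} {v : Fin n → ℝ}
    (hv : v ≠ 0) (he : (W - avgMatrix n).mulVec v = lam • v) : lam < 1 := by
  by_contra! hl
  have hJ : (avgMatrix n).mulVec v = 0 := by
    have h1 : (avgMatrix n).mulVec ((W - avgMatrix n).mulVec v) = 0 := by
      rw [Matrix.mulVec_mulVec, mul_sub, h.avg_mul, avgMatrix_mul_self hn, sub_self,
        Matrix.zero_mulVec]
    rw [he, Matrix.mulVec_smul] at h1
    exact (smul_eq_zero.1 h1).resolve_left (by linarith)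
  have hn' : (0 : ℝ) < n := by exact_mod_cast hn
  have hsum : ∑ j, v j = 0 := by
    have h1 := congrFun hJ ⟨0, hn⟩
    simp only [Matrix.mulVec, dotProduct, avgMatrix, ← Finset.mul_sum, Pi.zero_apply] at h1
    exact (mul_eq_zero.1 h1).resolve_left (by positivity)
  have hW : W.mulVec v = lam • v := by rw [← he, Matrix.sub_mulVec, hJ, sub_zero]
  have hpow : ∀ l : ℕ, (W ^ l).mulVec v = lam ^ l • v := by
    intro l
    induction l with
    | zero => simp
    | succ l ih => rw [pow_succ, ← Matrix.mulVec_mulVec, hW, Matrix.mulVec_smul, ih, smul_smul,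
        pow_succ, mul_comm]
  obtain ⟨l, -, hpos⟩ := h.regular
  have : Nonempty (Fin n) := ⟨⟨0, hn⟩⟩
  obtain ⟨i, hi⟩ := Finite.exists_max v
  have hvi : 0 ≤ v i := by
    by_contra! hneg
    have : ∑ j, v j < 0 := Finset.sum_neg (fun j _ => (hi j).trans_lt hneg) ⟨i, by simp⟩
    linarith
  have h1 : ∑ j, (W ^ l) i j * (v i - v j) ≤ 0 := by
    have h2 := congrFun (hpow l) i
    simp only [Matrix.mulVec, dotProduct, Pi.smul_apply, smul_eq_mul] at h2
    simp only [mul_sub, Finset.sum_sub_distrib, ← Finset.sum_mul, h.row_sum_pow, h2, one_mul]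
    have h3 : 1 ≤ lam ^ l := one_le_pow₀ hl
    nlinarith
  have h2 : ∀ j, v j = v i := by
    intro j
    have h3 : ∀ j ∈ Finset.univ, 0 ≤ (W ^ l) i j * (v i - v j) := fun j _ =>
      mul_nonneg (hpos i j).le (sub_nonneg.2 (hi j))
    have h4 := (Finset.sum_eq_zero_iff_of_nonneg h3).1 (le_antisymm h1 (Finset.sum_nonneg h3)) j
      (Finset.mem_univ j)
    have := (mul_eq_zero.1 h4).resolve_left (hpos i j).ne'
    linarith
  have h3 : v i = 0 := by
    simp only [h2, Finset.sum_const, Finset.card_univ, Fintype.card_fin, nsmul_eq_mul] at hsum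
    exact (mul_eq_zero.1 hsum).resolve_left hn'.ne'
  exact hv (funext fun j => by simp [h2 j, h3])

/-- The spectral decomposition of `W - 𝟏𝟏ᵀ/n`: an orthonormal eigenbasis, with eigenvalues in
`[0, 1 - θ]`, where `θ ∈ (0, 1]`. -/
theorem IsGossip.exists_eigenbasis (hn : 0 < n) (h : IsGossip G W) :
    0 < gap W ∧ gap W ≤ 1 ∧
    ∃ (b : OrthonormalBasis (Fin n) ℝ (EuclideanSpace ℝ (Fin n))) (lam : Fin n → ℝ),
      (∀ j, 0 ≤ lam j ∧ lam j ≤ 1 - gap W) ∧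
      ∀ j, (W - avgMatrix n).mulVec (b j) = lam j • (b j : Fin n → ℝ) := by
  have hp := h.posSemidef_sub_avg hn
  set M := W - avgMatrix n with hM
  set b := hp.1.eigenvectorBasis
  set lam := hp.1.eigenvalues
  have he : ∀ j, M.mulVec (b j) = lam j • (b j : Fin n → ℝ) := fun j =>
    hp.1.mulVec_eigenvectorBasis j
  have hne : ∀ j, (b j : Fin n → ℝ) ≠ 0 := by
    intro j h0
    have h1 : ‖b j‖ = 1 := b.norm_eq_one j
    rw [show b j = 0 from by ext i; exact congrFun h0 i, norm_zero] at h1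
    exact zero_ne_one h1
  set T := Matrix.toEuclideanCLM (𝕜 := ℝ) M
  have hT : ∀ j, T (b j) = lam j • b j := by
    intro j
    ext i
    have := congrFun (he j) i
    simpa [T, Matrix.ofLp_toEuclideanCLM] using this
  have hnorm : specNorm M = ‖T‖ := rfl
  have hgap : gap W = 1 - ‖T‖ := rfl
  have hlam0 : ∀ j, 0 ≤ lam j := hp.eigenvalues_nonneg
  have hlt : ∀ j, lam j < 1 := fun j => h.eigenvalue_lt_one hn (hne j) (he j)
  have : Nonempty (Fin n) := ⟨⟨0, hn⟩⟩
  obtain ⟨i, hi⟩ := Finite.exists_max lam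
  have hTle : ‖T‖ ≤ lam i := by
    refine ContinuousLinearMap.opNorm_le_bound _ (hlam0 i) fun x => ?_
    refine abs_le_of_sq_le_sq' ?_ (mul_nonneg (hlam0 i) (norm_nonneg _)) |>.2
    rw [mul_pow, ← b.sum_sq_norm_inner_right (T x), ← b.sum_sq_norm_inner_right x, Finset.mul_sum]
    refine Finset.sum_le_sum fun j _ => ?_
    have hsymm : inner ℝ (b j) (T x) = lam j * inner ℝ (b j) x := by
      have h1 : inner ℝ (b j) (T x) = inner ℝ (T (b j)) x := by
        have hs : (Matrix.toEuclideanLin M).IsSymmetric :=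
          Matrix.isSymmetric_toEuclideanLin_iff.2 hp.1
        exact (hs (b j) x).symm
      rw [h1, hT, real_inner_smul_left]
    rw [hsymm, norm_mul, mul_pow]
    have : ‖lam j‖ ^ 2 ≤ lam i ^ 2 := by
      rw [Real.norm_of_nonneg (hlam0 j)]
      exact pow_le_pow_left₀ (hlam0 j) (hi j) 2
    exact mul_le_mul_of_nonneg_right this (sq_nonneg _)
  refine ⟨by rw [hgap]; linarith [hlt i], by rw [hgap]; linarith [norm_nonneg T], b, lam,
    fun j => ⟨hlam0 j, ?_⟩, he⟩
  have h1 := T.le_opNorm (b j)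
  rw [hT, norm_smul, b.norm_eq_one, Real.norm_of_nonneg (hlam0 j)] at h1
  rw [hgap]
  linarith

end SpectralGap

/-! ### The accelerated gap -/

section AccGap

theorem etaW_eq (θ : ℝ) : etaW θ = 1 / (1 + √(1 - (1 - θ) ^ 2)) := by
  have : 0 ≤ √(1 - (1 - θ) ^ 2) := Real.sqrt_nonneg _
  rw [etaW]
  field_simp
  ring

variable {θ : ℝ}

theorem accGap_sq (θ : ℝ) : (1 - accGap θ) ^ 2 = etaW θ := by
  have : 0 ≤ etaW θ := by
    rw [etaW_eq]
    positivity
  rw [accGap, sub_sub_cancel, Real.sq_sqrt this]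

theorem accGap_relation (θ : ℝ) : (1 - accGap θ) ^ 2 * (1 + √(1 - (1 - θ) ^ 2)) = 1 := by
  have : 0 ≤ √(1 - (1 - θ) ^ 2) := Real.sqrt_nonneg _
  rw [accGap_sq, etaW_eq]
  field_simp

theorem chebyshev_width_sq (h0 : 0 < θ) (h1 : θ ≤ 1) :
    √(1 - (1 - θ) ^ 2) ^ 2 = 1 - (1 - θ) ^ 2 :=
  Real.sq_sqrt (by nlinarith)

theorem chebyshev_width_pos (h0 : 0 < θ) (h1 : θ ≤ 1) : 0 < √(1 - (1 - θ) ^ 2) :=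
  Real.sqrt_pos.2 (by nlinarith)

theorem chebyshev_width_le_one (θ : ℝ) : √(1 - (1 - θ) ^ 2) ≤ 1 :=
  Real.sqrt_le_one.2 (by nlinarith [sq_nonneg (1 - θ)])

theorem one_sub_accGap_nonneg (θ : ℝ) : 0 ≤ 1 - accGap θ := by
  rw [accGap, sub_sub_cancel]
  exact Real.sqrt_nonneg _

theorem accGap_pos (h0 : 0 < θ) (h1 : θ ≤ 1) : 0 < accGap θ := by
  have h := accGap_relation θ
  have hs := chebyshev_width_pos h0 h1
  by_contra! hneg
  have h1 : 1 ≤ (1 - accGap θ) ^ 2 := by nlinarith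
  nlinarith

theorem accGap_le (θ : ℝ) : accGap θ ≤ 3 / 10 := by
  have h := accGap_relation θ
  have hs := chebyshev_width_le_one θ
  have hr := one_sub_accGap_nonneg θ
  by_contra! hneg
  have : (1 - accGap θ) ^ 2 ≤ 49 / 100 := by nlinarith
  nlinarith [Real.sqrt_nonneg (1 - (1 - θ) ^ 2)]

theorem sqrt_gap_le (h0 : 0 < θ) (h1 : θ ≤ 1) : √θ ≤ 4 * accGap θ := by
  have h := accGap_relation θ
  have hr := one_sub_accGap_nonneg θ
  have hp := accGap_pos h0 h1
  have hs1 := chebyshev_width_le_one θ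
  have hs0 := chebyshev_width_pos h0 h1
  have : √θ ≤ √(1 - (1 - θ) ^ 2) := Real.sqrt_le_sqrt (by nlinarith)
  have h2 : 1 / 2 ≤ (1 - accGap θ) ^ 2 := by nlinarith [sq_nonneg (1 - accGap θ)]
  have h3 := mul_le_mul_of_nonneg_right h2 hs0.le
  nlinarith

theorem accGap_le_sqrt (h0 : 0 < θ) (h1 : θ ≤ 1) : accGap θ ≤ 4 * √θ := by
  have h := accGap_relation θ
  have hr := one_sub_accGap_nonneg θ
  have hp := accGap_pos h0 h1
  have hs0 := chebyshev_width_pos h0 h1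
  have h2 : √(1 - (1 - θ) ^ 2) ≤ √(2 ^ 2 * θ) := Real.sqrt_le_sqrt (by nlinarith)
  rw [Real.sqrt_mul (by norm_num), Real.sqrt_sq (by norm_num)] at h2
  have h3 : accGap θ ≤ √(1 - (1 - θ) ^ 2) := by
    have h4 : (1 - accGap θ) ^ 2 ≤ 1 := by nlinarith
    have h5 := mul_le_mul_of_nonneg_right h4 hs0.le
    nlinarith
  linarith [Real.sqrt_nonneg θ]

end AccGap

/-! ### Loopless Chebyshev acceleration -/

section Chebyshev

/-- The scalar recursion obeyed by an eigencomponent of the two halves under the augmented gossip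
matrix, started at `(1, 1)`. -/
noncomputable def chebPair (w lam : ℝ) : ℕ → ℝ × ℝ
  | 0 => (1, 1)
  | k + 1 => ((1 + w) * lam * (chebPair w lam k).1 - w * (chebPair w lam k).2,
      (chebPair w lam k).1)

/-- The quadratic form `x² - (1 + w) λ x y + w y²` is multiplied by `w` in each step. -/
theorem chebPair_energy (w lam : ℝ) (k : ℕ) :
    (chebPair w lam k).1 ^ 2 - (1 + w) * lam * (chebPair w lam k).1 * (chebPair w lam k).2
      + w * (chebPair w lam k).2 ^ 2 = w ^ k * ((1 + w) * (1 - lam)) := by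
  induction k with
  | zero => simp [chebPair]; ring
  | succ k ih =>
    simp only [chebPair]
    linear_combination w * ih

/-- On the spectrum `[0, 1 - θ]` the roots of the scalar recursion are complex of modulus
`1 - θ̂`, so that the energy bounds the first component. The constant `14` is uniform because both
`1 - λ` and the discriminant are of the order of `θ` at the upper end of the spectrum. -/
theorem chebPair_sq_le {θ lam : ℝ} (h0 : 0 < θ) (h1 : θ ≤ 1) (hl0 : 0 ≤ lam) (hl1 : lam ≤ 1 - θ)
    (k : ℕ) : (chebPair (etaW θ) lam k).1 ^ 2 ≤ 14 * (1 - accGap θ) ^ (2 * k) := by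
  have hE := chebPair_energy (etaW θ) lam k
  have hs0 := chebyshev_width_pos h0 h1
  have hs1 := chebyshev_width_le_one θ
  have hs2 := chebyshev_width_sq h0 h1
  rw [pow_mul, accGap_sq]
  rw [etaW_eq] at hE ⊢
  set s := √(1 - (1 - θ) ^ 2)
  set w := 1 / (1 + s) with hw
  have hw0 : 0 < w := by positivity
  have hws : w * (1 + s) = 1 := by
    rw [hw]
    field_simp
  set x := (chebPair w lam k).1
  set y := (chebPair w lam k).2
  have hlow : (4 * w - (1 + w) ^ 2 * lam ^ 2) * x ^ 2 ≤ 4 * w * (w ^ k * ((1 + w) * (1 - lam))) := by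
    rw [← hE]
    nlinarith [sq_nonneg ((1 + w) * lam * x - 2 * w * y)]
  have hl2 : lam ^ 2 ≤ 1 - s ^ 2 := by nlinarith
  have key : 4 * (2 + s) * (1 - lam) ≤ 14 * (4 * (1 + s) - (2 + s) ^ 2 * lam ^ 2) := by
    have e1 : 4 * (2 + s) * (1 - lam) ≤ 4 * (2 + s) * (1 - lam ^ 2) :=
      mul_le_mul_of_nonneg_left (by nlinarith) (by positivity)
    have e2 : (14 * (2 + s) ^ 2 - 4 * (2 + s)) * lam ^ 2
        ≤ (14 * (2 + s) ^ 2 - 4 * (2 + s)) * (1 - s ^ 2) :=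
      mul_le_mul_of_nonneg_left hl2 (by nlinarith)
    have e3 : 0 ≤ s ^ 3 := by positivity
    nlinarith [sq_nonneg (s ^ 2)]
  have hdisc : 0 < 4 * (1 + s) - (2 + s) ^ 2 * lam ^ 2 := by
    have : (2 + s) ^ 2 * lam ^ 2 ≤ (2 + s) ^ 2 * (1 - s ^ 2) :=
      mul_le_mul_of_nonneg_left hl2 (by positivity)
    have e3 : 0 < s ^ 3 := by positivity
    nlinarith [sq_nonneg (s ^ 2), sq_pos_of_pos hs0]
  have hw1 : 1 + w = w * (2 + s) := by linarith
  rw [hw1] at hlow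
  have hlow2 : (4 * (1 + s) - (2 + s) ^ 2 * lam ^ 2) * x ^ 2
      ≤ 4 * (2 + s) * (1 - lam) * w ^ k := by
    have e : (4 * w - (w * (2 + s)) ^ 2 * lam ^ 2) * x ^ 2
        = w ^ 2 * ((4 * (1 + s) - (2 + s) ^ 2 * lam ^ 2) * x ^ 2) := by
      linear_combination (-4 * w * x ^ 2) * hws
    rw [e] at hlow
    have e' : 4 * w * (w ^ k * (w * (2 + s) * (1 - lam)))
        = w ^ 2 * (4 * (2 + s) * (1 - lam) * w ^ k) := by ring
    rw [e'] at hlow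
    exact le_of_mul_le_mul_left hlow (by positivity)
  have hk : 0 ≤ w ^ k := by positivity
  have := hlow2.trans (mul_le_mul_of_nonneg_right key hk)
  rw [mul_right_comm, mul_comm] at this
  exact le_of_mul_le_mul_right this hdisc

variable {n d : ℕ}

/-- The component of `Π X` along a vector. -/
noncomputable def component (v : Fin n → ℝ) (X : Rows (Fin n) d) : Vec d :=
  ∑ i, v i • mulRows (proj n) X i

theorem component_add (v : Fin n → ℝ) (X Y : Rows (Fin n) d) :
    component v (X + Y) = component v X + component v Y := by
  simp [component, mulRows_add, Finset.sum_add_distrib]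

theorem component_smul (v : Fin n → ℝ) (a : ℝ) (X : Rows (Fin n) d) :
    component v (a • X) = a • component v X := by
  simp only [component, mulRows_smul, Pi.smul_apply, Finset.smul_sum]
  exact Finset.sum_congr rfl fun j _ => smul_comm _ _ _

theorem consErr_eq_sum_component
    (b : OrthonormalBasis (Fin n) ℝ (EuclideanSpace ℝ (Fin n))) (X : Rows (Fin n) d) :
    consErr X = ∑ j, ‖component (b j) X‖ ^ 2 := by
  simp only [consErr, frobSq, component]
  set Y := mulRows (proj n) X
  simp only [EuclideanSpace.norm_sq_eq, Real.norm_eq_abs, sq_abs]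
  rw [Finset.sum_comm, Finset.sum_comm (s := Finset.univ (α := Fin n))]
  refine Finset.sum_congr rfl fun c _ => ?_
  have h := b.sum_sq_norm_inner_right (WithLp.toLp 2 fun i => Y i c)
  simp only [EuclideanSpace.norm_sq_eq, Real.norm_eq_abs, sq_abs] at h
  rw [← h]
  refine Finset.sum_congr rfl fun j _ => ?_
  congr 1
  simp [PiLp.inner_apply, mul_comm]

theorem component_mulRows {G : SimpleGraph (Fin n)} {W : Matrix (Fin n) (Fin n) ℝ} (hn : 0 < n)
    (h : IsGossip G W) {lam : ℝ} {v : Fin n → ℝ}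
    (he : (W - avgMatrix n).mulVec v = lam • v) (X : Rows (Fin n) d) :
    component v (mulRows W X) = lam • component v X := by
  have h1 : mulRows (proj n) (mulRows W X) = mulRows (W - avgMatrix n) (mulRows (proj n) X) := by
    rw [← mulRows_mul, ← mulRows_mul]
    congr 1
    simp only [proj, sub_mul, mul_sub, one_mul, mul_one, h.avg_mul, h.mul_avg,
      avgMatrix_mul_self hn]
    abel
  have hs : ∀ i j, (W - avgMatrix n) i j = (W - avgMatrix n) j i := by
    intro i j
    simp [avgMatrix, h.symm i j]
  rw [component, h1, component]
  set Y := mulRows (proj n) X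
  simp only [mulRows, Finset.smul_sum, smul_smul]
  rw [Finset.sum_comm]
  refine Finset.sum_congr rfl fun j _ => ?_
  rw [← Finset.sum_smul]
  congr 1
  have := congrFun he j
  simp only [Matrix.mulVec, dotProduct, Pi.smul_apply, smul_eq_mul] at this
  rw [← this]
  refine Finset.sum_congr rfl fun i _ => ?_
  rw [hs i j, mul_comm]

theorem augW_inl (I : Problem n d) (A : Rows (Fin n ⊕ Fin n) d) (i : Fin n) :
    mulRows I.augW A (Sum.inl i)
      = (1 + etaW I.θ) • mulRows I.W (top A) i - etaW I.θ • A (Sum.inr i) := by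
  simp [mulRows, Problem.augW, top, Finset.smul_sum, smul_smul, Matrix.one_apply, ite_smul,
    sub_eq_add_neg, neg_smul]

theorem augW_inr (I : Problem n d) (A : Rows (Fin n ⊕ Fin n) d) (i : Fin n) :
    mulRows I.augW A (Sum.inr i) = A (Sum.inl i) := by
  simp [mulRows, Problem.augW, Matrix.one_apply, ite_smul]

/-- The last `n` rows of a `2n`-by-`d` matrix. -/
noncomputable def bot (A : Rows (Fin n ⊕ Fin n) d) : Rows (Fin n) d := fun i => A (Sum.inr i)

theorem top_augW (I : Problem n d) (A : Rows (Fin n ⊕ Fin n) d) :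
    top (mulRows I.augW A) = (1 + etaW I.θ) • mulRows I.W (top A) + (-etaW I.θ) • bot A := by
  funext i
  rw [top, augW_inl, sub_eq_add_neg, ← neg_smul]
  rfl

theorem bot_augW (I : Problem n d) (A : Rows (Fin n ⊕ Fin n) d) :
    bot (mulRows I.augW A) = top A := by
  funext i
  simp only [top, augW_inr, bot]

theorem component_augW_pow (I : Problem n d) (hn : 0 < n) (h : IsGossip I.G I.W) {lam : ℝ}
    {v : Fin n → ℝ} (he : (I.W - avgMatrix n).mulVec v = lam • v) (B : Rows (Fin n) d) (k : ℕ) :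
    component v (top (mulRows (I.augW ^ k) (stack B)))
        = (chebPair (etaW I.θ) lam k).1 • component v B ∧
      component v (bot (mulRows (I.augW ^ k) (stack B)))
        = (chebPair (etaW I.θ) lam k).2 • component v B := by
  induction k with
  | zero =>
    simp only [pow_zero, mulRows_one, chebPair, one_smul]
    exact ⟨rfl, rfl⟩
  | succ k ih =>
    rw [pow_succ', mulRows_mul, top_augW, bot_augW, component_add, component_smul, component_smul,
      component_mulRows hn h he, ih.1, ih.2]
    refine ⟨?_, rfl⟩
    simp only [chebPair, smul_smul, ← add_smul]
    congr 1
    ring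

/-- Iterating the augmented gossip matrix from a pair of equal halves contracts the consensus error
at the accelerated rate. -/
theorem consErr_augW_pow_le (I : Problem n d) (hn : 0 < n) (h : IsGossip I.G I.W)
    (B : Rows (Fin n) d) (k : ℕ) :
    consErr (top (mulRows (I.augW ^ k) (stack B)))
      ≤ cheb * (1 - I.θhat) ^ (2 * k) * consErr B := by
  obtain ⟨h0, h1, b, lam, hlam, he⟩ := h.exists_eigenbasis hn
  rw [consErr_eq_sum_component b, consErr_eq_sum_component b, Finset.mul_sum]
  refine Finset.sum_le_sum fun j _ => ?_
  rw [(component_augW_pow I hn h (he j) B k).1, norm_smul, mul_pow, Real.norm_eq_abs, sq_abs]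
  exact mul_le_mul_of_nonneg_right (chebPair_sq_le h0 h1 (hlam j).1 (hlam j).2 k) (sq_nonneg _)

end Chebyshev

section Decay

variable {n d : ℕ}

/-- `b` bounds the consensus seminorm of the upper half of `A`, and this bound contracts at the
accelerated rate under repeated multiplication by the augmented gossip matrix. A single step need
not contract the consensus error, but this property is stable under all operations that generate
the iterates. -/
noncomputable def Decay (I : Problem n d) (A : Rows (Fin n ⊕ Fin n) d) (b : ℝ) : Prop :=
  ∀ m : ℕ, cnorm (top (mulRows (I.augW ^ m) A)) ≤ (1 - I.θhat) ^ m * b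

variable {I : Problem n d} {A B : Rows (Fin n ⊕ Fin n) d} {a b : ℝ}

theorem one_sub_thetaHat_nonneg (I : Problem n d) : 0 ≤ 1 - I.θhat := one_sub_accGap_nonneg _

theorem Decay.cnorm_top_le (h : Decay I A a) : cnorm (top A) ≤ a := by
  simpa [mulRows_one] using h 0

theorem Decay.add (hA : Decay I A a) (hB : Decay I B b) : Decay I (A + B) (a + b) := by
  intro m
  rw [mulRows_add, mul_add]
  exact (cnorm_add_le _ _).trans (add_le_add (hA m) (hB m))

theorem Decay.smul (hA : Decay I A a) (t : ℝ) : Decay I (t • A) (|t| * a) := by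
  intro m
  rw [mulRows_smul, mul_left_comm]
  exact (cnorm_smul t (top (mulRows (I.augW ^ m) A))).le.trans
    (mul_le_mul_of_nonneg_left (hA m) (abs_nonneg t))

theorem Decay.mono (hA : Decay I A a) (hab : a ≤ b) : Decay I A b := fun m =>
  (hA m).trans (mul_le_mul_of_nonneg_left hab (pow_nonneg (one_sub_thetaHat_nonneg I) m))

theorem Decay.augW (hA : Decay I A a) : Decay I (mulRows I.augW A) ((1 - I.θhat) * a) := by
  intro m
  rw [← mulRows_mul, ← pow_succ, ← mul_assoc, ← pow_succ]
  exact hA (m + 1)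

theorem Decay.stack (hn : 0 < n) (h : IsGossip I.G I.W) (X : Rows (Fin n) d) :
    Decay I (stack X) (√cheb * cnorm X) := by
  intro m
  have h1 := consErr_augW_pow_le I hn h X m
  have hc : (0 : ℝ) ≤ cheb := by norm_num [cheb]
  refine abs_le_of_sq_le_sq' ?_ (mul_nonneg (pow_nonneg (one_sub_thetaHat_nonneg I) m)
    (mul_nonneg (Real.sqrt_nonneg _) (cnorm_nonneg X))) |>.2
  rw [cnorm_sq, mul_pow, mul_pow, Real.sq_sqrt hc, cnorm_sq, ← pow_mul, mul_comm m 2]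
  linarith

end Decay

/-! ### Random variables determined by the past -/

section Past

variable {Ω : Type*} {ξ ζ : ℕ → Ω → ℝ} {k : ℕ} {T T' T'' : Type*}

/-- `A` is a function of the random inputs before step `k`. No measurability is asked for, since the
inputs take finitely many values. -/
def Past (ξ ζ : ℕ → Ω → ℝ) (k : ℕ) (A : Ω → T) : Prop :=
  ∃ F : (Finset.range k → ℝ × ℝ) → T, ∀ ω, A ω = F fun j => (ξ j ω, ζ j ω)

theorem Past.const (c : T) : Past ξ ζ k fun _ => c := ⟨fun _ => c, fun _ => rfl⟩

theorem Past.comp {A : Ω → T} (hA : Past ξ ζ k A) (g : T → T') : Past ξ ζ k fun ω => g (A ω) := by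
  obtain ⟨F, hF⟩ := hA
  exact ⟨fun v => g (F v), fun ω => congrArg g (hF ω)⟩

theorem Past.comp₂ {A : Ω → T} {B : Ω → T'} (hA : Past ξ ζ k A) (hB : Past ξ ζ k B)
    (g : T → T' → T'') : Past ξ ζ k fun ω => g (A ω) (B ω) := by
  obtain ⟨F, hF⟩ := hA
  obtain ⟨F', hF'⟩ := hB
  exact ⟨fun v => g (F v) (F' v), fun ω => congrArg₂ g (hF ω) (hF' ω)⟩

theorem Past.succ {A : Ω → T} (hA : Past ξ ζ k A) : Past ξ ζ (k + 1) A := by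
  obtain ⟨F, hF⟩ := hA
  exact ⟨fun v => F fun j => v ⟨j, Finset.mem_range.2 (by have := Finset.mem_range.1 j.2; omega)⟩, hF⟩

theorem Past.input (k : ℕ) : Past ξ ζ (k + 1) fun ω => (ξ k ω, ζ k ω) :=
  ⟨fun v => v ⟨k, Finset.self_mem_range_succ k⟩, fun _ => rfl⟩

theorem past_rv {n d : ℕ} (I : Problem n d) (r : Params) (k : ℕ) :
    Past ξ ζ k fun ω => rv I r ξ ζ k ω := by
  induction k with
  | zero => exact Past.const _
  | succ k ih => exact (ih.succ.comp₂ (Past.input k) fun s x => step I r x.1 x.2 s)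

variable [MeasurableSpace Ω] {P : Measure Ω} {p q : ℝ}

theorem Sampling.measurable_pair (hs : Sampling P p q ξ ζ) (k : ℕ) :
    Measurable fun ω => (ξ k ω, ζ k ω) := (hs.measurable_ξ k).prodMk (hs.measurable_ζ k)

/-- A function of the past may be taken measurable, as the inputs take finitely many values. -/
theorem Past.exists_measurable {A : Ω → ℝ} (hA : Past ξ ζ k A) (hs : Sampling P p q ξ ζ) :
    ∃ F : (Finset.range k → ℝ × ℝ) → ℝ, Measurable F ∧ (∃ C, ∀ v, |F v| ≤ C) ∧
      ∀ ω, A ω = F fun j => (ξ j ω, ζ j ω) := by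
  obtain ⟨F, hF⟩ := hA
  set V : Set (Finset.range k → ℝ × ℝ) :=
    Set.pi Set.univ fun _ => ({0, 1} : Set ℝ) ×ˢ ({0, 1 / q} : Set ℝ) with hV
  have hfin : V.Finite := Set.Finite.pi fun _ => (Set.toFinite _).prod (Set.toFinite _)
  refine ⟨V.indicator F, ?_, ?_, ?_⟩
  · refine measurable_of_restrict_of_restrict_compl hfin.measurableSet ?_ ?_
    · have : Countable V := hfin.countable
      exact measurable_of_countable _
    · have : Vᶜ.domRestrict (V.indicator F) = fun _ => 0 :=
        funext fun v => Set.indicator_of_notMem v.2 _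
      rw [this]
      exact measurable_const
  · obtain ⟨C, hC⟩ := (hfin.image fun v => |F v|).bddAbove
    refine ⟨max C 0, fun v => ?_⟩
    by_cases hv : v ∈ V
    · rw [Set.indicator_of_mem hv]
      exact (hC ⟨v, hv, rfl⟩).trans (le_max_left _ _)
    · rw [Set.indicator_of_notMem hv, abs_zero]
      exact le_max_right _ _
  · intro ω
    rw [Set.indicator_of_mem, hF]
    simp only [hV, Set.mem_pi, Set.mem_univ, true_imp_iff, Set.mem_prod, Set.mem_insert_iff,
      Set.mem_singleton_iff]
    exact fun j => ⟨hs.values_ξ j ω, hs.values_ζ j ω⟩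

theorem measurable_history (hs : Sampling P p q ξ ζ) (k : ℕ) :
    Measurable fun ω (j : Finset.range k) => (ξ j ω, ζ j ω) :=
  measurable_pi_lambda _ fun j => hs.measurable_pair j

theorem Past.integrable [IsProbabilityMeasure P] {A : Ω → ℝ} (hA : Past ξ ζ k A)
    (hs : Sampling P p q ξ ζ) : Integrable A P := by
  obtain ⟨F, hF, ⟨C, hC⟩, hA⟩ := hA.exists_measurable hs
  have : A = fun ω => F fun j => (ξ j ω, ζ j ω) := funext hA
  rw [this]
  exact Integrable.of_bound (hF.comp (measurable_history hs k)).aestronglyMeasurable C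
    (Filter.Eventually.of_forall fun ω => hC _)

/-- The past is independent of the current input. -/
theorem Past.integral_mul [IsProbabilityMeasure P] {A : Ω → ℝ} (hA : Past ξ ζ k A)
    (hs : Sampling P p q ξ ζ) {g : ℝ × ℝ → ℝ} (hg : Measurable g) :
    ∫ ω, A ω * g (ξ k ω, ζ k ω) ∂P = (∫ ω, A ω ∂P) * ∫ ω, g (ξ k ω, ζ k ω) ∂P := by
  obtain ⟨F, hF, -, hA⟩ := hA.exists_measurable hs
  have hdisj : Disjoint (Finset.range k) {k} := by simp
  have hind := hs.indep.indepFun_finset (Finset.range k) {k} hdisj hs.measurable_pair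
  have hg' : Measurable fun v : ({k} : Finset ℕ) → ℝ × ℝ => g (v ⟨k, by simp⟩) :=
    hg.comp (measurable_pi_apply _)
  have h := (hind.comp hF hg').integral_fun_mul_eq_mul_integral
    (hF.comp (measurable_history hs k)).aestronglyMeasurable
    (hg.comp (hs.measurable_pair k)).aestronglyMeasurable
  simp only [hA]
  exact h

/-- A two-point random variable with values `0` and `c` has mean `c` times the probability of
`c`. -/
theorem integral_two_point [IsProbabilityMeasure P] {X : Ω → ℝ} (hX : Measurable X) {c : ℝ}
    (hval : ∀ ω, X ω = 0 ∨ X ω = c) : ∫ ω, X ω ∂P = P.real {ω | X ω = c} * c := by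
  have hm : MeasurableSet {ω | X ω = c} := hX (measurableSet_singleton c)
  have h : X = {ω | X ω = c}.indicator fun _ => c := by
    funext ω
    by_cases hω : X ω = c
    · rw [Set.indicator_of_mem (show ω ∈ {ω | X ω = c} from hω), hω]
    · rw [Set.indicator_of_notMem (show ω ∉ {ω | X ω = c} from hω)]
      exact (hval ω).resolve_right hω
  conv_lhs => rw [h]
  rw [integral_indicator_const _ hm, smul_eq_mul]

theorem Sampling.integral_xi [IsProbabilityMeasure P] (hs : Sampling P p q ξ ζ) (k : ℕ) :
    ∫ ω, ξ k ω ∂P = p := by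
  rw [integral_two_point (hs.measurable_ξ k) (hs.values_ξ k), hs.prob_ξ, mul_one]

theorem Sampling.integral_zeta [IsProbabilityMeasure P] (hs : Sampling P p q ξ ζ) (hq : q ≠ 0)
    (k : ℕ) : ∫ ω, ζ k ω ∂P = 1 := by
  rw [integral_two_point (hs.measurable_ζ k) (hs.values_ζ k), hs.prob_ζ, mul_one_div_cancel hq]

theorem Past.integral_mul_xi [IsProbabilityMeasure P] {A : Ω → ℝ} (hA : Past ξ ζ k A)
    (hs : Sampling P p q ξ ζ) : ∫ ω, A ω * ξ k ω ∂P = p * ∫ ω, A ω ∂P := by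
  rw [hA.integral_mul hs (g := Prod.fst) measurable_fst, hs.integral_xi, mul_comm]

theorem Past.integral_mul_zeta [IsProbabilityMeasure P] {A : Ω → ℝ} (hA : Past ξ ζ k A)
    (hs : Sampling P p q ξ ζ) (hq : q ≠ 0) : ∫ ω, A ω * ζ k ω ∂P = ∫ ω, A ω ∂P := by
  rw [hA.integral_mul hs (g := Prod.snd) measurable_snd, hs.integral_zeta hq, mul_one]

/-- Averaging over the current input: a bound that is affine in the inputs may be integrated by
replacing `ξ` and `ζ` by their means. -/
theorem integral_le_of_affine [IsProbabilityMeasure P] (hs : Sampling P p q ξ ζ) (hq : q ≠ 0)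
    {N A B C : Ω → ℝ} (hN : Past ξ ζ (k + 1) N) (hA : Past ξ ζ k A) (hB : Past ξ ζ k B)
    (hC : Past ξ ζ k C) (h : ∀ ω, N ω ≤ A ω + B ω * ξ k ω + C ω * ζ k ω) :
    ∫ ω, N ω ∂P ≤ ∫ ω, A ω ∂P + p * ∫ ω, B ω ∂P + ∫ ω, C ω ∂P := by
  have hiB : Integrable (fun ω => B ω * ξ k ω) P :=
    (hB.succ.comp₂ (Past.input k) fun b x => b * x.1).integrable hs
  have hiC : Integrable (fun ω => C ω * ζ k ω) P :=
    (hC.succ.comp₂ (Past.input k) fun b x => b * x.2).integrable hs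
  have h1 := integral_mono (hN.integrable hs) (((hA.integrable hs).add hiB).add hiC) h
  rw [integral_add' ((hA.integrable hs).add hiB) hiC, integral_add' (hA.integrable hs) hiB,
    hB.integral_mul_xi hs, hC.integral_mul_zeta hs hq] at h1
  exact h1

end Past

section Expectation

variable {Ω : Type*} [MeasurableSpace Ω] {P : Measure Ω} [IsProbabilityMeasure P] {p q : ℝ}
  {ξ ζ : ℕ → Ω → ℝ} {k : ℕ}

theorem integral_le_comb (hs : Sampling P p q ξ ζ) {N f₁ f₂ f₃ f₄ : Ω → ℝ} (c₁ c₂ c₃ c₄ : ℝ)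
    (hN : Past ξ ζ k N) (h₁ : Past ξ ζ k f₁) (h₂ : Past ξ ζ k f₂) (h₃ : Past ξ ζ k f₃)
    (h₄ : Past ξ ζ k f₄)
    (h : ∀ ω, N ω ≤ c₁ * f₁ ω + c₂ * f₂ ω + c₃ * f₃ ω + c₄ * f₄ ω) :
    ∫ ω, N ω ∂P ≤ c₁ * ∫ ω, f₁ ω ∂P + c₂ * ∫ ω, f₂ ω ∂P + c₃ * ∫ ω, f₃ ω ∂P
      + c₄ * ∫ ω, f₄ ω ∂P := by
  have i₁ := (h₁.integrable hs).const_mul c₁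
  have i₂ := (h₂.integrable hs).const_mul c₂
  have i₃ := (h₃.integrable hs).const_mul c₃
  have i₄ := (h₄.integrable hs).const_mul c₄
  have := integral_mono (hN.integrable hs) (((i₁.add i₂).add i₃).add i₄) h
  rwa [integral_add' ((i₁.add i₂).add i₃) i₄, integral_add' (i₁.add i₂) i₃, integral_add' i₁ i₂,
    integral_const_mul, integral_const_mul, integral_const_mul, integral_const_mul] at this

/-- Averaging over the current input, for a bound by a combination of functions of the past. -/
theorem integral_le_comb_of_affine (hs : Sampling P p q ξ ζ) (hq : q ≠ 0)
    {N A B C f₁ f₂ f₃ f₄ : Ω → ℝ} (c₁ c₂ c₃ c₄ : ℝ)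
    (hN : Past ξ ζ (k + 1) N) (hA : Past ξ ζ k A) (hB : Past ξ ζ k B) (hC : Past ξ ζ k C)
    (h₁ : Past ξ ζ k f₁) (h₂ : Past ξ ζ k f₂) (h₃ : Past ξ ζ k f₃) (h₄ : Past ξ ζ k f₄)
    (h : ∀ ω, N ω ≤ A ω + B ω * ξ k ω + C ω * ζ k ω)
    (h' : ∀ ω, A ω + p * B ω + C ω ≤ c₁ * f₁ ω + c₂ * f₂ ω + c₃ * f₃ ω + c₄ * f₄ ω) :
    ∫ ω, N ω ∂P ≤ c₁ * ∫ ω, f₁ ω ∂P + c₂ * ∫ ω, f₂ ω ∂P + c₃ * ∫ ω, f₃ ω ∂P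
      + c₄ * ∫ ω, f₄ ω ∂P := by
  have e1 := integral_le_of_affine hs hq hN hA hB hC h
  have e2 := integral_le_comb hs c₁ c₂ c₃ c₄
    ((hA.comp₂ hB fun a b => a + p * b).comp₂ hC fun a b => a + b) h₁ h₂ h₃ h₄ h'
  have iB := (hB.integrable hs).const_mul p
  have e3 := integral_add' ((hA.integrable hs).add iB) (hC.integrable hs)
  rw [integral_add' (hA.integrable hs) iB, integral_const_mul] at e3
  exact e1.trans (e3.symm.le.trans e2)

end Expectation

/-! ### Consensus errors in expectation -/

section Majorants

variable {n d : ℕ} {Ω : Type*} (I : Problem n d) (r : Params) (ξ ζ : ℕ → Ω → ℝ)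

theorem rv_succ (k : ℕ) (ω : Ω) :
    rv I r ξ ζ (k + 1) ω = step I r (ξ k ω) (ζ k ω) (rv I r ξ ζ k ω) := rfl

/-- The gradient difference `∇F(X) - ∇F(Q)` of a state. -/
noncomputable def State.gradDiff (s : State n d) : Rows (Fin n) d := I.gradF (s.X r) - I.gradF s.Q

theorem cnorm_le_fnorm (hn : 0 < n) (X : Rows (Fin n) d) : cnorm X ≤ fnorm X := by
  refine abs_le_of_sq_le_sq' ?_ (fnorm_nonneg X) |>.2
  rw [cnorm_sq, fnorm_sq]
  have h := sum_norm_sub_sq hn X 0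
  simp only [zero_sub, norm_neg] at h
  rw [frobSq, h]
  have : 0 ≤ (n : ℝ) * ‖rowAvg X‖ ^ 2 := by positivity
  linarith

theorem stack_sub (A B : Rows (Fin n) d) : stack A - stack B = stack (A - B) := by
  funext i
  rcases i with i | i <;> rfl

/-- Scalar majorant of the contributions of the gradient differences to `Π G^k`. -/
noncomputable def accG : ℕ → Ω → ℝ
  | 0, _ => 0
  | k + 1, ω => (1 - I.θhat) * accG k ω + ξ k ω * fnorm ((rv I r ξ ζ k ω).gradDiff I r)

/-- Scalar majorant of `Π U^k`. -/
noncomputable def accU : ℕ → Ω → ℝ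
  | 0, _ => cnorm (initState I).U
  | k + 1, ω => (1 - I.θhat) * ((1 - ξ k ω) * accU k ω + ξ k ω * cnorm ((rv I r ξ ζ k ω).X r))

/-- Scalar majorant of the contributions of the inputs of the recursion to `Π Z^k`. -/
noncomputable def accZ : ℕ → Ω → ℝ
  | 0, _ => 0
  | k + 1, ω => (1 - I.θhat) * (accZ k ω + r.β * cnorm ((rv I r ξ ζ k ω).X r)
      + r.η * cnorm (rv I r ξ ζ k ω).Gr
      + r.η * ζ k ω * fnorm ((rv I r ξ ζ k ω).gradDiff I r))

theorem past_accG (k : ℕ) : Past ξ ζ k (accG I r ξ ζ k) := by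
  induction k with
  | zero => exact Past.const _
  | succ k ih =>
    exact (ih.succ.comp₂ (past_rv I r k).succ fun a s => (a, s)).comp₂ (Past.input k)
      fun a x => (1 - I.θhat) * a.1 + x.1 * fnorm (a.2.gradDiff I r)

theorem past_accU (k : ℕ) : Past ξ ζ k (accU I r ξ ζ k) := by
  induction k with
  | zero => exact Past.const _
  | succ k ih =>
    exact (ih.succ.comp₂ (past_rv I r k).succ fun a s => (a, s)).comp₂ (Past.input k)
      fun a x => (1 - I.θhat) * ((1 - x.1) * a.1 + x.1 * cnorm (a.2.X r))

theorem past_accZ (k : ℕ) : Past ξ ζ k (accZ I r ξ ζ k) := by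
  induction k with
  | zero => exact Past.const _
  | succ k ih =>
    exact (ih.succ.comp₂ (past_rv I r k).succ fun a s => (a, s)).comp₂ (Past.input k)
      fun a x => (1 - I.θhat) * (a.1 + r.β * cnorm (a.2.X r) + r.η * cnorm a.2.Gr
        + r.η * x.2 * fnorm (a.2.gradDiff I r))

variable {I r ξ ζ}

theorem thetaHat_pos (hn : 0 < n) (hI : I.Assumptions) : 0 < I.θhat := by
  obtain ⟨h0, h1, -⟩ := hI.gossip.exists_eigenbasis hn
  exact accGap_pos h0 h1

theorem decay_G (hn : 0 < n) (hI : I.Assumptions) (hξ : ∀ k ω, ξ k ω = 0 ∨ ξ k ω = 1) (k : ℕ)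
    (ω : Ω) : Decay I (rv I r ξ ζ k ω).Gt
      (√cheb * ((1 - I.θhat) ^ k * cnorm (initState I).Gr + accG I r ξ ζ k ω)) := by
  induction k with
  | zero =>
    simp only [pow_zero, one_mul, accG, add_zero]
    exact Decay.stack hn hI.gossip (I.gradF I.X₀)
  | succ k ih =>
    have h1 := ih.augW.add
      ((Decay.stack hn hI.gossip ((rv I r ξ ζ k ω).gradDiff I r)).smul (ξ k ω))
    have h2 : (rv I r ξ ζ (k + 1) ω).Gt = mulRows I.augW (rv I r ξ ζ k ω).Gt
        + ξ k ω • stack ((rv I r ξ ζ k ω).gradDiff I r) := by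
      rw [State.gradDiff, ← stack_sub]
      rfl
    rw [h2]
    refine h1.mono ?_
    have h3 : 0 ≤ ξ k ω := by rcases hξ k ω with h | h <;> simp [h]
    rw [abs_of_nonneg h3, accG, pow_succ]
    have h4 : ξ k ω * (√cheb * cnorm ((rv I r ξ ζ k ω).gradDiff I r))
        ≤ ξ k ω * (√cheb * fnorm ((rv I r ξ ζ k ω).gradDiff I r)) :=
      mul_le_mul_of_nonneg_left (mul_le_mul_of_nonneg_left (cnorm_le_fnorm hn _)
        (Real.sqrt_nonneg _)) h3
    linarith

theorem decay_U (hn : 0 < n) (hI : I.Assumptions) (hξ : ∀ k ω, ξ k ω = 0 ∨ ξ k ω = 1) (k : ℕ)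
    (ω : Ω) : Decay I (rv I r ξ ζ k ω).Ut (√cheb * accU I r ξ ζ k ω) := by
  induction k with
  | zero => exact Decay.stack hn hI.gossip I.X₀
  | succ k ih =>
    have h1 := ((ih.smul (1 - ξ k ω)).add
      ((Decay.stack hn hI.gossip ((rv I r ξ ζ k ω).X r)).smul (ξ k ω))).augW
    refine Decay.mono (A := (rv I r ξ ζ (k + 1) ω).Ut) h1 (le_of_eq ?_)
    have h3 : 0 ≤ ξ k ω ∧ 0 ≤ 1 - ξ k ω := by rcases hξ k ω with h | h <;> simp [h]
    rw [abs_of_nonneg h3.1, abs_of_nonneg h3.2, accU]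
    ring

theorem accG_nonneg (hξ : ∀ k ω, ξ k ω = 0 ∨ ξ k ω = 1) (k : ℕ) (ω : Ω) :
    0 ≤ accG I r ξ ζ k ω := by
  induction k with
  | zero => exact le_rfl
  | succ k ih =>
    have h3 : 0 ≤ ξ k ω := by rcases hξ k ω with h | h <;> simp [h]
    exact add_nonneg (mul_nonneg (one_sub_thetaHat_nonneg I) ih) (mul_nonneg h3 (fnorm_nonneg _))

theorem accZ_nonneg (hr : r.Valid) (hζ : ∀ k ω, ζ k ω = 0 ∨ ζ k ω = 1 / r.q) (k : ℕ) (ω : Ω) :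
    0 ≤ accZ I r ξ ζ k ω := by
  induction k with
  | zero => exact le_rfl
  | succ k ih =>
    have h3 : 0 ≤ ζ k ω := by
      rcases hζ k ω with h | h <;> rw [h]
      exact one_div_nonneg.2 hr.q_mem.1.le
    have h4 := hr.η_pos.le
    have h5 := hr.β_mem.1.le
    exact mul_nonneg (one_sub_thetaHat_nonneg I) (add_nonneg (add_nonneg (add_nonneg ih
      (mul_nonneg h5 (cnorm_nonneg _))) (mul_nonneg h4 (cnorm_nonneg _)))
      (mul_nonneg (mul_nonneg h4 h3) (fnorm_nonneg _)))

theorem decay_Z (hn : 0 < n) (hI : I.Assumptions) (hr : r.Valid)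
    (hζ : ∀ k ω, ζ k ω = 0 ∨ ζ k ω = 1 / r.q) (k : ℕ)
    (ω : Ω) : Decay I (rv I r ξ ζ k ω).Zt
      (√cheb * ((1 - I.θhat) ^ k * cnorm (initState I).Z + accZ I r ξ ζ k ω)) := by
  induction k with
  | zero =>
    simp only [pow_zero, one_mul, accZ, add_zero]
    exact Decay.stack hn hI.gossip I.X₀
  | succ k ih =>
    have hβ := hr.β_mem.1
    have hη := hr.η_pos
    have h3 : 0 ≤ ζ k ω := by
      rcases hζ k ω with h | h <;> rw [h]
      exact one_div_nonneg.2 hr.q_mem.1.le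
    set s := rv I r ξ ζ k ω with hsdef
    have hG : Decay I (stack s.Gr) (√cheb * cnorm s.Gr) := Decay.stack hn hI.gossip _
    have hX : Decay I (stack (s.X r)) (√cheb * cnorm (s.X r)) := Decay.stack hn hI.gossip _
    have hD : Decay I (stack (s.gradDiff I r)) (√cheb * fnorm (s.gradDiff I r)) :=
      (Decay.stack hn hI.gossip _).mono
        (mul_le_mul_of_nonneg_left (cnorm_le_fnorm hn _) (Real.sqrt_nonneg _))
    have h1 := (((ih.add (hX.smul r.β)).add (hG.smul (-r.η))).add
      (hD.smul (-(r.η * ζ k ω)))).augW.smul (1 + r.β)⁻¹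
    have h2 : (rv I r ξ ζ (k + 1) ω).Zt = (1 + r.β)⁻¹ • mulRows I.augW
        (s.Zt + r.β • stack (s.X r) + (-r.η) • stack s.Gr
          + (-(r.η * ζ k ω)) • stack (s.gradDiff I r)) := by
      rw [State.gradDiff, ← stack_sub, neg_smul, neg_smul, ← smul_neg (r.η * ζ k ω), neg_sub,
        ← sub_eq_add_neg]
      rfl
    rw [h2]
    refine h1.mono ?_
    have h4 : 0 ≤ r.η * ζ k ω := mul_nonneg hη.le h3
    have h5 : |(1 + r.β)⁻¹| ≤ 1 := by
      rw [abs_of_pos (by positivity)]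
      exact inv_le_one_of_one_le₀ (by linarith)
    rw [abs_neg, abs_neg, abs_of_nonneg h4, abs_of_pos hη, abs_of_pos hβ]
    refine (mul_le_of_le_one_left ?_ h5).trans (le_of_eq ?_)
    · have := one_sub_thetaHat_nonneg I
      have := accZ_nonneg (I := I) (r := r) (ξ := ξ) hr hζ k ω
      have := cnorm_nonneg s.Gr
      have := cnorm_nonneg (s.X r)
      have := cnorm_nonneg (initState I).Z
      have := fnorm_nonneg (s.gradDiff I r)
      positivity
    · rw [accZ, pow_succ, ← hsdef]
      ring

variable [MeasurableSpace Ω] {P : Measure Ω}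

theorem majG_succ (k : ℕ) : majG P I r ξ ζ (k + 1)
    = (1 - I.θhat) * majG P I r ξ ζ k + 4 * cheb * r.p * gradDiff P I r ξ ζ k := by
  have h : ∀ i ∈ Finset.range k, (1 - I.θhat) ^ (k - i)
      = (1 - I.θhat) * (1 - I.θhat) ^ (k - 1 - i) := by
    intro i hi
    rw [← pow_succ']
    congr 1
    have := Finset.mem_range.1 hi
    omega
  simp only [majG, Finset.sum_range_succ, Nat.add_sub_cancel, Nat.sub_self, pow_zero, mul_one,
    mul_add, Finset.mul_sum]
  rw [Finset.sum_congr rfl fun i hi => by rw [h i hi]]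
  rw [Finset.sum_congr rfl fun i _ => show 4 * cheb * r.p * ((1 - I.θhat) *
    (1 - I.θhat) ^ (k - 1 - i)) * gradDiff P I r ξ ζ i = (1 - I.θhat) * (4 * cheb * r.p *
    (1 - I.θhat) ^ (k - 1 - i) * gradDiff P I r ξ ζ i) by ring]
  ring

theorem majU_succ (k : ℕ) : majU P I r ξ ζ (k + 1)
    = (1 - I.θhat) ^ 2 * (majU P I r ξ ζ k + 2 * cheb * r.p * errX P I r ξ ζ k) := by
  have h : ∀ i ∈ Finset.range (k + 1), (1 - I.θhat) ^ (2 * (k + 1 - i))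
      = (1 - I.θhat) ^ 2 * (1 - I.θhat) ^ (2 * (k - i)) := by
    intro i hi
    rw [← pow_add]
    congr 1
    have := Finset.mem_range.1 hi
    omega
  simp only [majU]
  rw [Finset.sum_congr rfl fun i hi => by rw [h i hi]]
  rw [Finset.sum_congr rfl fun i _ => show 2 * cheb * r.p * ((1 - I.θhat) ^ 2 *
    (1 - I.θhat) ^ (2 * (k - i))) * errX P I r ξ ζ i = (1 - I.θhat) ^ 2 * (2 * cheb * r.p *
    (1 - I.θhat) ^ (2 * (k - i)) * errX P I r ξ ζ i) by ring, ← Finset.mul_sum,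
    Finset.sum_range_succ, Nat.sub_self]
  ring

theorem majZ_succ (k : ℕ) : majZ P I r ξ ζ (k + 1)
    = (1 - I.θhat) * (majZ P I r ξ ζ k + (8 * cheb * r.β ^ 2 / I.θhat * errX P I r ξ ζ k
        + 8 * cheb * r.η ^ 2 / I.θhat * majG P I r ξ ζ k
        + 2 * cheb * (r.η ^ 2 / r.q + 2 * r.η ^ 2 / I.θhat) * gradDiff P I r ξ ζ k)) := by
  have h : ∀ i ∈ Finset.range (k + 1), (1 - I.θhat) ^ (k + 1 - i)
      = (1 - I.θhat) * (1 - I.θhat) ^ (k - i) := by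
    intro i hi
    rw [← pow_succ']
    congr 1
    have := Finset.mem_range.1 hi
    omega
  simp only [majZ]
  rw [Finset.sum_congr rfl fun i hi => by rw [h i hi, mul_assoc], ← Finset.mul_sum,
    Finset.sum_range_succ, Nat.sub_self]
  ring

theorem gradDiff_nonneg (k : ℕ) : 0 ≤ gradDiff P I r ξ ζ k :=
  integral_nonneg fun _ => frobSq_nonneg _

theorem errX_nonneg (k : ℕ) : 0 ≤ errX P I r ξ ζ k :=
  integral_nonneg fun _ => consErr_nonneg _

theorem cheb_pos : 0 < cheb := by norm_num [cheb]

variable [IsProbabilityMeasure P]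

theorem accG_sq_le (hn : 0 < n) (hI : I.Assumptions) (hr : r.Valid)
    (hs : Sampling P r.p r.q ξ ζ) (hp : r.p ≤ I.θhat * (1 - I.θhat)) (k : ℕ) :
    2 * cheb * (∫ ω, accG I r ξ ζ k ω ^ 2 ∂P)
      + 2 * cheb * (1 - I.θhat) ^ k * consErr (initState I).Gr ≤ majG P I r ξ ζ k := by
  have hc := cheb_pos
  induction k with
  | zero => simp [accG, majG]
  | succ k ih =>
    have hd : Past ξ ζ k fun ω => fnorm ((rv I r ξ ζ k ω).gradDiff I r) :=
      (past_rv I r k).comp fun s => fnorm (s.gradDiff I r)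
    have hS := past_accG I r ξ ζ k
    have hstep := integral_le_comb_of_affine hs hr.q_mem.1.ne'
      (N := fun ω => accG I r ξ ζ (k + 1) ω ^ 2)
      (A := fun ω => (1 - I.θhat) ^ 2 * accG I r ξ ζ k ω ^ 2)
      (B := fun ω => 2 * (1 - I.θhat) * accG I r ξ ζ k ω * fnorm ((rv I r ξ ζ k ω).gradDiff I r)
        + fnorm ((rv I r ξ ζ k ω).gradDiff I r) ^ 2)
      (C := fun _ => 0) (f₁ := fun ω => accG I r ξ ζ k ω ^ 2)
      (f₂ := fun ω => frobSq ((rv I r ξ ζ k ω).gradDiff I r)) (f₃ := fun _ => 0)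
      (f₄ := fun _ => 0) (1 - I.θhat) (2 * r.p) 0 0
      ((past_accG I r ξ ζ (k + 1)).comp fun a => a ^ 2)
      (hS.comp fun a => (1 - I.θhat) ^ 2 * a ^ 2)
      (hS.comp₂ hd fun a b => 2 * (1 - I.θhat) * a * b + b ^ 2) (Past.const 0)
      (hS.comp fun a => a ^ 2) ((past_rv I r k).comp fun s => frobSq (s.gradDiff I r))
      (Past.const 0) (Past.const 0) ?_ ?_
    · have h2 : ∫ ω, frobSq ((rv I r ξ ζ k ω).gradDiff I r) ∂P = gradDiff P I r ξ ζ k := rfl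
      rw [majG_succ, pow_succ]
      rw [h2] at hstep
      simp only [integral_zero, mul_zero, add_zero] at hstep
      have h3 := mul_le_mul_of_nonneg_left ih (one_sub_thetaHat_nonneg I)
      have h4 := mul_le_mul_of_nonneg_left hstep (show (0 : ℝ) ≤ 2 * cheb by positivity)
      linarith
    · intro ω
      simp only [accG]
      rcases hs.values_ξ k ω with h | h <;> rw [h] <;> apply le_of_eq <;> ring
    · intro ω
      simp only [← fnorm_sq, zero_mul, add_zero]
      set S := accG I r ξ ζ k ω
      set e := fnorm ((rv I r ξ ζ k ω).gradDiff I r)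
      have h0 := one_sub_thetaHat_nonneg I
      have hθ := thetaHat_pos hn hI
      have hp0 := hr.p_mem.1
      have h1 : 2 * (1 - I.θhat) * S * e ≤ S ^ 2 + e ^ 2 := by
        have hS : 0 ≤ S := accG_nonneg hs.values_ξ k ω
        have he : 0 ≤ e := fnorm_nonneg _
        nlinarith [sq_nonneg (S - e), mul_nonneg (mul_nonneg hS he) hθ.le]
      have h2 := mul_le_mul_of_nonneg_left h1 hp0.le
      have h3 := mul_le_mul_of_nonneg_right hp (sq_nonneg S)
      linarith

/-- The consensus error of `G^k` in expectation. -/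
theorem consErr_G_le (hn : 0 < n) (hI : I.Assumptions) (hr : r.Valid)
    (hs : Sampling P r.p r.q ξ ζ) (hp : r.p ≤ I.θhat * (1 - I.θhat)) (k : ℕ) :
    ∫ ω, consErr (rv I r ξ ζ k ω).Gr ∂P ≤ majG P I r ξ ζ k := by
  have hc := cheb_pos
  refine le_trans ?_ (accG_sq_le hn hI hr hs hp k)
  have h := integral_le_comb hs (N := fun ω => consErr (rv I r ξ ζ k ω).Gr)
    (f₁ := fun ω => accG I r ξ ζ k ω ^ 2) (f₂ := fun _ => 1) (f₃ := fun _ => 0) (f₄ := fun _ => 0)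
    (2 * cheb) (2 * cheb * (1 - I.θhat) ^ k * consErr (initState I).Gr) 0 0
    ((past_rv I r k).comp fun s => consErr s.Gr) ((past_accG I r ξ ζ k).comp fun a => a ^ 2)
    (Past.const 1) (Past.const 0) (Past.const 0) ?_
  · simpa using h
  · intro ω
    have h1 := (decay_G hn hI hs.values_ξ k ω (r := r) (ζ := ζ)).cnorm_top_le
    have h2 := pow_le_pow_left₀ (cnorm_nonneg _) h1 2
    rw [cnorm_sq, mul_pow, Real.sq_sqrt hc.le] at h2
    have h0 := one_sub_thetaHat_nonneg I
    have h3 : (1 - I.θhat) ^ k ≤ 1 := pow_le_one₀ h0 (by linarith [thetaHat_pos hn hI])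
    have h4 : 0 ≤ (1 - I.θhat) ^ k := pow_nonneg h0 k
    refine h2.trans ?_
    rw [← cnorm_sq (initState I).Gr]
    set g := cnorm (initState I).Gr
    set S := accG I r ξ ζ k ω
    set x := (1 - I.θhat) ^ k
    have h5 : (x * g + S) ^ 2 ≤ 2 * x * g ^ 2 + 2 * S ^ 2 := by
      nlinarith [sq_nonneg (x * g - S), mul_nonneg (mul_nonneg h4 (sub_nonneg.2 h3)) (sq_nonneg g)]
    have := mul_le_mul_of_nonneg_left h5 hc.le
    linarith

/-- The consensus error of `U^k` in expectation. -/
theorem consErr_U_le (hn : 0 < n) (hI : I.Assumptions) (hr : r.Valid)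
    (hs : Sampling P r.p r.q ξ ζ) (k : ℕ) :
    ∫ ω, consErr (rv I r ξ ζ k ω).U ∂P ≤ majU P I r ξ ζ k := by
  have hc := cheb_pos
  have hp0 := hr.p_mem.1
  have h1 : ∀ k, cheb * ∫ ω, accU I r ξ ζ k ω ^ 2 ∂P ≤ majU P I r ξ ζ k := by
    intro k
    induction k with
    | zero =>
      simp only [accU, majU, cnorm_sq]
      have := consErr_nonneg (initState I).U
      have := mul_nonneg hc.le this
      simp
      linarith
    | succ k ih =>
      have hS := past_accU I r ξ ζ k
      have hstep := integral_le_comb_of_affine hs hr.q_mem.1.ne'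
        (N := fun ω => accU I r ξ ζ (k + 1) ω ^ 2)
        (A := fun ω => (1 - I.θhat) ^ 2 * accU I r ξ ζ k ω ^ 2)
        (B := fun ω => (1 - I.θhat) ^ 2 * (consErr ((rv I r ξ ζ k ω).X r) - accU I r ξ ζ k ω ^ 2))
        (C := fun _ => 0) (f₁ := fun ω => accU I r ξ ζ k ω ^ 2)
        (f₂ := fun ω => consErr ((rv I r ξ ζ k ω).X r)) (f₃ := fun _ => 0)
        (f₄ := fun _ => 0) ((1 - I.θhat) ^ 2) ((1 - I.θhat) ^ 2 * r.p) 0 0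
        ((past_accU I r ξ ζ (k + 1)).comp fun a => a ^ 2)
        (hS.comp fun a => (1 - I.θhat) ^ 2 * a ^ 2)
        (hS.comp₂ (past_rv I r k) fun a s => (1 - I.θhat) ^ 2 * (consErr (s.X r) - a ^ 2))
        (Past.const 0)
        (hS.comp fun a => a ^ 2) ((past_rv I r k).comp fun s => consErr (s.X r))
        (Past.const 0) (Past.const 0) ?_ ?_
      · have h2 : ∫ ω, consErr ((rv I r ξ ζ k ω).X r) ∂P = errX P I r ξ ζ k := rfl
        rw [majU_succ]
        rw [h2] at hstep
        simp only [integral_zero, mul_zero, add_zero] at hstep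
        have h3 := mul_le_mul_of_nonneg_left ih (sq_nonneg (1 - I.θhat))
        have h4 := mul_le_mul_of_nonneg_left hstep hc.le
        have h5 : 0 ≤ (1 - I.θhat) ^ 2 * (cheb * r.p * errX P I r ξ ζ k) :=
          mul_nonneg (sq_nonneg _) (mul_nonneg (mul_nonneg hc.le hp0.le) (errX_nonneg k))
        linarith
      · intro ω
        simp only [accU, ← cnorm_sq]
        rcases hs.values_ξ k ω with h | h <;> rw [h] <;> apply le_of_eq <;> ring
      · intro ω
        have := mul_nonneg (sq_nonneg (1 - I.θhat)) (mul_nonneg hp0.le (sq_nonneg (accU I r ξ ζ k ω)))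
        linarith
  refine le_trans ?_ (h1 k)
  have h := integral_le_comb hs (N := fun ω => consErr (rv I r ξ ζ k ω).U)
    (f₁ := fun ω => accU I r ξ ζ k ω ^ 2) (f₂ := fun _ => 0) (f₃ := fun _ => 0) (f₄ := fun _ => 0)
    cheb 0 0 0
    ((past_rv I r k).comp fun s => consErr s.U) ((past_accU I r ξ ζ k).comp fun a => a ^ 2)
    (Past.const 0) (Past.const 0) (Past.const 0) ?_
  · simpa using h
  · intro ω
    have h1 := (decay_U hn hI hs.values_ξ k ω (r := r) (ζ := ζ)).cnorm_top_le
    have h2 := pow_le_pow_left₀ (cnorm_nonneg _) h1 2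
    rw [cnorm_sq, mul_pow, Real.sq_sqrt hc.le] at h2
    simp only [mul_zero, add_zero]
    exact h2

/-- Young's inequality for the second moment of `S⁺ = (1 - θ̂) (S + β x + η g + η ζ e)`: part of the
contraction factor `1 - θ̂` is spent on the splitting. -/
theorem accZ_young {t S x g e β η q : ℝ} (ht : 0 < t) (ht1 : t ≤ 1) (hq : 0 < q) :
    (1 - t) ^ 2 * (S + β * x + η * g) ^ 2
      + (1 - t) ^ 2 * (2 * (S + β * x + η * g) * η * e + η ^ 2 * e ^ 2 / q)
    ≤ (1 - t) * S ^ 2 + (1 - t) * (4 * β ^ 2 / t) * x ^ 2 + (1 - t) * (4 * η ^ 2 / t) * g ^ 2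
      + (1 - t) * (η ^ 2 / q + 2 * η ^ 2 / t) * e ^ 2 := by
  have h0 : 0 ≤ 1 - t := by linarith
  set b := β * x + η * g + η * e
  have h1 : (1 - t) * (S + b) ^ 2 ≤ S ^ 2 + b ^ 2 / t := by
    have : S ^ 2 + b ^ 2 / t - (1 - t) * (S + b) ^ 2 = (t * S - (1 - t) * b) ^ 2 / t + b ^ 2 := by
      field_simp
      ring
    have h2 : 0 ≤ (t * S - (1 - t) * b) ^ 2 / t := by positivity
    linarith [sq_nonneg b]
  have h2 : b ^ 2 / t ≤ (4 * β ^ 2 / t) * x ^ 2 + (4 * η ^ 2 / t) * g ^ 2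
      + 2 * η ^ 2 / t * e ^ 2 := by
    have : b ^ 2 ≤ 4 * β ^ 2 * x ^ 2 + 4 * η ^ 2 * g ^ 2 + 2 * η ^ 2 * e ^ 2 := by
      nlinarith [sq_nonneg (β * x - η * g), sq_nonneg (β * x + η * g - η * e)]
    calc b ^ 2 / t ≤ (4 * β ^ 2 * x ^ 2 + 4 * η ^ 2 * g ^ 2 + 2 * η ^ 2 * e ^ 2) / t := by gcongr
      _ = _ := by ring
  have h3 := mul_le_mul_of_nonneg_left (h1.trans (add_le_add_right h2 _)) h0
  have h4 : (1 - t) ^ 2 * (η ^ 2 * e ^ 2 / q - η ^ 2 * e ^ 2) ≤ (1 - t) * (η ^ 2 / q * e ^ 2) := by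
    have h5 : η ^ 2 * e ^ 2 / q - η ^ 2 * e ^ 2 ≤ η ^ 2 * e ^ 2 / q := by
      linarith [mul_nonneg (sq_nonneg η) (sq_nonneg e)]
    have h6 : (1 - t) ^ 2 ≤ 1 - t := by nlinarith
    have h7 : 0 ≤ η ^ 2 * e ^ 2 / q := by positivity
    calc _ ≤ (1 - t) ^ 2 * (η ^ 2 * e ^ 2 / q) := mul_le_mul_of_nonneg_left h5 (sq_nonneg _)
      _ ≤ (1 - t) * (η ^ 2 * e ^ 2 / q) := mul_le_mul_of_nonneg_right h6 h7
      _ = _ := by ring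
  have e1 : (1 - t) ^ 2 * (S + β * x + η * g) ^ 2
      + (1 - t) ^ 2 * (2 * (S + β * x + η * g) * η * e + η ^ 2 * e ^ 2 / q)
      = (1 - t) * ((1 - t) * (S + b) ^ 2)
        + (1 - t) ^ 2 * (η ^ 2 * e ^ 2 / q - η ^ 2 * e ^ 2) := by
    simp only [b]
    ring
  rw [e1]
  linarith

theorem accZ_sq_le (hn : 0 < n) (hI : I.Assumptions) (hr : r.Valid)
    (hs : Sampling P r.p r.q ξ ζ) (hp : r.p ≤ I.θhat * (1 - I.θhat)) (k : ℕ) :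
    2 * cheb * (∫ ω, accZ I r ξ ζ k ω ^ 2 ∂P)
      + 2 * cheb * (1 - I.θhat) ^ k * consErr (initState I).Z ≤ majZ P I r ξ ζ k := by
  have hc := cheb_pos
  have hq := hr.q_mem.1
  have hθ := thetaHat_pos hn hI
  have hθ1 : I.θhat ≤ 1 := by linarith [one_sub_thetaHat_nonneg I]
  induction k with
  | zero => simp [accZ, majZ]
  | succ k ih =>
    have hrv := past_rv (ξ := ξ) (ζ := ζ) I r k
    have hS := past_accZ I r ξ ζ k
    have hstep := integral_le_comb_of_affine hs hq.ne'
      (N := fun ω => accZ I r ξ ζ (k + 1) ω ^ 2)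
      (A := fun ω => (1 - I.θhat) ^ 2 * (accZ I r ξ ζ k ω + r.β * cnorm ((rv I r ξ ζ k ω).X r)
        + r.η * cnorm (rv I r ξ ζ k ω).Gr) ^ 2)
      (B := fun _ => 0)
      (C := fun ω => (1 - I.θhat) ^ 2 * (2 * (accZ I r ξ ζ k ω
        + r.β * cnorm ((rv I r ξ ζ k ω).X r) + r.η * cnorm (rv I r ξ ζ k ω).Gr)
        * r.η * fnorm ((rv I r ξ ζ k ω).gradDiff I r)
        + r.η ^ 2 * fnorm ((rv I r ξ ζ k ω).gradDiff I r) ^ 2 / r.q))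
      (f₁ := fun ω => accZ I r ξ ζ k ω ^ 2)
      (f₂ := fun ω => consErr ((rv I r ξ ζ k ω).X r))
      (f₃ := fun ω => consErr (rv I r ξ ζ k ω).Gr)
      (f₄ := fun ω => frobSq ((rv I r ξ ζ k ω).gradDiff I r))
      (1 - I.θhat) ((1 - I.θhat) * (4 * r.β ^ 2 / I.θhat))
      ((1 - I.θhat) * (4 * r.η ^ 2 / I.θhat))
      ((1 - I.θhat) * (r.η ^ 2 / r.q + 2 * r.η ^ 2 / I.θhat))
      ((past_accZ I r ξ ζ (k + 1)).comp fun a => a ^ 2)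
      (hS.comp₂ hrv fun a s => (1 - I.θhat) ^ 2 * (a + r.β * cnorm (s.X r)
        + r.η * cnorm s.Gr) ^ 2) (Past.const 0)
      (hS.comp₂ hrv fun a s => (1 - I.θhat) ^ 2 * (2 * (a + r.β * cnorm (s.X r)
        + r.η * cnorm s.Gr) * r.η * fnorm (s.gradDiff I r)
        + r.η ^ 2 * fnorm (s.gradDiff I r) ^ 2 / r.q))
      (hS.comp fun a => a ^ 2) (hrv.comp fun s => consErr (s.X r)) (hrv.comp fun s => consErr s.Gr)
      (hrv.comp fun s => frobSq (s.gradDiff I r)) ?_ ?_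
    · have h2 : ∫ ω, frobSq ((rv I r ξ ζ k ω).gradDiff I r) ∂P = gradDiff P I r ξ ζ k := rfl
      have h2' : ∫ ω, consErr ((rv I r ξ ζ k ω).X r) ∂P = errX P I r ξ ζ k := rfl
      rw [majZ_succ, pow_succ]
      rw [h2, h2'] at hstep
      have hG := consErr_G_le hn hI hr hs hp k
      have h0 := one_sub_thetaHat_nonneg I
      have h3 := mul_le_mul_of_nonneg_left ih h0
      have h4 := mul_le_mul_of_nonneg_left hstep (show (0 : ℝ) ≤ 2 * cheb by positivity)
      have h5 := mul_le_mul_of_nonneg_left hG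
        (show (0 : ℝ) ≤ (1 - I.θhat) * (8 * cheb * r.η ^ 2 / I.θhat) by positivity)
      have e1 : 8 * cheb * r.β ^ 2 / I.θhat = 2 * cheb * (4 * r.β ^ 2 / I.θhat) := by ring
      have e2 : 8 * cheb * r.η ^ 2 / I.θhat = 2 * cheb * (4 * r.η ^ 2 / I.θhat) := by ring
      rw [e2] at h5
      rw [e1, e2]
      linarith
    · intro ω
      simp only [accZ, zero_mul, add_zero]
      rcases hs.values_ζ k ω with h | h <;> rw [h] <;> apply le_of_eq <;> field_simp <;> ring
    · intro ω
      simp only [← fnorm_sq, ← cnorm_sq, mul_zero, add_zero]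
      exact accZ_young hθ hθ1 hq

/-- The consensus error of `Z^k` in expectation. -/
theorem consErr_Z_le (hn : 0 < n) (hI : I.Assumptions) (hr : r.Valid)
    (hs : Sampling P r.p r.q ξ ζ) (hp : r.p ≤ I.θhat * (1 - I.θhat)) (k : ℕ) :
    ∫ ω, consErr (rv I r ξ ζ k ω).Z ∂P ≤ majZ P I r ξ ζ k := by
  have hc := cheb_pos
  refine le_trans ?_ (accZ_sq_le hn hI hr hs hp k)
  have h := integral_le_comb hs (N := fun ω => consErr (rv I r ξ ζ k ω).Z)
    (f₁ := fun ω => accZ I r ξ ζ k ω ^ 2) (f₂ := fun _ => 1) (f₃ := fun _ => 0) (f₄ := fun _ => 0)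
    (2 * cheb) (2 * cheb * (1 - I.θhat) ^ k * consErr (initState I).Z) 0 0
    ((past_rv I r k).comp fun s => consErr s.Z) ((past_accZ I r ξ ζ k).comp fun a => a ^ 2)
    (Past.const 1) (Past.const 0) (Past.const 0) ?_
  · simpa using h
  · intro ω
    have h1 := (decay_Z (ξ := ξ) hn hI hr hs.values_ζ k ω).cnorm_top_le
    have h2 := pow_le_pow_left₀ (cnorm_nonneg _) h1 2
    rw [cnorm_sq, mul_pow, Real.sq_sqrt hc.le] at h2
    have h0 := one_sub_thetaHat_nonneg I
    have h3 : (1 - I.θhat) ^ k ≤ 1 := pow_le_one₀ h0 (by linarith [thetaHat_pos hn hI])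
    have h4 : 0 ≤ (1 - I.θhat) ^ k := pow_nonneg h0 k
    refine h2.trans ?_
    rw [← cnorm_sq (initState I).Z]
    set g := cnorm (initState I).Z
    set S := accZ I r ξ ζ k ω
    set x := (1 - I.θhat) ^ k
    have h5 : (x * g + S) ^ 2 ≤ 2 * x * g ^ 2 + 2 * S ^ 2 := by
      nlinarith [sq_nonneg (x * g - S), mul_nonneg (mul_nonneg h4 (sub_nonneg.2 h3)) (sq_nonneg g)]
    have := mul_le_mul_of_nonneg_left h5 hc.le
    linarith

end Majorants

/-! ### Decrease of the consensus Lyapunov function -/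

section ConsensusScalars

/-- `α ‖Π Z‖` is split off by Young's inequality with weight `τ / 7`, and the remaining convex
combination is treated by Jensen's inequality. -/
theorem sq_combination_le {τ α a x y z u : ℝ} (hτ : 0 < τ) (hτ1 : τ < 1) (ha1 : a ≤ 1 - τ) (hx : 0 ≤ x)
    (hy : 0 ≤ y) (hu : 0 ≤ u)
    (h : x ≤ a * y + α * z + τ * u) :
    x ^ 2 ≤ (1 + τ / 7) * ((1 - τ) * y ^ 2 + τ * u ^ 2) + 8 / τ * α ^ 2 * z ^ 2 := by
  set v := (1 - τ) * y + τ * u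
  have hv : 0 ≤ v := by
    have : 0 ≤ 1 - τ := by linarith
    positivity
  have h1 : x ≤ v + α * z := by
    have := mul_le_mul_of_nonneg_right ha1 hy
    simp only [v]
    linarith
  have h2 : x ^ 2 ≤ (v + α * z) ^ 2 := pow_le_pow_left₀ hx h1 2
  have h3 : (v + α * z) ^ 2 ≤ (1 + τ / 7) * v ^ 2 + 8 / τ * (α * z) ^ 2 := by
    have e : (1 + τ / 7) * v ^ 2 + 8 / τ * (α * z) ^ 2 - (v + α * z) ^ 2
        = (τ * v - 7 * (α * z)) ^ 2 / (7 * τ) + (1 - τ) / τ * (α * z) ^ 2 := by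
      field_simp
      ring
    have : 0 ≤ (τ * v - 7 * (α * z)) ^ 2 / (7 * τ) + (1 - τ) / τ * (α * z) ^ 2 := by
      have : 0 ≤ 1 - τ := by linarith
      positivity
    linarith
  have h4 : v ^ 2 ≤ (1 - τ) * y ^ 2 + τ * u ^ 2 := by
    have : (1 - τ) * y ^ 2 + τ * u ^ 2 - v ^ 2 = τ * (1 - τ) * (y - u) ^ 2 := by
      simp only [v]
      ring
    have : 0 ≤ τ * (1 - τ) * (y - u) ^ 2 := mul_nonneg (mul_nonneg hτ.le (by linarith)) (sq_nonneg _)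
    linarith
  have h5 := mul_le_mul_of_nonneg_left h4 (show 0 ≤ 1 + τ / 7 by positivity)
  rw [mul_pow] at h3
  linarith

theorem sq_momentum_le {τ γ x y z w : ℝ} (hτ : 0 < τ) (hτ1 : τ < 1) (hy : 0 ≤ y)
    (h : y ≤ x + γ * (z + w)) :
    y ^ 2 ≤ (4 - τ) / (4 - 2 * τ) * x ^ 2 + (4 - τ) / τ * γ ^ 2 * (2 * z ^ 2 + 2 * w ^ 2) := by
  have h2 : y ^ 2 ≤ (x + γ * (z + w)) ^ 2 := pow_le_pow_left₀ hy h 2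
  have h42 : 0 < 4 - 2 * τ := by linarith
  have h4 : 0 < 4 - τ := by linarith
  have e : (4 - τ) / (4 - 2 * τ) * x ^ 2 + (4 - τ) / τ * (γ * (z + w)) ^ 2 - (x + γ * (z + w)) ^ 2
      = (τ * x - (4 - 2 * τ) * (γ * (z + w))) ^ 2 / (τ * (4 - 2 * τ)) := by
    have h42' : 4 - 2 * τ ≠ 0 := h42.ne'
    rw [← sub_eq_zero]
    generalize hD : 4 - 2 * τ = D at h42' ⊢
    obtain rfl : τ = (4 - D) / 2 := by linarith
    have h4D : 4 - D ≠ 0 := (by linarith : 0 < 4 - D).ne'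
    field_simp
    ring
  have e0 : 0 ≤ (τ * x - (4 - 2 * τ) * (γ * (z + w))) ^ 2 / (τ * (4 - 2 * τ)) := by positivity
  have e1 : (4 - τ) / τ * (γ * (z + w)) ^ 2 ≤ (4 - τ) / τ * γ ^ 2 * (2 * z ^ 2 + 2 * w ^ 2) := by
    rw [mul_pow, ← mul_assoc]
    refine mul_le_mul_of_nonneg_left ?_ (by positivity)
    nlinarith [sq_nonneg (z - w)]
  linarith

variable {τ th p q α β γ η L c A bb t e Q Y Z U G Δ Q' Y' Z' U' G' : ℝ}

/-- As `2 (1 - τ) / (2 - τ) ≥ 1 - τ`, the first consensus condition leaves only room of the order of `τ`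
for its other terms, so that `p` is small compared with `τ θ̂`. -/
theorem prob_le_of_cons₁ (hτ : 0 < τ) (hτ1 : τ < 1) (hth : 0 < th) {m : ℝ} (hm : 0 ≤ m)
    (h : 2 * (1 - τ) / (2 - τ) + m + τ / 4 + 32 * cheb * p / th ≤ 1 - τ / 8) :
    p ≤ τ * th / 700 := by
  have h2 : 0 < 2 - τ := by linarith
  have e1 : 2 * (1 - τ) / (2 - τ) = 1 - τ / (2 - τ) := by
    field_simp
    ring
  have e2 : τ / (2 - τ) ≤ τ := by
    rw [div_le_iff₀ h2]
    nlinarith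
  have e3 : 32 * cheb * p / th ≤ 5 / 8 * τ := by linarith
  rw [div_le_iff₀ hth, cheb] at e3
  nlinarith [mul_pos hτ hth]

/-- The decrease of the consensus Lyapunov function, from the recursions of its constituents.
Here `A = (1 - τ) γ² / τ` and `bb = η² / q + 2 η² / θ̂`. -/
theorem consensus_decrease (hτ : 0 < τ) (hτ1 : τ < 1) (hth : 0 < th) (hth1 : th ≤ 3 / 10)
    (hp : 0 < p) (hc : 0 < c) (hA : A = (1 - τ) * γ ^ 2 / τ) (hL : 0 < L) (hbb : 0 ≤ bb)
    (ht : t ≤ p / 2) (ht' : t ≤ th / 2) (hpτ : p ≤ τ * th / 700)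
    (hQ0 : 0 ≤ Q) (hY0 : 0 ≤ Y) (hZ0 : 0 ≤ Z) (hU0 : 0 ≤ U) (hG0 : 0 ≤ G) (hΔ0 : 0 ≤ Δ)
    (he0 : 0 ≤ e)
    (c₁ : 2 * (1 - τ) / (2 - τ) + 384 * c * A * β ^ 2 / th ^ 2 + τ / 4 + 32 * c * p / th
      ≤ 1 - τ / 8)
    (c₂ : α ^ 2 / ((1 - τ) * γ ^ 2) ≤ 1) (hγ : 0 < γ)
    (c₃ : 384 * c * A * η ^ 2 * L ^ 2 / th ≤ th / 2)
    (hQ : Q' = (1 - p) * Q + p * e)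
    (hY : 4 * (1 - τ) / (4 - τ) * Y' ≤ 2 * (1 - τ) / (2 - τ) * e + 8 * A * (Z' + Z))
    (hU : U' = (1 - th) ^ 2 * (U + 2 * c * p * e))
    (hZ : Z' = (1 - th) * (Z + (8 * c * β ^ 2 / th * e + 8 * c * η ^ 2 / th * G + 2 * c * bb * Δ)))
    (hG : G' = (1 - th) * G + 4 * c * p * Δ)
    (he : e ≤ (1 + τ / 7) * ((1 - τ) * Y + τ * U) + 8 / τ * α ^ 2 * Z) :
    τ / (4 * p) * Q' + 4 * (1 - τ) / (4 - τ) * Y' + 16 / th * U'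
        + (1 - th / 6) * (48 * A / th) * Z' + 1 / (th * L ^ 2) * G'
      ≤ (1 - t) * (τ / (4 * p) * Q + 4 * (1 - τ) / (4 - τ) * Y + 16 / th * U
        + (1 - th / 6) * (48 * A / th) * Z + 1 / (th * L ^ 2) * G)
        - τ / 8 * e - τ / 8 * Q + (96 * c * A / th * bb + 4 * c * p / (th * L ^ 2)) * Δ := by
  have hτ0 : 0 < 1 - τ := by linarith
  have hA0 : 0 < A := by rw [hA]; positivity
  have h4τ : 0 < 4 - τ := by linarith
  have q1 : τ / (4 * p) * Q' ≤ (1 - t) * (τ / (4 * p) * Q) - τ / 8 * Q + τ / 4 * e := by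
    have e1 : τ / (4 * p) * Q' = τ / (4 * p) * Q - τ / 4 * Q + τ / 4 * e := by
      rw [hQ]
      field_simp
    have e2 : t * (τ / (4 * p)) ≤ τ / 8 := by
      calc t * (τ / (4 * p)) ≤ p / 2 * (τ / (4 * p)) := by gcongr
        _ = τ / 8 := by field_simp; norm_num
    have := mul_le_mul_of_nonneg_right e2 hQ0
    linarith
  have u1 : 16 / th * U' ≤ (1 - t) * (16 / th * U) - 8 * U + 32 * c * p / th * e := by
    have e1 : (1 - th) ^ 2 ≤ 1 - t - th / 2 := by nlinarith only [hth, hth1, ht']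
    have e2 : (1 - th) ^ 2 ≤ 1 := by nlinarith only [hth, hth1]
    have e3 : 16 / th * ((1 - th) ^ 2 * U) ≤ 16 / th * ((1 - t - th / 2) * U) := by gcongr
    have e4 : 16 / th * ((1 - th) ^ 2 * (2 * c * p * e)) ≤ 16 / th * (1 * (2 * c * p * e)) := by
      gcongr
    have e5 : 16 / th * ((1 - t - th / 2) * U) = (1 - t) * (16 / th * U) - 8 * U := by
      field_simp
      ring
    have e6 : 16 / th * (1 * (2 * c * p * e)) = 32 * c * p / th * e := by ring
    rw [hU, mul_add, mul_add]
    linarith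
  have z1 : 48 * A / th * Z' + 8 * A * Z ≤ (1 - t) * ((1 - th / 6) * (48 * A / th) * Z) - 8 * A * Z
      + 384 * c * A * β ^ 2 / th ^ 2 * e + 384 * c * A * η ^ 2 / th ^ 2 * G
      + 96 * c * A / th * bb * Δ := by
    set rest := 384 * c * A * β ^ 2 / th ^ 2 * e + 384 * c * A * η ^ 2 / th ^ 2 * G
      + 96 * c * A / th * bb * Δ with hrest
    have hrest0 : 0 ≤ rest := by positivity
    have e1 : 48 * A / th * Z' = 48 * A / th * Z - 48 * A * Z + (1 - th) * rest := by
      rw [hZ, hrest]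
      field_simp
      ring
    have e2 : (1 - th) * rest ≤ rest := by nlinarith only [hth, hrest0]
    have e3 : (1 - th / 2) * (1 - th / 6) ≤ (1 - t) * (1 - th / 6) :=
      mul_le_mul_of_nonneg_right (by linarith) (by linarith)
    have e4 : 1 - 2 / 3 * th ≤ (1 - t) * (1 - th / 6) := by
      nlinarith only [e3, hth]
    have e5 := mul_le_mul_of_nonneg_right e4 (show 0 ≤ 48 * A / th * Z by positivity)
    have e6 : (1 - 2 / 3 * th) * (48 * A / th * Z) = 48 * A / th * Z - 32 * A * Z := by
      field_simp
      ring
    linarith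
  have g1 : 1 / (th * L ^ 2) * G' + 384 * c * A * η ^ 2 / th ^ 2 * G
      ≤ (1 - t) * (1 / (th * L ^ 2) * G) + 4 * c * p / (th * L ^ 2) * Δ := by
    have e1 : 384 * c * A * η ^ 2 / th ^ 2 ≤ th / 2 * (1 / (th * L ^ 2)) := by
      have : 384 * c * A * η ^ 2 / th ^ 2
          = 384 * c * A * η ^ 2 * L ^ 2 / th * (1 / (th * L ^ 2)) := by
        field_simp
      rw [this]
      gcongr
    have e2 := mul_le_mul_of_nonneg_right e1 hG0
    have e3 : 0 ≤ (th / 2 - t) * (1 / (th * L ^ 2) * G) :=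
      mul_nonneg (by linarith) (by positivity)
    have e4 : 1 / (th * L ^ 2) * (4 * c * p * Δ) = 4 * c * p / (th * L ^ 2) * Δ := by ring
    rw [hG, mul_add, e4]
    linarith
  have y1 : e ≤ (1 - t) * (4 * (1 - τ) / (4 - τ) * Y) + 8 * U + 8 * A * Z := by
    have e1 : (1 + τ / 7) * (1 - τ / 4) ≤ 1 - t := by
      nlinarith only [ht, hpτ, hτ, hth, hth1]
    have e2 : 1 + τ / 7 ≤ (1 - t) * (4 / (4 - τ)) := by
      rw [mul_div_assoc', le_div_iff₀ h4τ]
      linarith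
    have e3 := mul_le_mul_of_nonneg_right e2 (mul_nonneg hτ0.le hY0)
    have e4 : (1 - t) * (4 / (4 - τ)) * ((1 - τ) * Y) = (1 - t) * (4 * (1 - τ) / (4 - τ) * Y) := by
      ring
    have e5 : (1 + τ / 7) * τ * U ≤ 8 * U := 
      mul_le_mul_of_nonneg_right (by nlinarith only [hτ, hτ1]) hU0
    have e6 : 8 / τ * α ^ 2 ≤ 8 * A := by
      rw [div_le_one (by positivity)] at c₂
      rw [hA]
      calc 8 / τ * α ^ 2 ≤ 8 / τ * ((1 - τ) * γ ^ 2) := by gcongr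
        _ = _ := by ring
    have e7 := mul_le_mul_of_nonneg_right e6 hZ0
    linarith
  have ce := mul_le_mul_of_nonneg_right c₁ he0
  have z2 : (1 - th / 6) * (48 * A / th) * Z' = 48 * A / th * Z' - 8 * A * Z' := by
    field_simp
    ring
  linarith

end ConsensusScalars

section ConsensusDecrease

variable {n d : ℕ} {Ω : Type*} {I : Problem n d} {r : Params} {ξ ζ : ℕ → Ω → ℝ}
  [MeasurableSpace Ω] {P : Measure Ω}

/-- Membership in the admissible range and the conditions keep the weight of `Y` positive. -/
theorem weightY_pos (hr : r.Valid) (hc : Conditions I r) : 0 < 1 - r.α - r.τ := by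
  have h := hc.main₃
  have hα := hr.α_mem.1
  have h1 : 1 < 1 / r.γ := (one_lt_div hr.γ_mem.1).2 hr.γ_mem.2
  have h2 : 0 < (1 - r.α - r.τ) / r.α := by linarith
  exact (div_pos_iff_of_pos_right hα).1 h2

theorem Conditions.prob_le (hn : 0 < n) (hI : I.Assumptions) (hr : r.Valid)
    (hc : Conditions I r) : r.p ≤ r.τ * I.θhat / 700 := by
  have hτ := hr.τ_mem
  have hθ := thetaHat_pos hn hI
  have := cheb_pos
  have h1 : 0 < 1 - r.τ := by linarith [hτ.2]
  exact prob_le_of_cons₁ hτ.1 hτ.2 hθ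
    (div_nonneg (by have := hτ.1; positivity) (mul_nonneg hτ.1.le (sq_nonneg _))) hc.cons₁

theorem consErr_X_le (hr : r.Valid) (hc : Conditions I r) (s : State n d) :
    consErr (s.X r) ≤ (1 + r.τ / 7) * ((1 - r.τ) * consErr s.Y + r.τ * consErr s.U)
      + 8 / r.τ * r.α ^ 2 * consErr s.Z := by
  have hw := weightY_pos hr hc
  have hα := hr.α_mem.1
  have hτ := hr.τ_mem
  simp only [← cnorm_sq]
  refine sq_combination_le (a := 1 - r.α - r.τ) hτ.1 hτ.2 (by linarith) (cnorm_nonneg _) (cnorm_nonneg _)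
    (cnorm_nonneg _) ?_
  rw [State.X]
  refine (cnorm_add_le _ _).trans ?_
  have := cnorm_add_le ((1 - r.α - r.τ) • s.Y) (r.α • s.Z)
  simp only [cnorm_smul, abs_of_pos hw, abs_of_pos hα, abs_of_pos hτ.1] at this ⊢
  linarith

/-- The weights are those for which the factor `4 (1 - τ) / (4 - τ)` of `‖Π Y‖²` in the Lyapunov function
turns the coefficient of `‖Π X‖²` into `2 (1 - τ) / (2 - τ)`. -/
theorem consErr_Y_step_le (hr : r.Valid) (x z : ℝ) (s : State n d) :
    consErr (step I r x z s).Y ≤ (4 - r.τ) / (4 - 2 * r.τ) * consErr (s.X r)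
      + (4 - r.τ) / r.τ * r.γ ^ 2 * (2 * consErr (step I r x z s).Z + 2 * consErr s.Z) := by
  have hγ := hr.γ_mem.1
  simp only [← cnorm_sq]
  refine sq_momentum_le hr.τ_mem.1 hr.τ_mem.2 (cnorm_nonneg _) ?_
  have h : (step I r x z s).Y = s.X r + r.γ • ((step I r x z s).Z + (-1 : ℝ) • s.Z) := by
    rw [neg_one_smul, ← sub_eq_add_neg]
    rfl
  rw [h]
  refine (cnorm_add_le _ _).trans ?_
  rw [cnorm_smul, abs_of_pos hγ]
  have := cnorm_add_le (step I r x z s).Z ((-1 : ℝ) • s.Z)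
  rw [cnorm_smul, abs_neg, abs_one, one_mul] at this
  gcongr

theorem majG_nonneg (hr : r.Valid) (k : ℕ) : 0 ≤ majG P I r ξ ζ k := by
  have := cheb_pos
  have := hr.p_mem.1
  have := one_sub_thetaHat_nonneg I
  have := consErr_nonneg (initState I).Gr
  refine add_nonneg (Finset.sum_nonneg fun i _ => mul_nonneg (by positivity) (gradDiff_nonneg i))
    (by positivity)

variable [IsProbabilityMeasure P]

theorem majU_nonneg (hn : 0 < n) (hI : I.Assumptions) (hr : r.Valid)
    (hs : Sampling P r.p r.q ξ ζ) (k : ℕ) : 0 ≤ majU P I r ξ ζ k :=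
  (integral_nonneg fun _ => consErr_nonneg _).trans (consErr_U_le hn hI hr hs k)

theorem errX_le (hn : 0 < n) (hI : I.Assumptions) (hr : r.Valid) (hc : Conditions I r)
    (hs : Sampling P r.p r.q ξ ζ) (hp : r.p ≤ I.θhat * (1 - I.θhat)) (k : ℕ) :
    errX P I r ξ ζ k ≤ (1 + r.τ / 7) * ((1 - r.τ) * ∫ ω, consErr (rv I r ξ ζ k ω).Y ∂P
      + r.τ * majU P I r ξ ζ k) + 8 / r.τ * r.α ^ 2 * majZ P I r ξ ζ k := by
  have hτ := hr.τ_mem.1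
  have h := integral_le_comb hs (N := fun ω => consErr ((rv I r ξ ζ k ω).X r))
    (f₁ := fun ω => consErr (rv I r ξ ζ k ω).Y) (f₂ := fun ω => consErr (rv I r ξ ζ k ω).U)
    (f₃ := fun ω => consErr (rv I r ξ ζ k ω).Z) (f₄ := fun _ => 0)
    ((1 + r.τ / 7) * (1 - r.τ)) ((1 + r.τ / 7) * r.τ) (8 / r.τ * r.α ^ 2) 0
    ((past_rv I r k).comp fun s => consErr (s.X r)) ((past_rv I r k).comp fun s => consErr s.Y)
    ((past_rv I r k).comp fun s => consErr s.U) ((past_rv I r k).comp fun s => consErr s.Z)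
    (Past.const 0) ?_
  · have h1 := mul_le_mul_of_nonneg_left (consErr_U_le hn hI hr hs k)
      (show 0 ≤ (1 + r.τ / 7) * r.τ by positivity)
    have h2 := mul_le_mul_of_nonneg_left (consErr_Z_le hn hI hr hs hp k)
      (show 0 ≤ 8 / r.τ * r.α ^ 2 by positivity)
    rw [errX]
    linarith
  · intro ω
    have := consErr_X_le hr hc (rv I r ξ ζ k ω)
    linarith

theorem consErr_Y_succ_le (hn : 0 < n) (hI : I.Assumptions) (hr : r.Valid)
    (hs : Sampling P r.p r.q ξ ζ) (hp : r.p ≤ I.θhat * (1 - I.θhat)) (k : ℕ) :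
    4 * (1 - r.τ) / (4 - r.τ) * ∫ ω, consErr (rv I r ξ ζ (k + 1) ω).Y ∂P
      ≤ 2 * (1 - r.τ) / (2 - r.τ) * errX P I r ξ ζ k
        + 8 * ((1 - r.τ) * r.γ ^ 2 / r.τ) * (majZ P I r ξ ζ (k + 1) + majZ P I r ξ ζ k) := by
  have hτ := hr.τ_mem.1
  have hτ1 : 0 < 1 - r.τ := by linarith [hr.τ_mem.2]
  have hτ2 : 0 < 2 - r.τ := by linarith
  have hτ4 : 0 < 4 - r.τ := by linarith
  have hτ42 : 0 < 4 - 2 * r.τ := by linarith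
  have h := integral_le_comb hs (N := fun ω => consErr (rv I r ξ ζ (k + 1) ω).Y)
    (f₁ := fun ω => consErr ((rv I r ξ ζ k ω).X r))
    (f₂ := fun ω => consErr (rv I r ξ ζ (k + 1) ω).Z)
    (f₃ := fun ω => consErr (rv I r ξ ζ k ω).Z) (f₄ := fun _ => 0)
    ((4 - r.τ) / (4 - 2 * r.τ)) ((4 - r.τ) / r.τ * r.γ ^ 2 * 2) ((4 - r.τ) / r.τ * r.γ ^ 2 * 2) 0
    ((past_rv I r (k + 1)).comp fun s => consErr s.Y)
    ((past_rv I r k).succ.comp fun s => consErr (s.X r))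
    ((past_rv I r (k + 1)).comp fun s => consErr s.Z)
    ((past_rv I r k).succ.comp fun s => consErr s.Z) (Past.const 0) ?_
  · have h1 := mul_le_mul_of_nonneg_left (consErr_Z_le hn hI hr hs hp k)
      (show 0 ≤ 8 * ((1 - r.τ) * r.γ ^ 2 / r.τ) by positivity)
    have h2 := mul_le_mul_of_nonneg_left (consErr_Z_le hn hI hr hs hp (k + 1))
      (show 0 ≤ 8 * ((1 - r.τ) * r.γ ^ 2 / r.τ) by positivity)
    have h3 := mul_le_mul_of_nonneg_left h (show 0 ≤ 4 * (1 - r.τ) / (4 - r.τ) by positivity)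
    simp only [integral_zero, mul_zero, add_zero] at h3
    have e1 : ∀ x y z : ℝ, 4 * (1 - r.τ) / (4 - r.τ) * ((4 - r.τ) / (4 - 2 * r.τ) * x
        + (4 - r.τ) / r.τ * r.γ ^ 2 * 2 * y + (4 - r.τ) / r.τ * r.γ ^ 2 * 2 * z)
        = 2 * (1 - r.τ) / (2 - r.τ) * x + 8 * ((1 - r.τ) * r.γ ^ 2 / r.τ) * y
          + 8 * ((1 - r.τ) * r.γ ^ 2 / r.τ) * z := by
      intro x y z
      rw [show 4 - 2 * r.τ = 2 * (2 - r.τ) by ring]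
      field_simp
      ring
    rw [e1] at h3
    rw [errX]
    linarith
  · intro ω
    have := consErr_Y_step_le (I := I) hr (ξ k ω) (ζ k ω) (rv I r ξ ζ k ω)
    rw [rv_succ]
    linarith

theorem consErr_Q_succ (hs : Sampling P r.p r.q ξ ζ) (k : ℕ) :
    ∫ ω, consErr (rv I r ξ ζ (k + 1) ω).Q ∂P
      = (1 - r.p) * ∫ ω, consErr (rv I r ξ ζ k ω).Q ∂P + r.p * errX P I r ξ ζ k := by
  have hQ := (past_rv (ξ := ξ) (ζ := ζ) I r k).comp fun s => consErr s.Q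
  have hX := (past_rv (ξ := ξ) (ζ := ζ) I r k).comp fun s => consErr (s.X r)
  have hB := (past_rv (ξ := ξ) (ζ := ζ) I r k).comp fun s => consErr (s.X r) - consErr s.Q
  have h : ∀ ω, consErr (rv I r ξ ζ (k + 1) ω).Q = consErr (rv I r ξ ζ k ω).Q
      + (consErr ((rv I r ξ ζ k ω).X r) - consErr (rv I r ξ ζ k ω).Q) * ξ k ω := by
    intro ω
    have h1 : (rv I r ξ ζ (k + 1) ω).Q
        = (1 - ξ k ω) • (rv I r ξ ζ k ω).Q + ξ k ω • (rv I r ξ ζ k ω).X r := rfl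
    rw [h1]
    rcases hs.values_ξ k ω with h | h <;> rw [h] <;> simp
  have hiB : Integrable (fun ω => (consErr ((rv I r ξ ζ k ω).X r) - consErr (rv I r ξ ζ k ω).Q)
      * ξ k ω) P := (hB.succ.comp₂ (Past.input k) fun b x => b * x.1).integrable hs
  simp only [h]
  rw [integral_add (hQ.integrable hs) hiB, hB.integral_mul_xi hs,
    integral_sub (hX.integrable hs) (hQ.integrable hs), errX]
  ring

theorem consLyap_eq (hs : Sampling P r.p r.q ξ ζ) (k : ℕ) :
    consLyap P I r ξ ζ k = 8 / r.τ *
    (r.τ / (4 * r.p) * (∫ ω, consErr (rv I r ξ ζ k ω).Q ∂P)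
      + 4 * (1 - r.τ) / (4 - r.τ) * (∫ ω, consErr (rv I r ξ ζ k ω).Y ∂P)
      + 16 / I.θhat * majU P I r ξ ζ k
      + (1 - I.θhat / 6) * (48 * ((1 - r.τ) * r.γ ^ 2 / r.τ) / I.θhat) * majZ P I r ξ ζ k
      + 1 / (I.θhat * I.L ^ 2) * majG P I r ξ ζ k) := by
  have hQ := ((past_rv (ξ := ξ) (ζ := ζ) I r k).comp fun s => consErr s.Q).integrable hs
  have hY := ((past_rv (ξ := ξ) (ζ := ζ) I r k).comp fun s => consErr s.Y).integrable hs
  rw [consLyap, integral_add (hQ.const_mul _) (hY.const_mul _), integral_const_mul,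
    integral_const_mul]
  congr 4
  rw [mul_assoc 48, mul_div_assoc 48, mul_div_assoc 48, div_div]

theorem consLyap_nonneg (hn : 0 < n) (hI : I.Assumptions) (hr : r.Valid)
    (hs : Sampling P r.p r.q ξ ζ) (hp : r.p ≤ I.θhat * (1 - I.θhat)) (k : ℕ) :
    0 ≤ consLyap P I r ξ ζ k := by
  have hθ := thetaHat_pos hn hI
  have hτ := hr.τ_mem.1
  have hτ1 : 0 < 1 - r.τ := by linarith [hr.τ_mem.2]
  have hτ4 : 0 < 4 - r.τ := by linarith
  have hp0 := hr.p_mem.1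
  have h1 : 0 ≤ ∫ ω, consErr (rv I r ξ ζ k ω).Q ∂P := integral_nonneg fun _ => consErr_nonneg _
  have h2 : 0 ≤ ∫ ω, consErr (rv I r ξ ζ k ω).Y ∂P := integral_nonneg fun _ => consErr_nonneg _
  have h3 := majU_nonneg hn hI hr hs k
  have h4 := majG_nonneg (P := P) (I := I) (ξ := ξ) (ζ := ζ) hr k
  have h5 : 0 ≤ majZ P I r ξ ζ k :=
    (integral_nonneg fun _ => consErr_nonneg _).trans (consErr_Z_le hn hI hr hs hp k)
  have h6 : 0 ≤ 1 - I.θhat / 6 := by linarith [one_sub_thetaHat_nonneg I]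
  rw [consLyap_eq hs]
  positivity

theorem consLyap_succ_le (hn : 0 < n) (hI : I.Assumptions) (hL : 0 < I.L) (hr : r.Valid)
    (hc : Conditions I r) (hs : Sampling P r.p r.q ξ ζ) {t : ℝ} (ht : t ≤ r.p / 2)
    (ht' : t ≤ I.θhat / 2) (k : ℕ) :
    consLyap P I r ξ ζ (k + 1) ≤ (1 - t) * consLyap P I r ξ ζ k - errX P I r ξ ζ k
      - (∫ ω, consErr (rv I r ξ ζ k ω).Q ∂P)
      + 2 * cheb * constB I r * gradDiff P I r ξ ζ k := by
  have hθ := thetaHat_pos hn hI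
  have hθ1 : I.θhat ≤ 3 / 10 := accGap_le _
  have hτ := hr.τ_mem
  have hpτ := hc.prob_le hn hI hr
  have hp : r.p ≤ I.θhat * (1 - I.θhat) := by nlinarith [hτ.1, hτ.2]
  have hq := hr.q_mem.1
  have hη := hr.η_pos
  have hτ1 : 0 < 1 - r.τ := by linarith [hτ.2]
  have e₁ : 384 * cheb * ((1 - r.τ) * r.γ ^ 2 / r.τ) * r.β ^ 2 / I.θhat ^ 2
      = 384 * cheb * (1 - r.τ) * r.γ ^ 2 * r.β ^ 2 / (r.τ * I.θhat ^ 2) := by ring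
  have e₃ : 384 * cheb * ((1 - r.τ) * r.γ ^ 2 / r.τ) * r.η ^ 2 * I.L ^ 2 / I.θhat
      = 384 * cheb * (1 - r.τ) * r.γ ^ 2 * r.η ^ 2 * I.L ^ 2 / (r.τ * I.θhat) := by ring
  have h := consensus_decrease hτ.1 hτ.2 hθ hθ1 hr.p_mem.1 cheb_pos rfl hL
    (show 0 ≤ r.η ^ 2 / r.q + 2 * r.η ^ 2 / I.θhat by positivity) ht ht' hpτ
    (integral_nonneg fun ω => consErr_nonneg (rv I r ξ ζ k ω).Q)
    (integral_nonneg fun ω => consErr_nonneg (rv I r ξ ζ k ω).Y)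
    ((integral_nonneg fun _ => consErr_nonneg _).trans (consErr_Z_le hn hI hr hs hp k))
    (majU_nonneg hn hI hr hs k) (majG_nonneg hr k) (gradDiff_nonneg k) (errX_nonneg k)
    (e₁ ▸ hc.cons₁) hc.cons₂ hr.γ_mem.1 (e₃ ▸ hc.cons₃) (consErr_Q_succ hs k)
    (consErr_Y_succ_le hn hI hr hs hp k) (majU_succ k) (majZ_succ k) (majG_succ k)
    (errX_le hn hI hr hc hs hp k)
  rw [consLyap_eq hs, consLyap_eq hs]
  have h8 := mul_le_mul_of_nonneg_left h (show 0 ≤ 8 / r.τ by have := hτ.1; positivity)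
  refine h8.trans (le_of_eq ?_)
  have eB : 2 * cheb * constB I r = 8 / r.τ *
      (96 * cheb * ((1 - r.τ) * r.γ ^ 2 / r.τ) / I.θhat * (r.η ^ 2 / r.q + 2 * r.η ^ 2 / I.θhat)
        + 4 * cheb * r.p / (I.θhat * I.L ^ 2)) := by
    rw [constB]
    ring
  have eτ : 8 / r.τ * (r.τ / 8) = 1 := by
    have := hτ.1.ne'
    field_simp
  rw [eB]
  linear_combination (-(errX P I r ξ ζ k) - ∫ ω, consErr (rv I r ξ ζ k ω).Q ∂P) * eτ

end ConsensusDecrease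

/-! ### Strongly convex and smooth objectives -/

section Objective

variable {d : ℕ} {μ L : ℝ} {φ : Vec d → ℝ}

theorem IsStronglyConvexSmooth.mu_le (hd : 0 < d) (h : IsStronglyConvexSmooth μ L φ) : μ ≤ L := by
  obtain ⟨h1, h2⟩ := h.2 (EuclideanSpace.single ⟨0, hd⟩ 1) 0
  have h3 := h1.trans h2
  simp only [sub_zero, EuclideanSpace.single, PiLp.norm_single, norm_one, one_pow, mul_one] at h3
  linarith

/-- Cocoercivity of the gradient: the smoothness bound at the point reached by a gradient step of
the function tilted to have its minimum at `x`. -/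
theorem IsStronglyConvexSmooth.cocoercive (hμ : 0 ≤ μ) (hL : 0 < L)
    (h : IsStronglyConvexSmooth μ L φ) (x y : Vec d) :
    φ x + inner ℝ (gradient φ x) (y - x) + 1 / (2 * L) * ‖gradient φ y - gradient φ x‖ ^ 2
      ≤ φ y := by
  set g := gradient φ y - gradient φ x with hg
  have h1 := (h.2 (y - L⁻¹ • g) x).1
  have h2 := (h.2 (y - L⁻¹ • g) y).2
  have e1 : y - L⁻¹ • g - x = (y - x) - L⁻¹ • g := by abel
  have e2 : y - L⁻¹ • g - y = -(L⁻¹ • g) := by abel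
  have e3 : inner ℝ (gradient φ y) g = inner ℝ (gradient φ x) g + ‖g‖ ^ 2 := by
    rw [← real_inner_self_eq_norm_sq, ← inner_add_left, hg, add_sub_cancel]
  rw [e1, inner_sub_right, real_inner_smul_right] at h1
  rw [e2, inner_neg_right, real_inner_smul_right, norm_neg, norm_smul, mul_pow, e3,
    Real.norm_eq_abs, sq_abs] at h2
  have h3 : 0 ≤ μ / 2 * ‖y - x - L⁻¹ • g‖ ^ 2 := by positivity
  have e4 : L / 2 * (L⁻¹ ^ 2 * ‖g‖ ^ 2) = 1 / (2 * L) * ‖g‖ ^ 2 := by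
    field_simp
  have e5 : L⁻¹ * ‖g‖ ^ 2 = 2 * (1 / (2 * L) * ‖g‖ ^ 2) := by
    field_simp
  rw [e4, mul_add, e5] at h2
  linarith

theorem IsStronglyConvexSmooth.lipschitz (hμ : 0 ≤ μ) (hL : 0 < L)
    (h : IsStronglyConvexSmooth μ L φ) (x y : Vec d) :
    ‖gradient φ y - gradient φ x‖ ^ 2 ≤ L ^ 2 * ‖y - x‖ ^ 2 := by
  have h1 := (h.cocoercive hμ hL x y).trans (h.2 y x).2
  have h2 : 1 / (2 * L) * ‖gradient φ y - gradient φ x‖ ^ 2 ≤ L / 2 * ‖y - x‖ ^ 2 := by linarith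
  have h3 := mul_le_mul_of_nonneg_left h2 (show 0 ≤ 2 * L by positivity)
  calc _ = 2 * L * (1 / (2 * L) * ‖gradient φ y - gradient φ x‖ ^ 2) := by field_simp
    _ ≤ 2 * L * (L / 2 * ‖y - x‖ ^ 2) := h3
    _ = _ := by ring

end Objective

section InexactOracle

variable {n d : ℕ} {I : Problem n d}

/-- The value at the average of the rows of `X` of the linear models of the local objectives at the
rows. Together with the average of the local gradients it forms an inexact first-order oracle for
the average objective. -/
noncomputable def Problem.model (I : Problem n d) (X : Rows (Fin n) d) : ℝ :=
  (n : ℝ)⁻¹ * ∑ i, (I.f i (X i) + inner ℝ (gradient (I.f i) (X i)) (rowAvg X - X i))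

theorem Problem.Assumptions.L_pos (hn : 0 < n) (hd : 0 < d) (hI : I.Assumptions) : 0 < I.L :=
  hI.mu_pos.trans_le ((hI.objective ⟨0, hn⟩).mu_le hd)

theorem model_add_inner (X : Rows (Fin n) d) (x : Vec d) :
    I.model X + inner ℝ (rowAvg (I.gradF X)) (x - rowAvg X)
      = (n : ℝ)⁻¹ * ∑ i, (I.f i (X i) + inner ℝ (gradient (I.f i) (X i)) (x - X i)) := by
  have h : ∀ i, inner ℝ (gradient (I.f i) (X i)) (x - X i)
      = inner ℝ (gradient (I.f i) (X i)) (rowAvg X - X i)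
        + inner ℝ (gradient (I.f i) (X i)) (x - rowAvg X) := by
    intro i
    rw [← inner_add_right]
    congr 1
    abel
  simp only [h, ← add_assoc]
  rw [Finset.sum_add_distrib, mul_add, ← sum_inner]
  congr 1
  rw [rowAvg, real_inner_smul_left]
  rfl

theorem model_lower (hn : 0 < n) (hI : I.Assumptions) (X : Rows (Fin n) d) (x : Vec d) :
    I.model X + inner ℝ (rowAvg (I.gradF X)) (x - rowAvg X) + I.μ / 2 * ‖x - rowAvg X‖ ^ 2
      ≤ I.favg x := by
  have hn' : (0 : ℝ) < n := by exact_mod_cast hn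
  have hμ := hI.mu_pos
  have h1 : ∑ i, (I.f i (X i) + inner ℝ (gradient (I.f i) (X i)) (x - X i))
      + I.μ / 2 * ∑ i, ‖x - X i‖ ^ 2 ≤ ∑ i, I.f i x := by
    rw [Finset.mul_sum, ← Finset.sum_add_distrib]
    exact Finset.sum_le_sum fun i _ => ((hI.objective i).2 x (X i)).1
  rw [sum_norm_sub_sq hn] at h1
  have h2 := mul_le_mul_of_nonneg_left h1 (inv_nonneg.2 hn'.le)
  rw [mul_add, ← model_add_inner] at h2
  have h3 : (n : ℝ)⁻¹ * (I.μ / 2 * (n * ‖x - rowAvg X‖ ^ 2 + consErr X))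
      = I.μ / 2 * ‖x - rowAvg X‖ ^ 2 + (n : ℝ)⁻¹ * (I.μ / 2 * consErr X) := by
    field_simp
  have h4 : 0 ≤ (n : ℝ)⁻¹ * (I.μ / 2 * consErr X) := by
    have := consErr_nonneg X
    positivity
  rw [Problem.favg]
  linarith

theorem model_upper (hn : 0 < n) (hI : I.Assumptions) (X : Rows (Fin n) d) (x : Vec d) :
    I.favg x ≤ I.model X + inner ℝ (rowAvg (I.gradF X)) (x - rowAvg X)
      + I.L / 2 * ‖x - rowAvg X‖ ^ 2 + I.L / (2 * n) * consErr X := by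
  have hn' : (0 : ℝ) < n := by exact_mod_cast hn
  have h1 : ∑ i, I.f i x ≤ ∑ i, (I.f i (X i) + inner ℝ (gradient (I.f i) (X i)) (x - X i))
      + I.L / 2 * ∑ i, ‖x - X i‖ ^ 2 := by
    rw [Finset.mul_sum, ← Finset.sum_add_distrib]
    exact Finset.sum_le_sum fun i _ => ((hI.objective i).2 x (X i)).2
  rw [sum_norm_sub_sq hn] at h1
  have h2 := mul_le_mul_of_nonneg_left h1 (inv_nonneg.2 hn'.le)
  rw [mul_add, ← model_add_inner] at h2
  have h3 : (n : ℝ)⁻¹ * (I.L / 2 * (n * ‖x - rowAvg X‖ ^ 2 + consErr X))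
      = I.L / 2 * ‖x - rowAvg X‖ ^ 2 + I.L / (2 * n) * consErr X := by
    field_simp
  rw [Problem.favg]
  linarith

/-- Convexity at the average of `Q` with a gain in the gradient differences. These are taken at the
rows of `Q`, not at their average, which costs the consensus error of `Q`. -/
theorem model_lower_of_gradDiff (hn : 0 < n) (hd : 0 < d) (hI : I.Assumptions)
    (X Q : Rows (Fin n) d) :
    I.model X + inner ℝ (rowAvg (I.gradF X)) (rowAvg Q - rowAvg X)
        + 1 / (4 * I.L * n) * frobSq (I.gradF X - I.gradF Q) - I.L / (2 * n) * consErr Q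
      ≤ I.favg (rowAvg Q) := by
  have hn' : (0 : ℝ) < n := by exact_mod_cast hn
  have hμ := hI.mu_pos.le
  have hL := hI.L_pos hn hd
  have h1 : ∑ i, (I.f i (X i) + inner ℝ (gradient (I.f i) (X i)) (rowAvg Q - X i))
      + (1 / (4 * I.L) * frobSq (I.gradF X - I.gradF Q) - I.L / 2 * consErr Q)
      ≤ ∑ i, I.f i (rowAvg Q) := by
    rw [frobSq, consErr_eq, Finset.mul_sum, Finset.mul_sum, ← Finset.sum_sub_distrib,
      ← Finset.sum_add_distrib]
    refine Finset.sum_le_sum fun i _ => ?_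
    have h2 := (hI.objective i).cocoercive hμ hL (X i) (rowAvg Q)
    have h3 := (hI.objective i).lipschitz hμ hL (rowAvg Q) (Q i)
    have h4 : ‖(I.gradF X - I.gradF Q) i‖ ^ 2
        ≤ 2 * ‖gradient (I.f i) (rowAvg Q) - gradient (I.f i) (X i)‖ ^ 2
          + 2 * ‖gradient (I.f i) (Q i) - gradient (I.f i) (rowAvg Q)‖ ^ 2 := by
      set a := gradient (I.f i) (rowAvg Q) - gradient (I.f i) (X i)
      set b := gradient (I.f i) (Q i) - gradient (I.f i) (rowAvg Q)
      have e : (I.gradF X - I.gradF Q) i = -(a + b) := by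
        simp only [Pi.sub_apply, Problem.gradF, a, b]
        abel
      rw [e, norm_neg]
      have := pow_le_pow_left₀ (norm_nonneg _) (norm_add_le a b) 2
      nlinarith [sq_nonneg (‖a‖ - ‖b‖)]
    have h5 : ‖(I.gradF X - I.gradF Q) i‖ ^ 2
        ≤ 2 * ‖gradient (I.f i) (rowAvg Q) - gradient (I.f i) (X i)‖ ^ 2
          + 2 * (I.L ^ 2 * ‖Q i - rowAvg Q‖ ^ 2) := by linarith
    have h6 := mul_le_mul_of_nonneg_left h5 (show 0 ≤ 1 / (4 * I.L) by positivity)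
    have e : ∀ a b : ℝ, 1 / (4 * I.L) * (2 * a + 2 * (I.L ^ 2 * b))
        = 1 / (2 * I.L) * a + I.L / 2 * b := by
      intro a b
      field_simp
      ring
    rw [e] at h6
    linarith
  have h2 := mul_le_mul_of_nonneg_left h1 (inv_nonneg.2 hn'.le)
  rw [mul_add, ← model_add_inner] at h2
  have h3 : (n : ℝ)⁻¹ * (1 / (4 * I.L) * frobSq (I.gradF X - I.gradF Q) - I.L / 2 * consErr Q)
      = 1 / (4 * I.L * n) * frobSq (I.gradF X - I.gradF Q) - I.L / (2 * n) * consErr Q := by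
    field_simp
  rw [Problem.favg]
  linarith

end InexactOracle

/-! ### Descent of the averaged iterates -/

section Descent

variable {E : Type*} [NormedAddCommGroup E] [InnerProductSpace ℝ E]

/-- The three-point identity of the proximal gradient step that defines `z'`. -/
theorem three_point {η β : ℝ} {z x z' gh : E} (s : E)
    (h : (1 + β) • z' = z + β • x - η • gh) :
    (1 + β) * ‖z' - s‖ ^ 2 = ‖z - s‖ ^ 2 - ‖z' - z‖ ^ 2 + β * ‖x - s‖ ^ 2 - β * ‖x - z'‖ ^ 2
      - 2 * η * inner ℝ gh (z' - s) := by
  have h1 : η • gh = (z - z') + β • (x - z') := by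
    have : η • gh = z + β • x - (1 + β) • z' := by
      rw [h]
      abel
    rw [this]
    module
  have e1 : z - s = (z - z') + (z' - s) := by abel
  have e2 : x - s = (x - z') + (z' - s) := by abel
  have e3 : 2 * η * inner ℝ gh (z' - s) = 2 * inner ℝ (η • gh) (z' - s) := by
    rw [real_inner_smul_left]
    ring
  rw [e3, h1, inner_add_left, real_inner_smul_left, e1, e2, norm_add_sq_real (z - z'),
    norm_add_sq_real (x - z'), norm_sub_rev z' z]
  ring

/-- One step of the accelerated method with an inexact oracle `(fh, g)` and a stochastic error
`(1 - ζ) δ` of the gradient, in terms of averaged iterates. -/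
theorem descent {α β γ τ q η μ L N ζ : ℝ} {x y z u s y' z' g δ : E}
    {fx fy fu fs fy' fh e Qe Δ : ℝ}
    (hα : 0 < α) (hβ : 0 < β) (hγ : 0 < γ) (hτ : 0 < τ) (hη : 0 < η) (hL : 0 < L) (hN : 0 < N)
    (hw : 0 < 1 - α - τ)
    (m₁ : L * γ ≤ 1 / (4 * η)) (m₂ : β / (2 * η) ≤ μ / 4)
    (m₃ : 1 / γ - (1 - α - τ) / α - 1 / 2 ≤ 0) (m₄ : (1 - α - τ) / α ≤ 1 / γ - 1 / 4)
    (hμ : 0 < μ) (hx : x = (1 - α - τ) • y + α • z + τ • u)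
    (hz : (1 + β) • z' = z + β • x - η • (g + (1 - ζ) • δ))
    (hy : y' = x + γ • (z' - z)) (hζ : ζ ^ 2 = ζ / q)
    (o₁ : fy' ≤ fh + inner ℝ g (y' - x) + L / 2 * ‖y' - x‖ ^ 2 + L / (2 * N) * e)
    (o₂ : fx ≤ fh + L / (2 * N) * e)
    (o₃ : fh + inner ℝ g (s - x) + μ / 2 * ‖s - x‖ ^ 2 ≤ fs)
    (o₄ : fh + inner ℝ g (y - x) ≤ fy)
    (o₅ : fh + inner ℝ g (u - x) + 1 / (4 * L * N) * Δ - L / (2 * N) * Qe ≤ fu)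
    (hfx : fs ≤ fx) (hfy : fs ≤ fy) :
    1 / γ * (fy' - fs) + (1 + β) / (2 * η) * ‖z' - s‖ ^ 2 + (τ / α + 1 / 2) * (fx - fs)
      ≤ (1 / γ - 1 / 4) * (fy - fs) + τ / α * (fu - fs) + 1 / (2 * η) * ‖z - s‖ ^ 2
        + L / (2 * N * α) * e + τ * L / (2 * α * N) * Qe - τ / (4 * α * L * N) * Δ
        + 2 * η / 3 * (1 / q - 1) * ‖δ‖ ^ 2
        + (inner ℝ δ (z - s) + 2 * η / 3 * (1 / q - 2) * ‖δ‖ ^ 2) * (ζ - 1) := by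
  set a := inner ℝ g (z' - z) with ha
  set a0 := inner ℝ g (s - x)
  set a1 := inner ℝ g (y - x)
  set a2 := inner ℝ g (u - x)
  set k1 := (1 - α - τ) / α with hk1
  set t1 := τ / α with ht1
  have hk10 : 0 < k1 := by positivity
  have ht10 : 0 < t1 := by positivity
  have hsum : k1 + t1 + 1 = 1 / α := by
    rw [hk1, ht1]
    field_simp
    ring
  -- the gradient at `z` is distributed over the directions to `s`, `y` and `u`
  have hzs : inner ℝ g (z - s) = -(k1 * a1) - t1 * a2 - a0 := by
    have h1 : α * inner ℝ g (z - x) = -((1 - α - τ) * a1) - τ * a2 := by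
      have : α • (z - x) = -((1 - α - τ) • (y - x)) - τ • (u - x) := by
        have h2 : α • z = x - (1 - α - τ) • y - τ • u := by
          rw [hx]
          abel
        rw [smul_sub, h2]
        module
      rw [← real_inner_smul_right, this, inner_sub_right, inner_neg_right, real_inner_smul_right,
        real_inner_smul_right]
    have h3 : inner ℝ g (z - x) = -(k1 * a1) - t1 * a2 := by
      rw [hk1, ht1]
      field_simp
      linarith
    rw [show z - s = (z - x) - (s - x) by abel, inner_sub_right, h3]
  have hyx : y' - x = γ • (z' - z) := by rw [hy]; abel
  rw [hyx, real_inner_smul_right, norm_smul, mul_pow, Real.norm_eq_abs, sq_abs, ← ha] at o₁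
  have h3p := three_point s hz
  have hin : inner ℝ (g + (1 - ζ) • δ) (z' - s) = a + inner ℝ g (z - s)
      + (1 - ζ) * inner ℝ δ (z' - z) + (1 - ζ) * inner ℝ δ (z - s) := by
    rw [show z' - s = (z' - z) + (z - s) by abel, inner_add_left, real_inner_smul_left,
      inner_add_right, inner_add_right, ha]
    ring
  -- Young's inequality absorbs the noise into the quadratic term left by the three-point identity
  have hyoung : -((1 - ζ) * inner ℝ δ (z' - z)) ≤ 3 / (8 * η) * ‖z' - z‖ ^ 2
      + 2 * η / 3 * ((1 - ζ) ^ 2 * ‖δ‖ ^ 2) := by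
    have h1 := real_inner_self_nonneg (x := (4 * η * (1 - ζ)) • δ + (3 : ℝ) • (z' - z))
    rw [real_inner_self_eq_norm_sq, norm_add_sq_real, norm_smul, norm_smul, mul_pow, mul_pow,
      Real.norm_eq_abs, Real.norm_eq_abs, sq_abs, sq_abs, real_inner_smul_left,
      real_inner_smul_right] at h1
    have e : 3 / (8 * η) * ‖z' - z‖ ^ 2 + 2 * η / 3 * ((1 - ζ) ^ 2 * ‖δ‖ ^ 2)
        + (1 - ζ) * inner ℝ δ (z' - z) = ((4 * η * (1 - ζ)) ^ 2 * ‖δ‖ ^ 2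
          + 2 * (4 * η * (1 - ζ) * (3 * inner ℝ δ (z' - z))) + 3 ^ 2 * ‖z' - z‖ ^ 2)
          / (24 * η) := by
      field_simp
      ring
    have := div_nonneg h1 (show 0 ≤ 24 * η by positivity)
    linarith
  have hζ2 : (1 - ζ) ^ 2 = (1 / q - 1) + (1 / q - 2) * (ζ - 1) := by
    have : (1 - ζ) ^ 2 = 1 - 2 * ζ + ζ ^ 2 := by ring
    rw [this, hζ]
    ring
  rw [hζ2] at hyoung
  have hstep : (1 + β) / (2 * η) * ‖z' - s‖ ^ 2 = 1 / (2 * η) * ‖z - s‖ ^ 2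
      - 1 / (2 * η) * ‖z' - z‖ ^ 2 + β / (2 * η) * ‖x - s‖ ^ 2 - β / (2 * η) * ‖x - z'‖ ^ 2
      - inner ℝ (g + (1 - ζ) • δ) (z' - s) := by
    have : (1 + β) / (2 * η) * ‖z' - s‖ ^ 2 = 1 / (2 * η) * ((1 + β) * ‖z' - s‖ ^ 2) := by ring
    rw [this, h3p]
    field_simp
  rw [hin, hzs] at hstep
  have hdrop : 0 ≤ β / (2 * η) * ‖x - z'‖ ^ 2 := by positivity
  have hquad : L * γ / 2 * ‖z' - z‖ ^ 2 ≤ (1 / (2 * η) - 3 / (8 * η)) * ‖z' - z‖ ^ 2 := by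
    refine mul_le_mul_of_nonneg_right ?_ (sq_nonneg _)
    have : 1 / (2 * η) - 3 / (8 * η) = 1 / (4 * η) / 2 := by
      field_simp
      norm_num
    rw [this]
    linarith
  have hB : β / (2 * η) * ‖x - s‖ ^ 2 ≤ μ / 2 * ‖s - x‖ ^ 2 := by
    rw [norm_sub_rev]
    exact mul_le_mul_of_nonneg_right (by linarith) (sq_nonneg _)
  have hy1 : 1 / γ * (fy' - fs) ≤ 1 / γ * (fh - fs) + a + L * γ / 2 * ‖z' - z‖ ^ 2
      + 1 / γ * (L / (2 * N) * e) := by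
    have h1 := mul_le_mul_of_nonneg_left o₁ (show 0 ≤ 1 / γ by positivity)
    have e1 : 1 / γ * (fh + γ * a + L / 2 * (γ ^ 2 * ‖z' - z‖ ^ 2) + L / (2 * N) * e)
        = 1 / γ * fh + a + L * γ / 2 * ‖z' - z‖ ^ 2 + 1 / γ * (L / (2 * N) * e) := by
      field_simp
    rw [e1] at h1
    linarith
  have h4 := mul_le_mul_of_nonneg_left o₄ hk10.le
  have h5 := mul_le_mul_of_nonneg_left o₅ ht10.le
  have h6 := mul_le_mul_of_nonneg_right m₄ (sub_nonneg.2 hfy)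
  have h7 := mul_le_mul_of_nonneg_left o₂ (show 0 ≤ t1 + 1 / 2 by positivity)
  have h8 : 0 ≤ (1 / 2 + k1 - 1 / γ) * (fh - fs + L / (2 * N) * e) :=
    mul_nonneg (by linarith) (by linarith)
  have e1 : L / (2 * N * α) * e = (k1 + t1 + 1) * (L / (2 * N) * e) := by
    rw [hsum]
    field_simp
  have e2 : τ * L / (2 * α * N) * Qe = t1 * (L / (2 * N) * Qe) := by
    rw [ht1]
    field_simp
  have e3 : τ / (4 * α * L * N) * Δ = t1 * (1 / (4 * L * N) * Δ) := by
    rw [ht1]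
    field_simp
  rw [e1, e2, e3, hstep]
  linarith

end Descent

/-! ### Averages of the iterates and the Lyapunov function -/

section Averages

variable {n d : ℕ} {I : Problem n d} {r : Params}

theorem rowAvg_mulRows {G : SimpleGraph (Fin n)} {W : Matrix (Fin n) (Fin n) ℝ}
    (h : IsGossip G W) (X : Rows (Fin n) d) : rowAvg (mulRows W X) = rowAvg X := by
  simp only [rowAvg, mulRows]
  rw [Finset.sum_comm]
  simp only [← Finset.sum_smul, h.col_sum, one_smul]

theorem rowAvg_top_augW (h : IsGossip I.G I.W) {A : Rows (Fin n ⊕ Fin n) d}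
    (hA : rowAvg (bot A) = rowAvg (top A)) :
    rowAvg (top (mulRows I.augW A)) = rowAvg (top A) := by
  rw [top_augW, rowAvg_add, rowAvg_smul, rowAvg_smul, rowAvg_mulRows h, hA]
  module

/-- The averages of the two halves of each `2n`-row variable agree, the tracked gradient averages to
the average gradient at `Q`, and `U` has the average of `Q`. -/
structure Balanced (I : Problem n d) (s : State n d) : Prop where
  bot_Z : rowAvg (bot s.Zt) = rowAvg s.Z
  top_U : rowAvg s.U = rowAvg s.Q
  bot_U : rowAvg (bot s.Ut) = rowAvg s.Q
  top_G : rowAvg s.Gr = rowAvg (I.gradF s.Q)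
  bot_G : rowAvg (bot s.Gt) = rowAvg (I.gradF s.Q)

theorem balanced_initState (I : Problem n d) : Balanced I (initState I) :=
  ⟨rfl, rfl, rfl, rfl, rfl⟩

theorem top_Zt_argument (s : State n d) (ζ : ℝ) :
    top (s.Zt + r.β • stack (s.X r) - r.η • stack s.Gr
      + (r.η * ζ) • (stack (I.gradF s.Q) - stack (I.gradF (s.X r))))
    = s.Z + r.β • s.X r - r.η • s.Gr + (r.η * ζ) • (I.gradF s.Q - I.gradF (s.X r)) := rfl

theorem bot_Zt_argument (s : State n d) (ζ : ℝ) :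
    bot (s.Zt + r.β • stack (s.X r) - r.η • stack s.Gr
      + (r.η * ζ) • (stack (I.gradF s.Q) - stack (I.gradF (s.X r))))
    = bot s.Zt + r.β • s.X r - r.η • s.Gr + (r.η * ζ) • (I.gradF s.Q - I.gradF (s.X r)) := rfl

theorem Balanced.rowAvg_argument {s : State n d} (hb : Balanced I s) (ζ : ℝ) :
    rowAvg (bot (s.Zt + r.β • stack (s.X r) - r.η • stack s.Gr
      + (r.η * ζ) • (stack (I.gradF s.Q) - stack (I.gradF (s.X r)))))
    = rowAvg (top (s.Zt + r.β • stack (s.X r) - r.η • stack s.Gr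
      + (r.η * ζ) • (stack (I.gradF s.Q) - stack (I.gradF (s.X r))))) := by
  rw [top_Zt_argument, bot_Zt_argument]
  simp only [rowAvg_add, rowAvg_sub, rowAvg_smul, hb.bot_Z]

theorem Balanced.rowAvg_nextZ (hI : I.Assumptions) {s : State n d} (hb : Balanced I s) (ξ ζ : ℝ) :
    rowAvg (step I r ξ ζ s).Z = (1 + r.β)⁻¹ • (rowAvg s.Z + r.β • rowAvg (s.X r)
      - r.η • rowAvg (I.gradF s.Q)
      + (r.η * ζ) • (rowAvg (I.gradF s.Q) - rowAvg (I.gradF (s.X r)))) := by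
  have h : (step I r ξ ζ s).Z = (1 + r.β)⁻¹ • top (mulRows I.augW
    (s.Zt + r.β • stack (s.X r) - r.η • stack s.Gr
      + (r.η * ζ) • (stack (I.gradF s.Q) - stack (I.gradF (s.X r))))) := rfl
  rw [h, rowAvg_smul, rowAvg_top_augW hI.gossip (hb.rowAvg_argument ζ), top_Zt_argument]
  simp only [rowAvg_add, rowAvg_sub, rowAvg_smul, hb.top_G]

theorem rowAvg_nextQ {s : State n d} (ξ ζ : ℝ) :
    rowAvg (step I r ξ ζ s).Q = (1 - ξ) • rowAvg s.Q + ξ • rowAvg (s.X r) := by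
  have h : (step I r ξ ζ s).Q = (1 - ξ) • s.Q + ξ • s.X r := rfl
  rw [h, rowAvg_add, rowAvg_smul, rowAvg_smul]

theorem Balanced.step (hI : I.Assumptions) {s : State n d} (hb : Balanced I s) {ξ : ℝ}
    (hξ : ξ = 0 ∨ ξ = 1) (ζ : ℝ) : Balanced I (step I r ξ ζ s) := by
  have hU1 : top ((1 - ξ) • s.Ut + ξ • stack (s.X r)) = (1 - ξ) • s.U + ξ • s.X r := rfl
  have hU2 : bot ((1 - ξ) • s.Ut + ξ • stack (s.X r)) = (1 - ξ) • bot s.Ut + ξ • s.X r := rfl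
  have hUavg : rowAvg (bot ((1 - ξ) • s.Ut + ξ • stack (s.X r)))
      = rowAvg (top ((1 - ξ) • s.Ut + ξ • stack (s.X r))) := by
    rw [hU1, hU2]
    simp only [rowAvg_add, rowAvg_smul, hb.top_U, hb.bot_U]
  have hUtop : rowAvg (top ((1 - ξ) • s.Ut + ξ • stack (s.X r)))
      = rowAvg (OGT.step I r ξ ζ s).Q := by
    rw [hU1, rowAvg_nextQ, rowAvg_add, rowAvg_smul, rowAvg_smul, hb.top_U]
  have hGavg : rowAvg (bot s.Gt) = rowAvg (top s.Gt) := hb.bot_G.trans hb.top_G.symm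
  have hG : rowAvg (I.gradF s.Q) + ξ • (rowAvg (I.gradF (s.X r)) - rowAvg (I.gradF s.Q))
      = rowAvg (I.gradF (OGT.step I r ξ ζ s).Q) := by
    have h : (OGT.step I r ξ ζ s).Q = (1 - ξ) • s.Q + ξ • s.X r := rfl
    rw [h]
    rcases hξ with rfl | rfl <;> simp
  refine ⟨?_, ?_, ?_, ?_, ?_⟩
  · have h1 : bot (OGT.step I r ξ ζ s).Zt = (1 + r.β)⁻¹ • bot (mulRows I.augW
      (s.Zt + r.β • stack (s.X r) - r.η • stack s.Gr
        + (r.η * ζ) • (stack (I.gradF s.Q) - stack (I.gradF (s.X r))))) := rfl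
    have h2 : (OGT.step I r ξ ζ s).Z = (1 + r.β)⁻¹ • top (mulRows I.augW
      (s.Zt + r.β • stack (s.X r) - r.η • stack s.Gr
        + (r.η * ζ) • (stack (I.gradF s.Q) - stack (I.gradF (s.X r))))) := rfl
    rw [h1, h2, rowAvg_smul, rowAvg_smul, bot_augW,
      rowAvg_top_augW hI.gossip (hb.rowAvg_argument ζ)]
  · exact (rowAvg_top_augW hI.gossip hUavg).trans hUtop
  · have h1 : bot (OGT.step I r ξ ζ s).Ut
        = bot (mulRows I.augW ((1 - ξ) • s.Ut + ξ • stack (s.X r))) := rfl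
    rw [h1, bot_augW]
    exact hUtop
  · have h1 : (OGT.step I r ξ ζ s).Gr = top (mulRows I.augW s.Gt)
        + ξ • (I.gradF (s.X r) - I.gradF s.Q) := rfl
    rw [h1, rowAvg_add, rowAvg_smul, rowAvg_sub, rowAvg_top_augW hI.gossip hGavg, ← hG]
    congr 1
    exact hb.top_G
  · have h1 : bot (OGT.step I r ξ ζ s).Gt = bot (mulRows I.augW s.Gt)
        + ξ • (I.gradF (s.X r) - I.gradF s.Q) := rfl
    rw [h1, rowAvg_add, rowAvg_smul, rowAvg_sub, bot_augW, ← hG]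
    congr 1
    exact hb.top_G

theorem balanced_rv {Ω : Type*} {ξ ζ : ℕ → Ω → ℝ} (hI : I.Assumptions)
    (hξ : ∀ k ω, ξ k ω = 0 ∨ ξ k ω = 1) (k : ℕ) (ω : Ω) : Balanced I (rv I r ξ ζ k ω) := by
  induction k with
  | zero => exact balanced_initState I
  | succ k ih => exact ih.step hI (hξ k ω) _

/-- The part of the Lyapunov function that depends on the averages. -/
noncomputable def State.mainLyap (I : Problem n d) (r : Params) (s : State n d) : ℝ :=
  1 / r.γ * (I.favg (rowAvg s.Y) - I.favg I.xs)
    + (2 * r.τ + r.α) / (2 * r.α * r.p) * (I.favg (rowAvg s.U) - I.favg I.xs)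
    + (1 + r.β) / (2 * r.η) * ‖rowAvg s.Z - I.xs‖ ^ 2

theorem mainLyap_nonneg (hI : I.Assumptions) (hr : r.Valid) (s : State n d) :
    0 ≤ s.mainLyap I r := by
  have h1 := sub_nonneg.2 (hI.minimizer (rowAvg s.Y))
  have h2 := sub_nonneg.2 (hI.minimizer (rowAvg s.U))
  have hα := hr.α_mem.1
  have hβ := hr.β_mem.1
  have hγ := hr.γ_mem.1
  have hτ := hr.τ_mem.1
  have hp := hr.p_mem.1
  have hη := hr.η_pos
  rw [State.mainLyap]
  positivity

/-- The coefficient of `ξ` in the bound for the next value of `mainLyap`. -/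
noncomputable def State.xiCoeff (I : Problem n d) (r : Params) (s : State n d) : ℝ :=
  (2 * r.τ + r.α) / (2 * r.α * r.p) * (I.favg (rowAvg (s.X r)) - I.favg (rowAvg s.U))

/-- The coefficient of `ζ` in the bound for the next value of `mainLyap`. -/
noncomputable def State.zetaCoeff (I : Problem n d) (r : Params) (s : State n d) : ℝ :=
  inner ℝ (rowAvg (I.gradF s.Q) - rowAvg (I.gradF (s.X r))) (rowAvg s.Z - I.xs)
    + 2 * r.η / 3 * (1 / r.q - 2) * ‖rowAvg (I.gradF s.Q) - rowAvg (I.gradF (s.X r))‖ ^ 2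

/-- The mean of the bound for the next value of `mainLyap`. -/
noncomputable def State.mainBound (I : Problem n d) (r : Params) (t : ℝ) (s : State n d) : ℝ :=
  (1 - t) * s.mainLyap I r + I.L / (2 * n * r.α) * consErr (s.X r)
    + r.τ * I.L / (2 * r.α * n) * consErr s.Q
    + (2 * r.η / (3 * r.q * n) - r.τ / (4 * r.α * I.L * n)) * frobSq (s.gradDiff I r)

/-- One step for fixed values of the inputs. The bound is affine in `ξ` and `ζ`, since `ξ ∈ {0, 1}` and
`ζ² = ζ / q`; its last two terms have mean zero. -/
theorem mainLyap_step_le (hn : 0 < n) (hd : 0 < d) (hI : I.Assumptions) (hr : r.Valid)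
    (hc : Conditions I r) {t : ℝ} (htγ : t ≤ r.γ / 4) (htρ : t ≤ rho r)
    (htβ : t ≤ r.β / (1 + r.β)) {s : State n d} (hb : Balanced I s) {ξ ζ : ℝ}
    (hξ : ξ = 0 ∨ ξ = 1) (hζ : ζ = 0 ∨ ζ = 1 / r.q) :
    (step I r ξ ζ s).mainLyap I r
      ≤ s.mainBound I r t + s.xiCoeff I r * (ξ - r.p) + s.zetaCoeff I r * (ζ - 1) := by
  have hn' : (0 : ℝ) < n := by exact_mod_cast hn
  have hL := hI.L_pos hn hd
  have hα := hr.α_mem.1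
  have hβ := hr.β_mem.1
  have hγ := hr.γ_mem.1
  have hτ := hr.τ_mem.1
  have hp := hr.p_mem.1
  have hq := hr.q_mem.1
  have hη := hr.η_pos
  have hb' := hb.step (r := r) hI hξ ζ
  set x := rowAvg (s.X r) with hx
  set g := rowAvg (I.gradF (s.X r)) with hg
  set δ := rowAvg (I.gradF s.Q) - rowAvg (I.gradF (s.X r)) with hδ
  have hxeq : x = (1 - r.α - r.τ) • rowAvg s.Y + r.α • rowAvg s.Z + r.τ • rowAvg s.U := by
    rw [hx, State.X, rowAvg_add, rowAvg_add, rowAvg_smul, rowAvg_smul, rowAvg_smul]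
  have hzeq : (1 + r.β) • rowAvg (step I r ξ ζ s).Z
      = rowAvg s.Z + r.β • x - r.η • (g + (1 - ζ) • δ) := by
    rw [hb.rowAvg_nextZ hI, smul_smul, mul_inv_cancel₀ (by positivity), one_smul, hδ, ← hx, ← hg]
    module
  have hyeq : rowAvg (step I r ξ ζ s).Y
      = x + r.γ • (rowAvg (step I r ξ ζ s).Z - rowAvg s.Z) := by
    have h1 : (step I r ξ ζ s).Y = s.X r + r.γ • ((step I r ξ ζ s).Z - s.Z) := rfl
    rw [h1, rowAvg_add, rowAvg_smul, rowAvg_sub]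
  have hζ2 : ζ ^ 2 = ζ / r.q := by
    rcases hζ with h | h <;> rw [h]
    · simp
    · field_simp
  have hlow : ∀ y, I.model (s.X r) + inner ℝ g (y - x) ≤ I.favg y := fun y => by
    have h1 := model_lower hn hI (s.X r) y
    have h2 : 0 ≤ I.μ / 2 * ‖y - rowAvg (s.X r)‖ ^ 2 := by
      have := hI.mu_pos
      positivity
    linarith
  have hu5 : I.model (s.X r) + inner ℝ g (rowAvg s.U - x)
      + 1 / (4 * I.L * n) * frobSq (s.gradDiff I r) - I.L / (2 * n) * consErr s.Q
      ≤ I.favg (rowAvg s.U) := by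
    rw [hb.top_U]
    exact model_lower_of_gradDiff hn hd hI (s.X r) s.Q
  have hx2 : I.favg x ≤ I.model (s.X r) + I.L / (2 * n) * consErr (s.X r) := by
    simpa [hx] using model_upper hn hI (s.X r) x
  have main := descent hα hβ hγ hτ hη hL hn' (weightY_pos hr hc) hc.main₁ hc.main₂ hc.main₃
    hc.main₄ hI.mu_pos hxeq hzeq hyeq hζ2
    (model_upper hn hI (s.X r) (rowAvg (step I r ξ ζ s).Y)) hx2 (model_lower hn hI (s.X r) I.xs)
    (hlow _) hu5 (hI.minimizer _) (hI.minimizer _)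
  -- the anchor point is replaced with probability `p`
  have hU : I.favg (rowAvg (step I r ξ ζ s).U)
      = I.favg (rowAvg s.U) + ξ * (I.favg x - I.favg (rowAvg s.U)) := by
    rw [hb'.top_U, rowAvg_nextQ, hb.top_U]
    rcases hξ with h | h <;> simp [h, hx]
  have hvar : 2 * r.η / 3 * (1 / r.q - 1) * ‖δ‖ ^ 2
      ≤ 2 * r.η / (3 * r.q * n) * frobSq (s.gradDiff I r) := by
    have h1 : ‖δ‖ ^ 2 ≤ (n : ℝ)⁻¹ * frobSq (s.gradDiff I r) := by
      have : δ = -rowAvg (s.gradDiff I r) := by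
        rw [State.gradDiff, rowAvg_sub, neg_sub]
      rw [this, norm_neg]
      exact rowAvg_norm_sq_le hn _
    have h2 : 2 * r.η / 3 * (1 / r.q - 1) * ‖δ‖ ^ 2 ≤ 2 * r.η / 3 * (1 / r.q) * ‖δ‖ ^ 2 := by
      gcongr
      linarith
    refine h2.trans ((mul_le_mul_of_nonneg_left h1 (by positivity)).trans (le_of_eq ?_))
    field_simp
  set K := (2 * r.τ + r.α) / (2 * r.α * r.p) with hK
  have hK0 : 0 < K := by positivity
  have hKp : K * r.p = r.τ / r.α + 1 / 2 := by
    rw [hK]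
    field_simp
  have hKρ : t * K ≤ 1 / 2 := by
    calc t * K ≤ rho r * K := by gcongr
      _ = 1 / 2 := by
        rw [rho, hK]
        field_simp
  have hhu := sub_nonneg.2 (hI.minimizer (rowAvg s.U))
  have hhy := sub_nonneg.2 (hI.minimizer (rowAvg s.Y))
  have c1 : (1 / r.γ - 1 / 4) * (I.favg (rowAvg s.Y) - I.favg I.xs)
      ≤ (1 - t) * (1 / r.γ * (I.favg (rowAvg s.Y) - I.favg I.xs)) := by
    rw [← mul_assoc]
    refine mul_le_mul_of_nonneg_right ?_ hhy
    have : t * (1 / r.γ) ≤ 1 / 4 := by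
      calc t * (1 / r.γ) ≤ r.γ / 4 * (1 / r.γ) := by gcongr
        _ = 1 / 4 := by field_simp
    linarith
  have c2 : (K - 1 / 2) * (I.favg (rowAvg s.U) - I.favg I.xs)
      ≤ (1 - t) * (K * (I.favg (rowAvg s.U) - I.favg I.xs)) := by
    rw [← mul_assoc]
    exact mul_le_mul_of_nonneg_right (by linarith) hhu
  have c3 : 1 / (2 * r.η) * ‖rowAvg s.Z - I.xs‖ ^ 2
      ≤ (1 - t) * ((1 + r.β) / (2 * r.η) * ‖rowAvg s.Z - I.xs‖ ^ 2) := by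
    rw [← mul_assoc]
    refine mul_le_mul_of_nonneg_right ?_ (sq_nonneg _)
    have h1 : t * (1 + r.β) ≤ r.β := (le_div_iff₀ (by positivity)).1 htβ
    rw [mul_div_assoc']
    gcongr
    linarith
  rw [State.mainBound, State.xiCoeff, State.zetaCoeff, State.mainLyap, State.mainLyap, hU, ← hx,
    ← hδ, ← hK]
  have e1 : (r.τ / r.α + 1 / 2) * (I.favg x - I.favg I.xs)
      = K * r.p * (I.favg x - I.favg I.xs) := by rw [hKp]
  have e2 : r.τ / r.α = K * r.p - 1 / 2 := by rw [hKp]; ring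
  rw [e1, e2] at main
  linarith

variable {Ω : Type*} [MeasurableSpace Ω] {P : Measure Ω} [IsProbabilityMeasure P]
  {ξ ζ : ℕ → Ω → ℝ}

theorem lyap_eq (hs : Sampling P r.p r.q ξ ζ) (k : ℕ) :
    lyap P I r ξ ζ k = (∫ ω, (rv I r ξ ζ k ω).mainLyap I r ∂P)
      + constD I r * consLyap P I r ξ ζ k := by
  have h1 : lyap P I r ξ ζ k
      = ∫ ω, ((rv I r ξ ζ k ω).mainLyap I r + constD I r * consLyap P I r ξ ζ k) ∂P := rfl
  rw [h1, integral_add (((past_rv I r k).comp fun s => s.mainLyap I r).integrable hs)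
    (integrable_const _)]
  simp

theorem mainLyap_succ_le (hn : 0 < n) (hd : 0 < d) (hI : I.Assumptions) (hr : r.Valid)
    (hc : Conditions I r) (hs : Sampling P r.p r.q ξ ζ) {t : ℝ} (htγ : t ≤ r.γ / 4)
    (htρ : t ≤ rho r) (htβ : t ≤ r.β / (1 + r.β)) (k : ℕ) :
    ∫ ω, (rv I r ξ ζ (k + 1) ω).mainLyap I r ∂P
      ≤ (1 - t) * (∫ ω, (rv I r ξ ζ k ω).mainLyap I r ∂P)
        + I.L / (2 * n * r.α) * errX P I r ξ ζ k
        + r.τ * I.L / (2 * r.α * n) * (∫ ω, consErr (rv I r ξ ζ k ω).Q ∂P)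
        + (2 * r.η / (3 * r.q * n) - r.τ / (4 * r.α * I.L * n)) * gradDiff P I r ξ ζ k := by
  have hrv := past_rv (ξ := ξ) (ζ := ζ) I r k
  refine integral_le_comb_of_affine hs hr.q_mem.1.ne'
    (A := fun ω => (rv I r ξ ζ k ω).mainBound I r t - r.p * (rv I r ξ ζ k ω).xiCoeff I r
      - (rv I r ξ ζ k ω).zetaCoeff I r)
    (B := fun ω => (rv I r ξ ζ k ω).xiCoeff I r) (C := fun ω => (rv I r ξ ζ k ω).zetaCoeff I r)
    (f₁ := fun ω => (rv I r ξ ζ k ω).mainLyap I r)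
    (f₂ := fun ω => consErr ((rv I r ξ ζ k ω).X r)) (f₃ := fun ω => consErr (rv I r ξ ζ k ω).Q)
    (f₄ := fun ω => frobSq ((rv I r ξ ζ k ω).gradDiff I r)) _ _ _ _
    ((past_rv I r (k + 1)).comp fun s => s.mainLyap I r)
    (hrv.comp fun s => s.mainBound I r t - r.p * s.xiCoeff I r - s.zetaCoeff I r)
    (hrv.comp fun s => s.xiCoeff I r) (hrv.comp fun s => s.zetaCoeff I r)
    (hrv.comp fun s => s.mainLyap I r) (hrv.comp fun s => consErr (s.X r))
    (hrv.comp fun s => consErr s.Q) (hrv.comp fun s => frobSq (s.gradDiff I r)) ?_ ?_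
  · intro ω
    have h := mainLyap_step_le hn hd hI hr hc htγ htρ htβ
      (balanced_rv (r := r) (ζ := ζ) hI hs.values_ξ k ω) (hs.values_ξ k ω) (hs.values_ζ k ω)
    rw [rv_succ]
    linarith
  · intro ω
    apply le_of_eq
    simp only [State.mainBound]
    ring

theorem Conditions.constC_pos (hn : 0 < n) (hd : 0 < d) (hI : I.Assumptions) (hr : r.Valid)
    (hc : Conditions I r) : 0 < constC I r := by
  have hn' : (0 : ℝ) < n := by exact_mod_cast hn
  have hL := hI.L_pos hn hd
  have hα := hr.α_mem.1
  have hγ := hr.γ_mem.1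
  have hw := weightY_pos hr hc
  rw [constC]
  positivity

/-- The weight `D` dominates the coefficients of all consensus errors and gradient differences that
the descent of the averages leaves behind. -/
theorem Conditions.constD_bounds (hn : 0 < n) (hd : 0 < d) (hI : I.Assumptions) (hr : r.Valid)
    (hc : Conditions I r) : 0 < constD I r ∧ I.L / (2 * n * r.α) ≤ constD I r ∧
      r.τ * I.L / (2 * r.α * n) ≤ constD I r ∧
      2 * r.η / (3 * r.q * n) - r.τ / (4 * r.α * I.L * n)
        + constD I r * (2 * cheb * constB I r) ≤ 0 := by
  have hn' : (0 : ℝ) < n := by exact_mod_cast hn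
  have hL := hI.L_pos hn hd
  have hα := hr.α_mem.1
  have hγ := hr.γ_mem.1
  have hτ := hr.τ_mem.1
  have hq := hr.q_mem.1
  have hη := hr.η_pos
  have hw := weightY_pos hr hc
  have hC := hc.constC_pos hn hd hI hr
  have d₁ := hc.diff₁
  have d₂ := hc.diff₂
  have d₃ := hc.diff₃
  set T := r.τ * r.q / (16 * r.α * r.η * I.L) with hT
  have hT0 : 0 < T := by positivity
  have hD : constD I r = constC I r * T := by
    rw [constD, hT]
    ring
  have hT2 : 2 ≤ T := by
    have h1 : T = r.τ / r.α * (r.q / (16 * r.η * I.L)) := by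
      rw [hT]
      field_simp
    rw [h1]
    calc (2 : ℝ) = 32 * r.η * I.L / r.q * (r.q / (16 * r.η * I.L)) := by
          field_simp
          norm_num
      _ ≤ _ := by gcongr
  have hDτ : r.τ * I.L / (r.α * n) ≤ constD I r := by
    calc r.τ * I.L / (r.α * n) = 2 * (8 * r.η * I.L ^ 2 / (r.q * n)) * T := by
          rw [hT]
          field_simp
          norm_num
      _ ≤ constC I r * T := by
          gcongr
          linarith
      _ = constD I r := hD.symm
  have hDC : 2 * constC I r ≤ constD I r := by
    rw [hD, mul_comm]
    gcongr
  have hCeq : constC I r = 2 * (I.L / (2 * n) * ((1 - r.α - r.τ) / r.α + 1))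
      + I.L / (n * r.γ) := by
    rw [constC]
    field_simp
    ring
  have h1 : 0 < I.L / (n * r.γ) := by positivity
  have h2 : 0 < I.L / (2 * n) * ((1 - r.α - r.τ) / r.α + 1) := by positivity
  have hτ2 : r.τ * I.L / (2 * r.α * n) = r.τ * I.L / (r.α * n) / 2 := by
    field_simp
  have hDτ0 : 0 < r.τ * I.L / (r.α * n) := by positivity
  refine ⟨by linarith, ?_, by linarith, ?_⟩
  · have e : I.L / (2 * n * r.α) = I.L / (2 * n) * ((1 - r.α - r.τ) / r.α + 1)
        + r.τ * I.L / (r.α * n) / 2 := by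
      field_simp
      ring
    linarith
  · have h3 : constD I r * (2 * cheb * constB I r) ≤ r.τ / (8 * r.α * I.L * n) := by
      calc constD I r * (2 * cheb * constB I r) = 2 * T * (cheb * constC I r * constB I r) := by
            rw [hD]
            ring
        _ ≤ 2 * T * (r.η / (r.q * n)) := by gcongr
        _ = r.τ / (8 * r.α * I.L * n) := by
            rw [hT]
            field_simp
            norm_num
    have h4 : 2 * r.η / (3 * r.q * n) ≤ r.τ / (8 * r.α * I.L * n) := by
      calc 2 * r.η / (3 * r.q * n) = 32 * r.η * I.L / r.q * (1 / (48 * I.L * n)) := by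
            field_simp
            norm_num
        _ ≤ r.τ / r.α * (1 / (48 * I.L * n)) := by gcongr
        _ ≤ r.τ / r.α * (1 / (8 * I.L * n)) := by
            gcongr
            norm_num
        _ = r.τ / (8 * r.α * I.L * n) := by field_simp
    have e : r.τ / (4 * r.α * I.L * n) = 2 * (r.τ / (8 * r.α * I.L * n)) := by
      field_simp
      norm_num
    linarith

theorem lyap_nonneg (hn : 0 < n) (hd : 0 < d) (hI : I.Assumptions) (hr : r.Valid)
    (hc : Conditions I r) (hs : Sampling P r.p r.q ξ ζ) (k : ℕ) : 0 ≤ lyap P I r ξ ζ k := by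
  have hpτ := hc.prob_le hn hI hr
  have hθ := thetaHat_pos hn hI
  have hθ1 : I.θhat ≤ 3 / 10 := accGap_le _
  have hp : r.p ≤ I.θhat * (1 - I.θhat) := by nlinarith [hr.τ_mem.1, hr.τ_mem.2]
  rw [lyap_eq hs]
  exact add_nonneg (integral_nonneg fun _ => mainLyap_nonneg hI hr _)
    (mul_nonneg (hc.constD_bounds hn hd hI hr).1.le (consLyap_nonneg hn hI hr hs hp k))

/-- Linear convergence of the Lyapunov function. -/
theorem lyap_succ_le (hn : 0 < n) (hd : 0 < d) (hI : I.Assumptions) (hr : r.Valid)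
    (hc : Conditions I r) (hs : Sampling P r.p r.q ξ ζ) (k : ℕ) :
    lyap P I r ξ ζ (k + 1) ≤ (1 - rate I r) * lyap P I r ξ ζ k := by
  obtain ⟨htγ, htρ, htβ, htp, -, htθ⟩ : rate I r ≤ r.γ / 4 ∧ rate I r ≤ rho r ∧
      rate I r ≤ r.β / (1 + r.β) ∧ rate I r ≤ r.p / 2 ∧ rate I r ≤ r.τ ∧
      rate I r ≤ I.θhat / 2 := by
    simpa only [le_min_iff] using (rate.eq_1 I r).le
  obtain ⟨hD, hDX, hDQ, hDΔ⟩ := hc.constD_bounds hn hd hI hr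
  have h1 := mainLyap_succ_le hn hd hI hr hc hs htγ htρ htβ k
  have h2 := mul_le_mul_of_nonneg_left
    (consLyap_succ_le hn hI (hI.L_pos hn hd) hr hc hs htp htθ k) hD.le
  have h3 := mul_le_mul_of_nonneg_right hDX (errX_nonneg (P := P) (I := I) (r := r) (ξ := ξ)
    (ζ := ζ) k)
  have h4 := mul_le_mul_of_nonneg_right hDQ (integral_nonneg (μ := P)
    fun ω => consErr_nonneg (rv I r ξ ζ k ω).Q)
  have h5 := mul_le_mul_of_nonneg_right hDΔ (gradDiff_nonneg (P := P) (I := I) (r := r) (ξ := ξ)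
    (ζ := ζ) k)
  rw [lyap_eq hs, lyap_eq hs]
  linarith

end Averages

/-! ### The explicit parameters -/

section Explicit

variable {n d : ℕ} {I : Problem n d}

theorem one_le_sqrt_kappa (hn : 0 < n) (hd : 0 < d) (hI : I.Assumptions) : 1 ≤ √I.κ := by
  rw [Real.one_le_sqrt, Problem.κ, one_le_div hI.mu_pos]
  exact (hI.objective ⟨0, hn⟩).mu_le hd

theorem mu_mul_sqrt_kappa_sq (hn : 0 < n) (hd : 0 < d) (hI : I.Assumptions) :
    I.μ * √I.κ ^ 2 = I.L := by
  rw [Problem.κ, Real.sq_sqrt (div_nonneg (hI.L_pos hn hd).le hI.mu_pos.le),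
    mul_div_cancel₀ _ hI.mu_pos.ne']

/-- The explicit parameters in terms of `k = √κ`. -/
theorem explicitParams_facts (hn : 0 < n) (hd : 0 < d) (hI : I.Assumptions) :
    (explicitParams I).α = 1 / (45 * √I.κ) ∧
    (explicitParams I).η = I.θhat * √I.κ / (91125 * I.L) ∧
    (explicitParams I).β = I.θhat / (182250 * √I.κ) ∧
    1 / (explicitParams I).γ = 45 * √I.κ / 2 - 3 / 4 ∧
    0 < (explicitParams I).γ ∧ (explicitParams I).γ ≤ 4 / (87 * √I.κ) := by
  have hk := one_le_sqrt_kappa hn hd hI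
  have hL := mu_mul_sqrt_kappa_sq hn hd hI
  have hμ := hI.mu_pos
  set k := √I.κ with hkdef
  have hk0 : 0 < k := by linarith
  have hγ : (explicitParams I).γ = 4 / (90 * k - 3) := by
    have h1 : 90 * k - 3 ≠ 0 := (by linarith : 0 < 90 * k - 3).ne'
    have h2 : (4 : ℝ) - 4 * (1 / 2) - 3 * (1 / (45 * k)) = (90 * k - 3) / (45 * k) := by
      field_simp
      ring
    simp only [explicitParams, ← hkdef, h2]
    field_simp
  refine ⟨rfl, rfl, ?_, ?_, ?_, ?_⟩
  · simp only [explicitParams, ← hkdef, ← hL]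
    field_simp
    ring
  · rw [hγ, one_div_div]
    ring
  · rw [hγ]
    exact div_pos (by norm_num) (by linarith)
  · rw [hγ]
    exact div_le_div_of_nonneg_left (by norm_num) (by linarith) (by linarith)

theorem explicitParams_valid (hn : 0 < n) (hd : 0 < d) (hI : I.Assumptions) :
    (explicitParams I).Valid := by
  obtain ⟨hα, hη, hβ, -, hγ0, hγ⟩ := explicitParams_facts hn hd hI
  have hk := one_le_sqrt_kappa hn hd hI
  have hL := hI.L_pos hn hd
  have hθ := thetaHat_pos hn hI
  have hθ1 : I.θhat ≤ 3 / 10 := accGap_le _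
  have hpq : I.θhat / 60750 ∈ Set.Ioo (0 : ℝ) 1 := ⟨by positivity, by linarith⟩
  refine ⟨?_, ?_, ⟨hγ0, hγ.trans_lt ?_⟩, ?_, hpq, hpq, ?_⟩
  · rw [hα]
    exact ⟨by positivity, by rw [div_lt_one (by positivity)]; linarith⟩
  · rw [hβ]
    exact ⟨by positivity, by rw [div_lt_one (by positivity)]; linarith⟩
  · rw [div_lt_one (by positivity)]
    linarith
  · simp only [explicitParams]
    norm_num
  · rw [hη]
    positivity

theorem explicitParams_constC (hn : 0 < n) (hd : 0 < d) (hI : I.Assumptions) :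
    constC I (explicitParams I) = (45 * √I.κ - 3 / 4) * (I.L / n) := by
  obtain ⟨hα, -, -, hγ, hγ0, -⟩ := explicitParams_facts hn hd hI
  have hn' : (0 : ℝ) < n := by exact_mod_cast hn
  have hk := one_le_sqrt_kappa hn hd hI
  have hτ : (explicitParams I).τ = 1 / 2 := rfl
  have e : constC I (explicitParams I) = ((1 - (explicitParams I).α - (explicitParams I).τ)
      / (explicitParams I).α + 1 / (explicitParams I).γ + 1) * (I.L / n) := by
    rw [constC]
    field_simp
  rw [e, hγ, hα, hτ]
  congr 1
  field_simp
  ring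

/-- `γ` is of the order of `1 / √κ`, which is all that most of the conditions need to know about it. -/
theorem explicitParams_gamma_sq (hn : 0 < n) (hd : 0 < d) (hI : I.Assumptions) :
    (explicitParams I).γ ^ 2 * √I.κ ^ 2 ≤ 1 / 400 := by
  obtain ⟨-, -, -, -, hγ0, hγ⟩ := explicitParams_facts hn hd hI
  have hk := one_le_sqrt_kappa hn hd hI
  have h1 : (explicitParams I).γ * √I.κ ≤ 4 / 87 := by
    calc (explicitParams I).γ * √I.κ ≤ 4 / (87 * √I.κ) * √I.κ := by gcongr
      _ = 4 / 87 := by field_simp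
  have h2 : 0 ≤ (explicitParams I).γ * √I.κ := by positivity
  rw [← mul_pow]
  nlinarith

theorem explicitParams_constB_le (hn : 0 < n) (hd : 0 < d) (hI : I.Assumptions) :
    constB I (explicitParams I) ≤ 1 / 1000 * (1 / I.L ^ 2) := by
  obtain ⟨-, hη, -, -, -, -⟩ := explicitParams_facts hn hd hI
  have hk := one_le_sqrt_kappa hn hd hI
  have hL := hI.L_pos hn hd
  have hθ := thetaHat_pos hn hI
  have hγ := explicitParams_gamma_sq hn hd hI
  have hτ : (explicitParams I).τ = 1 / 2 := rfl
  have hp : (explicitParams I).p = I.θhat / 60750 := rfl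
  have hq : (explicitParams I).q = I.θhat / 60750 := rfl
  rw [constB, hη, hτ, hp, hq]
  set k := √I.κ
  set γ := (explicitParams I).γ
  have e : 384 * (1 - 1 / 2) * γ ^ 2 / ((1 / 2) ^ 2 * I.θhat) *
      ((I.θhat * k / (91125 * I.L)) ^ 2 / (I.θhat / 60750)
        + 2 * (I.θhat * k / (91125 * I.L)) ^ 2 / I.θhat)
      + 16 * (I.θhat / 60750) / (1 / 2 * I.θhat * I.L ^ 2)
      = (768 * 60752 / 91125 ^ 2 * (γ ^ 2 * k ^ 2) + 32 / 60750) * (1 / I.L ^ 2) := by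
    field_simp
    ring
  rw [e]
  refine mul_le_mul_of_nonneg_right ?_ (by positivity)
  linarith

theorem explicitParams_conditions (hn : 0 < n) (hd : 0 < d) (hI : I.Assumptions) :
    Conditions I (explicitParams I) := by
  obtain ⟨hα, hη, hβ, hγi, hγ0, hγ⟩ := explicitParams_facts hn hd hI
  have hn' : (0 : ℝ) < n := by exact_mod_cast hn
  have hk := one_le_sqrt_kappa hn hd hI
  have hL := hI.L_pos hn hd
  have hθ := thetaHat_pos hn hI
  have hθ1 : I.θhat ≤ 3 / 10 := accGap_le _
  have hγ2 := explicitParams_gamma_sq hn hd hI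
  have hτ : (explicitParams I).τ = 1 / 2 := rfl
  have hp : (explicitParams I).p = I.θhat / 60750 := rfl
  have hq : (explicitParams I).q = I.θhat / 60750 := rfl
  have hC := explicitParams_constC hn hd hI
  have hB := explicitParams_constB_le hn hd hI
  have hβη : (explicitParams I).β = I.μ * (explicitParams I).η / 2 := rfl
  have hwα : (1 - (explicitParams I).α - (explicitParams I).τ) / (explicitParams I).α
      = 45 * √I.κ / 2 - 1 := by
    rw [hα, hτ]
    field_simp
    ring
  set r := explicitParams I
  set k := √I.κ
  have hη0 : 0 < r.η := by
    rw [hη]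
    positivity
  have hγ1 : r.γ ^ 2 ≤ 1 / 400 := by
    have : r.γ ^ 2 * 1 ≤ r.γ ^ 2 * k ^ 2 := by
      gcongr
      exact one_le_pow₀ hk
    linarith
  refine ⟨?_, ?_, ?_, ?_, ?_, ?_, ?_, ?_, ?_, ?_⟩
  · have hβ2 : r.β ^ 2 ≤ I.θhat ^ 2 * (1 / 182250 ^ 2) := by
      rw [hβ, div_pow, div_eq_mul_one_div]
      gcongr
      linarith
    have h1 : 384 * cheb * (1 - r.τ) * r.γ ^ 2 * r.β ^ 2 / (r.τ * I.θhat ^ 2) ≤ 1 / 100 := by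
      rw [hτ, cheb]
      have e : 384 * 14 * (1 - 1 / 2) * r.γ ^ 2 * r.β ^ 2 / (1 / 2 * I.θhat ^ 2)
          = 5376 * r.γ ^ 2 * (r.β ^ 2 / I.θhat ^ 2) := by
        field_simp
        ring
      have h2 : r.β ^ 2 / I.θhat ^ 2 ≤ 1 / 182250 ^ 2 := by
        rw [div_le_iff₀ (by positivity)]
        linarith
      rw [e]
      calc 5376 * r.γ ^ 2 * (r.β ^ 2 / I.θhat ^ 2) ≤ 5376 * (1 / 400) * (1 / 182250 ^ 2) := by
            gcongr
        _ ≤ 1 / 100 := by norm_num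
    have h2 : 32 * cheb * r.p / I.θhat = 448 / 60750 := by
      rw [hp, cheb]
      field_simp
      norm_num
    rw [h2, hτ]
    rw [hτ] at h1
    norm_num at h1 ⊢
    linarith
  · rw [hτ, div_le_one (by positivity)]
    have h1 : r.α ≤ 2 / 3 * r.γ := by
      have h2 : 1 = (45 * k / 2 - 3 / 4) * r.γ := by
        rw [← hγi]
        field_simp
      have h3 : (45 * k / 2 - 3 / 4) * r.γ ≤ 45 * k * (2 / 3 * r.γ) := by nlinarith
      rw [hα, div_le_iff₀ (by positivity)]
      linarith
    have h2 : 0 < r.α := by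
      rw [hα]
      positivity
    nlinarith
  · rw [hτ, hη, cheb]
    have e : 384 * 14 * (1 - 1 / 2) * r.γ ^ 2 * (I.θhat * k / (91125 * I.L)) ^ 2 * I.L ^ 2
        / (1 / 2 * I.θhat) = 5376 / 91125 ^ 2 * (r.γ ^ 2 * k ^ 2) * I.θhat := by
      field_simp
      norm_num
    rw [e]
    nlinarith
  · rw [hC, hη, hq]
    have e : 8 * (I.θhat * k / (91125 * I.L)) * I.L ^ 2 / (I.θhat / 60750 * n)
        = 16 / 3 * k * (I.L / n) := by
      field_simp
      norm_num
    rw [e, mul_div_right_comm]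
    refine mul_le_mul_of_nonneg_right ?_ (by positivity)
    linarith
  · have e : r.η / (r.q * n) = 2 / 3 * k * (1 / (I.L * n)) := by
      rw [hη, hq]
      field_simp
      norm_num
    rw [e, hC, cheb]
    calc 14 * ((45 * k - 3 / 4) * (I.L / n)) * constB I r
        ≤ 14 * ((45 * k - 3 / 4) * (I.L / n)) * (1 / 1000 * (1 / I.L ^ 2)) := by
          have h0 : 0 ≤ (45 * k - 3 / 4) * (I.L / n) := mul_nonneg (by linarith) (by positivity)
          exact mul_le_mul_of_nonneg_left hB (by linarith)
      _ ≤ 14 * (45 * k * (I.L / n)) * (1 / 1000 * (1 / I.L ^ 2)) := by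
          gcongr
          linarith
      _ = 63 / 100 * (k * (1 / (I.L * n))) := by
          field_simp
          norm_num
      _ ≤ 2 / 3 * k * (1 / (I.L * n)) := by
          rw [mul_assoc]
          exact mul_le_mul_of_nonneg_right (by norm_num) (by positivity)
  · rw [hη, hq, hτ, hα]
    have e : 32 * (I.θhat * k / (91125 * I.L)) * I.L / (I.θhat / 60750) = 64 / 3 * k := by
      field_simp
      norm_num
    have e2 : (1 : ℝ) / 2 / (1 / (45 * k)) = 45 / 2 * k := by
      field_simp
    rw [e, e2]
    linarith
  · rw [le_div_iff₀ (by positivity), hη]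
    have e : I.L * r.γ * (4 * (I.θhat * k / (91125 * I.L))) = 4 / 91125 * I.θhat * (r.γ * k) := by
      field_simp
    have h1 : r.γ * k ≤ 4 / 87 := by
      calc r.γ * k ≤ 4 / (87 * k) * k := by gcongr
        _ = 4 / 87 := by field_simp
    rw [e]
    calc 4 / 91125 * I.θhat * (r.γ * k) ≤ 4 / 91125 * (3 / 10) * (4 / 87) := by gcongr
      _ ≤ 1 := by norm_num
  · rw [hβη]
    apply le_of_eq
    field_simp
    norm_num
  · rw [hγi, hwα]
    linarith
  · rw [hγi, hwα]
    linarith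

theorem explicitParams_rate (hn : 0 < n) (hd : 0 < d) (hI : I.Assumptions) :
    I.θhat / (6000000 * √I.κ) ≤ rate I (explicitParams I) := by
  obtain ⟨hα, -, hβ, hγi, hγ0, -⟩ := explicitParams_facts hn hd hI
  have hr := explicitParams_valid hn hd hI
  have hk := one_le_sqrt_kappa hn hd hI
  have hθ := thetaHat_pos hn hI
  have hθ1 : I.θhat ≤ 3 / 10 := accGap_le _
  have hp : (explicitParams I).p = I.θhat / 60750 := rfl
  have hτ : (explicitParams I).τ = 1 / 2 := rfl
  set r := explicitParams I
  set k := √I.κ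
  have hdiv : I.θhat / (6000000 * k) ≤ I.θhat / 6000000 :=
    div_le_div_of_nonneg_left hθ.le (by norm_num) (by linarith)
  rw [rate]
  refine le_min ?_ (le_min ?_ (le_min ?_ (le_min ?_ (le_min ?_ ?_))))
  · have h1 : 1 = (45 * k / 2 - 3 / 4) * r.γ := by
      rw [← hγi]
      field_simp
    rw [div_le_iff₀ (by positivity)]
    nlinarith
  · have h1 := hr.α_mem
    rw [rho, hτ]
    calc I.θhat / (6000000 * k) ≤ r.α * r.p / 2 := by
          rw [hα, hp, div_le_iff₀ (by positivity)]
          have e : 1 / (45 * k) * (I.θhat / 60750) / 2 * (6000000 * k)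
              = 6000000 / 5467500 * I.θhat := by
            field_simp
            norm_num
          rw [e]
          linarith
      _ ≤ r.α * r.p / (2 * (1 / 2) + r.α) := by
          have := h1.1
          have := hr.p_mem.1
          gcongr
          linarith [h1.2]
  · have h1 := hr.β_mem
    calc I.θhat / (6000000 * k) ≤ r.β / 2 := by
          rw [hβ, div_div]
          exact div_le_div_of_nonneg_left hθ.le (by positivity) (by linarith)
      _ ≤ r.β / (1 + r.β) := by
          have := h1.1
          gcongr
          linarith [h1.2]
  · rw [hp]
    linarith
  · rw [hτ]
    linarith
  · linarith

end Explicit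

/-! ### The decentralized execution -/

section Execution

variable {n d : ℕ} {I : Problem n d} {r : Params}

theorem mix_eq (h : IsGossip I.G I.W) (i : Fin n) (v : Fin n → Vec d) :
    mix I i v = ∑ j, I.W i j • v j := by
  classical
  rw [mix]
  refine Finset.sum_subset (Finset.filter_subset _ _) fun j _ hj => ?_
  simp only [Finset.mem_filter, Finset.mem_univ, true_and, not_or] at hj
  have h0 : I.W i j = 0 := le_antisymm
    (not_lt.1 fun hpos => hj.2 (h.support i j (Ne.symm hj.1) hpos)) (h.nonneg i j)
  rw [h0, zero_smul]

theorem localPhase_eval (ξ ζ : ℝ) (a : Agent d) (g : Vec d → Vec d) :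
    (a.localPhase r ξ ζ).eval g = a.localWith r ξ ζ (g (a.x r)) := by
  rw [Agent.localPhase]
  split_ifs with h
  · obtain ⟨rfl, rfl⟩ := h
    simp [Prog.eval, Agent.localWith]
  · rfl

theorem localPhase_cost (ξ ζ : ℝ) (a : Agent d) (g : Vec d → Vec d) :
    (a.localPhase r ξ ζ).cost g = if ξ = 0 ∧ ζ = 0 then 0 else 1 := by
  rw [Agent.localPhase]
  split_ifs <;> rfl

theorem update_eq_step (hI : I.Assumptions) {ξ ζ : ℝ} (hξ : ξ = 0 ∨ ξ = 1)
    (hζ : ζ = 0 ∨ ζ = 1 / r.q) (hq : r.q ≠ 0) (s : State n d) (i : Fin n) :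
    (s.agent I i).update I r i
        ((s.agent I i).localWith r ξ ζ (gradient (I.f i) ((s.agent I i).x r)))
        (fun j => ((s.agent I j).localWith r ξ ζ (gradient (I.f j) ((s.agent I j).x r))).msg)
      = (step I r ξ ζ s).agent I i := by
  have hx : ∀ j, (s.agent I j).x r = s.X r j := fun j => rfl
  have hζs : ∀ w : Vec d, (if ζ = 0 then 0 else (r.η / r.q) • w) = (r.η * ζ) • w := by
    intro w
    rcases hζ with rfl | rfl
    · simp
    · have : (1 : ℝ) / r.q ≠ 0 := one_div_ne_zero hq
      rw [if_neg this, mul_one_div]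
  have hξ0 : ∀ a b : Vec d, (if ξ = 0 then a else b) = (1 - ξ) • a + ξ • b := by
    intro a b
    rcases hξ with rfl | rfl <;> simp
  -- the new stored gradient is the gradient at the new row of `Q`
  have hm : (if ξ = 0 then gradient (I.f i) (s.Q i) else gradient (I.f i) (s.X r i))
      = gradient (I.f i) (((1 - ξ) • s.Q + ξ • s.X r) i) := by
    rcases hξ with rfl | rfl <;> simp
  have hm2 : (if ξ = 0 then gradient (I.f i) (s.Q i) else gradient (I.f i) (s.X r i))
      - gradient (I.f i) (s.Q i)
      = ξ • (gradient (I.f i) (s.X r i) - gradient (I.f i) (s.Q i)) := by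
    rcases hξ with rfl | rfl <;> simp
  have hZ1 : (step I r ξ ζ s).Zt (Sum.inl i) = (1 + r.β)⁻¹ •
      ((1 + etaW I.θ) • mix I i (fun j => ((s.agent I j).localWith r ξ ζ
        (gradient (I.f j) ((s.agent I j).x r))).msg.z)
      - etaW I.θ • ((s.agent I i).localWith r ξ ζ
        (gradient (I.f i) ((s.agent I i).x r))).z₂) := by
    change (1 + r.β)⁻¹ • mulRows I.augW _ (Sum.inl i) = _
    rw [augW_inl, mix_eq hI.gossip]
    simp only [Agent.localWith, hζs, hx]
    rfl
  simp only [Agent.update]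
  rw [← hZ1]
  simp only [State.agent, Agent.mk.injEq]
  refine ⟨?_, trivial, ?_, ?_, ?_, ?_, ?_, ?_⟩
  · rfl
  · change _ = (1 + r.β)⁻¹ • mulRows I.augW _ (Sum.inr i)
    rw [augW_inr]
    simp only [Agent.localWith, hζs]
    rfl
  · change _ = mulRows I.augW _ (Sum.inl i)
    rw [augW_inl, mix_eq hI.gossip]
    simp only [Agent.localWith, hξ0]
    rfl
  · change _ = mulRows I.augW _ (Sum.inr i)
    rw [augW_inr]
    simp only [Agent.localWith, hξ0]
    rfl
  · change _ = mulRows I.augW _ (Sum.inl i) + _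
    rw [augW_inl, mix_eq hI.gossip]
    simp only [Agent.localWith]
    congr 1
  · change _ = mulRows I.augW _ (Sum.inr i) + _
    rw [augW_inr]
    simp only [Agent.localWith]
    congr 1
  · simp only [Agent.localWith]
    exact hm

/-- The decentralized execution reproduces the matrix iteration. -/
theorem run_agent (hI : I.Assumptions) (hq : r.q ≠ 0) {ξ ζ : ℕ → ℝ}
    (hξ : ∀ k, ξ k = 0 ∨ ξ k = 1) (hζ : ∀ k, ζ k = 0 ∨ ζ k = 1 / r.q) (k : ℕ) (i : Fin n) :
    (run I r ξ ζ k).agent i = (iter I r ξ ζ k).agent I i := by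
  induction k generalizing i with
  | zero => rfl
  | succ k ih =>
    have h : ∀ j, ((run I r ξ ζ k).agent j) = (iter I r ξ ζ k).agent I j := ih
    simp only [run, Network.step, iter, h, localPhase_eval]
    exact update_eq_step hI (hξ k) (hζ k) hq _ i

theorem run_rounds (ξ ζ : ℕ → ℝ) (k : ℕ) : (run I r ξ ζ k).rounds = k := by
  induction k with
  | zero => rfl
  | succ k ih => simp only [run, Network.step, ih]

theorem run_grads (ξ ζ : ℕ → ℝ) (k : ℕ) (i : Fin n) :
    (run I r ξ ζ k).grads i
      = 1 + ∑ j ∈ Finset.range k, if ξ j = 0 ∧ ζ j = 0 then 0 else 1 := by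
  induction k with
  | zero => rfl
  | succ k ih =>
    rw [Finset.sum_range_succ, ← add_assoc, ← ih]
    simp only [run, Network.step, localPhase_cost]

variable {Ω : Type*} [MeasurableSpace Ω] {P : Measure Ω} [IsProbabilityMeasure P]
  {ξ ζ : ℕ → Ω → ℝ}

/-- After the initialization an agent computes a gradient with probability at most `p + q` in each
iteration. -/
theorem integral_grads_le (hr : r.Valid) (hs : Sampling P r.p r.q ξ ζ) (k : ℕ) (i : Fin n) :
    ∫ ω, ((run I r (fun j => ξ j ω) (fun j => ζ j ω) k).grads i : ℝ) ∂P
      ≤ 1 + k * (r.p + r.q) := by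
  have hq := hr.q_mem.1
  have hiξ : ∀ j, Integrable (ξ j) P := fun j =>
    ((Past.input (ξ := ξ) (ζ := ζ) j).comp Prod.fst).integrable hs
  have hiζ : ∀ j, Integrable (fun ω => r.q * ζ j ω) P := fun j =>
    (((Past.input (ξ := ξ) (ζ := ζ) j).comp Prod.snd).integrable hs).const_mul _
  have hi : ∀ j ∈ Finset.range k, Integrable (fun ω => ξ j ω + r.q * ζ j ω) P := fun j _ =>
    (hiξ j).add (hiζ j)
  have h : ∫ ω, ((run I r (fun j => ξ j ω) (fun j => ζ j ω) k).grads i : ℝ) ∂P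
      ≤ ∫ ω, (1 + ∑ j ∈ Finset.range k, (ξ j ω + r.q * ζ j ω)) ∂P := by
    refine integral_mono_of_nonneg (Filter.Eventually.of_forall fun ω => Nat.cast_nonneg _)
      ((integrable_const _).add (integrable_finsetSum _ hi))
      (Filter.Eventually.of_forall fun ω => ?_)
    simp only [run_grads]
    push_cast
    gcongr with j
    rcases hs.values_ξ j ω with h | h <;> rcases hs.values_ζ j ω with h' | h' <;>
      rw [h, h'] <;> simp [hq.ne']
  refine h.trans (le_of_eq ?_)
  rw [integral_add (integrable_const _) (integrable_finsetSum _ hi), integral_finsetSum _ hi]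
  have : ∀ j, ∫ ω, (ξ j ω + r.q * ζ j ω) ∂P = r.p + r.q := by
    intro j
    rw [integral_add (hiξ j) (hiζ j), integral_const_mul, hs.integral_xi, hs.integral_zeta hq.ne',
      mul_one]
  simp [this, mul_add]

end Execution

/-! ### Complexity -/

section Complexity

/-- The number of iterations after which a sequence with contraction factor `1 - t` has decreased by
the factor `ε`. -/
theorem exists_iteration_count {a : ℕ → ℝ} {t ε : ℝ} (ha : ∀ k, 0 ≤ a k) (ht : 0 < t) (ht1 : t ≤ 1)
    (hstep : ∀ k, a (k + 1) ≤ (1 - t) * a k) (hε : 0 < ε) (hε1 : ε ≤ 1) :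
    ∃ K : ℕ, (∀ k, K ≤ k → a k ≤ ε * a 0) ∧ (K : ℝ) ≤ Real.log (1 / ε) / t + 1 := by
  have hlog : 0 ≤ Real.log (1 / ε) := Real.log_nonneg ((one_le_div hε).2 hε1)
  have hpow : ∀ k, a k ≤ (1 - t) ^ k * a 0 := by
    intro k
    induction k with
    | zero => simp
    | succ k ih =>
      rw [pow_succ', mul_assoc]
      exact (hstep k).trans (mul_le_mul_of_nonneg_left ih (by linarith))
  refine ⟨⌈Real.log (1 / ε) / t⌉₊, fun k hk => ?_, (Nat.ceil_lt_add_one (by positivity)).le⟩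
  refine (hpow k).trans (mul_le_mul_of_nonneg_right ?_ (ha 0))
  have h1 : Real.log (1 / ε) ≤ t * k := by
    have := (Nat.le_ceil _).trans (Nat.cast_le (α := ℝ).2 hk)
    rw [div_le_iff₀ ht] at this
    linarith
  calc (1 - t) ^ k ≤ Real.exp (-t) ^ k := by
        have := Real.add_one_le_exp (-t)
        exact pow_le_pow_left₀ (by linarith) (by linarith) k
    _ = Real.exp (-(t * k)) := by
        rw [← Real.exp_nat_mul]
        congr 1
        ring
    _ ≤ Real.exp (-Real.log (1 / ε)) := Real.exp_le_exp.2 (by linarith)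
    _ = ε := by rw [one_div, Real.log_inv, neg_neg, Real.exp_log hε]

variable {n d : ℕ} {I : Problem n d} {Ω : Type*} [MeasurableSpace Ω] {P : Measure Ω}
  [IsProbabilityMeasure P] {ξ ζ : ℕ → Ω → ℝ}

theorem exists_iteration_count_explicit (hn : 0 < n) (hd : 0 < d) (hI : I.Assumptions)
    (hs : Sampling P (explicitParams I).p (explicitParams I).q ξ ζ) {ε : ℝ} (hε : 0 < ε)
    (hε' : ε ≤ 1 / 2) :
    ∃ K : ℕ, (∀ k, K ≤ k → lyap P I (explicitParams I) ξ ζ k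
        ≤ ε * lyap P I (explicitParams I) ξ ζ 0) ∧
      (K : ℝ) ≤ 6000002 * (√I.κ * Real.log (1 / ε) / I.θhat) := by
  have hr := explicitParams_valid hn hd hI
  have hc := explicitParams_conditions hn hd hI
  have hk := one_le_sqrt_kappa hn hd hI
  have hθ := thetaHat_pos hn hI
  have hθ1 : I.θhat ≤ 3 / 10 := accGap_le _
  have hrate := explicitParams_rate hn hd hI
  have hrate0 : 0 < rate I (explicitParams I) := lt_of_lt_of_le (by positivity) hrate
  have hrate1 : rate I (explicitParams I) ≤ 1 := by
    have : rate I (explicitParams I) ≤ (explicitParams I).γ / 4 := min_le_left _ _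
    linarith [hr.γ_mem.2]
  obtain ⟨K, hK, hKle⟩ := exists_iteration_count (lyap_nonneg hn hd hI hr hc hs) hrate0 hrate1
    (lyap_succ_le hn hd hI hr hc hs) hε (by linarith)
  refine ⟨K, hK, hKle.trans ?_⟩
  have hlog : 1 / 2 ≤ Real.log (1 / ε) := by
    have h1 : Real.log 2 ≤ Real.log (1 / ε) := by
      refine Real.log_le_log (by norm_num) ?_
      rw [le_div_iff₀ hε]
      linarith
    linarith [Real.log_two_gt_d9]
  have h1 : Real.log (1 / ε) / rate I (explicitParams I)
      ≤ 6000000 * (√I.κ * Real.log (1 / ε) / I.θhat) := by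
    calc _ ≤ Real.log (1 / ε) / (I.θhat / (6000000 * √I.κ)) :=
          div_le_div_of_nonneg_left (by linarith) (by positivity) hrate
      _ = _ := by
        field_simp
  have h2 : 1 ≤ 2 * (√I.κ * Real.log (1 / ε) / I.θhat) := by
    have h3 : 1 / 2 ≤ √I.κ * Real.log (1 / ε) / I.θhat := by
      rw [le_div_iff₀ hθ]
      nlinarith
    linarith
  linarith

end Complexity

end OGT

theorem mainTheorem1 :
    ∃ C : ℝ, 0 < C ∧
      ∀ (n d : ℕ) (_hn : 0 < n) (_hd : 0 < d) (I : OGT.Problem n d) (_hI : I.Assumptions),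
        -- the accelerated gap is of the order of the square root of the spectral gap
        (√I.θ ≤ C * I.θhat ∧ I.θhat ≤ C * √I.θ) ∧
        -- linear convergence for all admissible parameters
        (∀ (r : OGT.Params) (_hr : r.Valid) (_hc : OGT.Conditions I r)
            (Ω : Type*) [MeasurableSpace Ω] (P : MeasureTheory.Measure Ω)
            [MeasureTheory.IsProbabilityMeasure P] (ξ ζ : ℕ → Ω → ℝ)
            (_hs : OGT.Sampling P r.p r.q ξ ζ) (k : ℕ),
          OGT.lyap P I r ξ ζ (k + 1) ≤ (1 - OGT.rate I r) * OGT.lyap P I r ξ ζ k) ∧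
        -- the explicit parameters are admissible
        (OGT.explicitParams I).Valid ∧ OGT.Conditions I (OGT.explicitParams I) ∧
        -- complexities of the decentralized execution with the explicit parameters
        ∀ (Ω : Type*) [MeasurableSpace Ω] (P : MeasureTheory.Measure Ω)
            [MeasureTheory.IsProbabilityMeasure P] (ξ ζ : ℕ → Ω → ℝ)
            (_hs : OGT.Sampling P (OGT.explicitParams I).p (OGT.explicitParams I).q ξ ζ),
          (∀ (k : ℕ) (ω : Ω) (i : Fin n),
            (OGT.run I (OGT.explicitParams I) (fun j => ξ j ω) (fun j => ζ j ω) k).agent i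
              = (OGT.rv I (OGT.explicitParams I) ξ ζ k ω).agent I i) ∧
          ∀ (ε : ℝ) (_hε : 0 < ε) (_hε' : ε ≤ 1 / 2), ∃ K : ℕ,
            (∀ k : ℕ, K ≤ k → OGT.lyap P I (OGT.explicitParams I) ξ ζ k
              ≤ ε * OGT.lyap P I (OGT.explicitParams I) ξ ζ 0) ∧
            (∀ ω : Ω,
              ((OGT.run I (OGT.explicitParams I)
                (fun j => ξ j ω) (fun j => ζ j ω) K).rounds : ℝ)
                ≤ C * (√(I.κ / I.θ) * Real.log (1 / ε))) ∧
            (∀ i : Fin n,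
              ∫ ω, ((OGT.run I (OGT.explicitParams I)
                (fun j => ξ j ω) (fun j => ζ j ω) K).grads i : ℝ) ∂P
                ≤ C * (√I.κ * Real.log (1 / ε))) := by
  refine ⟨30000000, by norm_num, fun n d hn hd I hI => ?_⟩
  obtain ⟨hθ0, hθ1, -⟩ := hI.gossip.exists_eigenbasis hn
  have hθh := OGT.thetaHat_pos hn hI
  have hr := OGT.explicitParams_valid hn hd hI
  have hk := OGT.one_le_sqrt_kappa hn hd hI
  have hgap : √I.θ ≤ 4 * I.θhat := OGT.sqrt_gap_le hθ0 hθ1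
  have hgap' : I.θhat ≤ 4 * √I.θ := OGT.accGap_le_sqrt hθ0 hθ1
  have hsq : 0 < √I.θ := Real.sqrt_pos.2 hθ0
  refine ⟨⟨by linarith, by linarith⟩, ?_, hr, OGT.explicitParams_conditions hn hd hI, ?_⟩
  · intro r hr hc Ω _ P _ ξ ζ hs k
    exact OGT.lyap_succ_le hn hd hI hr hc hs k
  intro Ω _ P _ ξ ζ hs
  refine ⟨fun k ω i => OGT.run_agent hI hr.q_mem.1.ne' (fun j => hs.values_ξ j ω)
    (fun j => hs.values_ζ j ω) k i, fun ε hε hε' => ?_⟩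
  obtain ⟨K, hK, hKle⟩ := OGT.exists_iteration_count_explicit hn hd hI hs hε hε'
  have hlog : 1 / 2 ≤ Real.log (1 / ε) := by
    have h1 : Real.log 2 ≤ Real.log (1 / ε) := by
      refine Real.log_le_log (by norm_num) ?_
      rw [le_div_iff₀ hε]
      linarith
    linarith [Real.log_two_gt_d9]
  refine ⟨K, hK, fun ω => ?_, fun i => ?_⟩
  · rw [OGT.run_rounds, Real.sqrt_div' _ (show 0 ≤ I.θ from hθ0.le)]
    refine hKle.trans ?_
    have h1 : √I.κ * Real.log (1 / ε) / I.θhat ≤ 4 * (√I.κ / √I.θ * Real.log (1 / ε)) := by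
      rw [div_le_iff₀ hθh]
      calc √I.κ * Real.log (1 / ε) = √I.κ / √I.θ * Real.log (1 / ε) * √I.θ := by field_simp
        _ ≤ √I.κ / √I.θ * Real.log (1 / ε) * (4 * I.θhat) := by gcongr
        _ = _ := by ring
    have h2 : 0 ≤ √I.κ / √I.θ * Real.log (1 / ε) := by positivity
    linarith
  · refine (OGT.integral_grads_le hr hs K i).trans ?_
    have hp : (OGT.explicitParams I).p = I.θhat / 60750 := rfl
    have hq : (OGT.explicitParams I).q = I.θhat / 60750 := rfl
    rw [hp, hq]
    have h1 : (K : ℝ) * (I.θhat / 60750 + I.θhat / 60750)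
        ≤ 6000002 * (√I.κ * Real.log (1 / ε) / I.θhat)
          * (I.θhat / 60750 + I.θhat / 60750) := by gcongr
    have h2 : 6000002 * (√I.κ * Real.log (1 / ε) / I.θhat) * (I.θhat / 60750 + I.θhat / 60750)
        = 12000004 / 60750 * (√I.κ * Real.log (1 / ε)) := by
      field_simp
      norm_num
    have h3 : 1 / 2 ≤ √I.κ * Real.log (1 / ε) := by nlinarith
    linarith
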